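/- Let $n\ge 1$, $m>0$, and let $\sigma\in L^\infty(\mathbf R)$ be real-valued. Let $y_1,y_2$ be linearly independent real solutions of $$y''(t)+\frac{\sigma(t)}{m}\,y(t)=0$$ (that is, $y_j$ and $y_j'$ are continuous and $y_j'(t)=y_j'(0)-\int_0^t\frac{\sigma(\tau)}{m}y_j(\tau)\,d\tau$), and assume that there are $0\le\lambda<1/2$, $c_{1,\pm}\in\mathbf R\setminus\{0\}$ and $c_{2,\pm}\in\mathbf R$ with $$\lim_{t\to\pm\infty}\frac{y_1(t)}{|t|^{1-\lambda}}=c_{1,\pm},\qquad \lim_{t\to\pm\infty}\frac{y_2(t)}{|t|^{\lambda}}=c_{2,\pm}.$$ Let $U_0(t,s)$ be the propagator of $H_0(t)=-\Delta/(2m)+\sigma(t)|x|^2/2$ on $L^2(\mathbf R^n)$, i.e. a strongly continuous family of unitary operators with $U_0(t,s)U_0(s,\tau)=U_0(t,\tau)$, $i\partial_tU_0(t,s)=H_0(t)U_0(t,s)$ and $i\partial_sU_0(t,s)=-U_0(t,s)H_0(s)$ (both equations integrated in time; the first tested against, the second applied to, Schwartz functions). Let $W=y_1'y_2-y_1y_2'$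 be the (constant) Wronskian. Call $r_0>0$ a cutoff radius if for all $t$ with $\pm t\ge r_0$ $$\tfrac12|c_{1,\pm}||t|^{1-\lambda}\le|y_1(t)|\le2|c_{1,\pm}||t|^{1-\lambda},\qquad \tfrac12|c_{2,\pm}||t|^{\lambda}\le|y_2(t)|\le2|c_{2,\pm}||t|^{\lambda},$$ and the integrals below converge absolutely with $$\left|\int_{\pm r_0}^{\pm\infty}\frac{W}{y_1(\tau)^2+y_2(\tau)^2}\,d\tau\right|<\frac\pi2 .$$ For such $r_0$ put $$\Omega_{0,\pm}=\{(t,s)\in\mathbf R^2\setminus[-r_0,r_0]^2:\ |t|/2\le|s|\le2|t|,\ \pm t\ge r_0,\ \pm s\ge r_0\},$$ $$\Omega_{\lambda,\pm}=\{(t,s)\in\mathbf R^2\setminus[-r_0,r_0]^2:\ |s|\le|t|/2\ \text{or}\ |s|\ge2|t|,\ \pm t\ge r_0,\ \pm s\ge r_0\}.$$ Then a cutoff radius exists, and for every cutoff radius $r_0$ there is a constant $C>0$ such that for all $2\le q\le\infty$, with $1/q+1/q'=1$, and all $\phi\in L^2(\mathbf R^n)\cap L^{q'}(\mathbf R^n)$,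 $$\|U_0(t,0)U_0(s,0)^*\phi\|_{L^q(\mathbf R^n)}\le C|t-s|^{-n(1/2-1/q)}\|\phi\|_{L^{q'}(\mathbf R^n)}\qquad\text{for }(t,s)\in\Omega_{0,\pm},$$ $$\|U_0(t,0)U_0(s,0)^*\phi\|_{L^q(\mathbf R^n)}\le C|t-s|^{-n(1-\lambda)(1/2-1/q)}\|\phi\|_{L^{q'}(\mathbf R^n)}\qquad\text{for }(t,s)\in\Omega_{\lambda,\pm}.$$ Here for $t=s$ a negative power of $|t-s|=0$ is read as $+\infty$, and $0^0=1$, $\infty\cdot 0=0$. -/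

import Mathlib

open MeasureTheory Filter Topology Set
open scoped ENNReal NNReal SchwartzMap Laplacian InnerProductSpace

noncomputable section

/-- The Hilbert space `L²(ℝⁿ)` of complex-valued functions. -/
abbrev L2Space (n : ℕ) : Type :=
  Lp ℂ 2 (volume : Measure (EuclideanSpace ℝ (Fin n)))

/-- `y` is a (Carathéodory) solution on `ℝ` of `y'' + (σ / m) y = 0`, where `σ` is only a bounded
measurable function: `y` and `y'` are continuous, and `y'` is the indefinite integral of
`-(σ / m) y`. -/
structure IsOscillatorSolution (m : ℝ) (σ y : ℝ → ℝ) : Prop where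
  contDiff : ContDiff ℝ 1 y
  deriv_eq : ∀ t : ℝ, deriv y t = deriv y 0 - ∫ τ in (0 : ℝ)..t, σ τ / m * y τ

/-- The standing assumption on the coefficient `σ ∈ L^∞(ℝ)`: there are linearly independent
solutions `y₁`, `y₂` of `y'' + (σ / m) y = 0` such that `y₁(t) / |t|^(1 - lam) → c₁p, c₁m` and
`y₂(t) / |t|^lam → c₂p, c₂m` as `t → +∞` and `t → -∞` respectively, with `0 ≤ lam < 1/2` and
`c₁p, c₁m ≠ 0`. -/
structure CoefficientAssumption (m : ℝ) (σ y₁ y₂ : ℝ → ℝ) (lam c₁p c₁m c₂p c₂m : ℝ) : Prop where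
  sigma_mem : MemLp σ ∞ (volume : Measure ℝ)
  sol₁ : IsOscillatorSolution m σ y₁
  sol₂ : IsOscillatorSolution m σ y₂
  indep : LinearIndependent ℝ ![y₁, y₂]
  lam_nonneg : 0 ≤ lam
  lam_lt : lam < 1 / 2
  c₁p_ne : c₁p ≠ 0
  c₁m_ne : c₁m ≠ 0
  lim₁p : Tendsto (fun t : ℝ => y₁ t / |t| ^ (1 - lam)) atTop (𝓝 c₁p)
  lim₁m : Tendsto (fun t : ℝ => y₁ t / |t| ^ (1 - lam)) atBot (𝓝 c₁m)
  lim₂p : Tendsto (fun t : ℝ => y₂ t / |t| ^ lam) atTop (𝓝 c₂p)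
  lim₂m : Tendsto (fun t : ℝ => y₂ t / |t| ^ lam) atBot (𝓝 c₂m)

/-- The Wronskian `W = y₁' y₂ - y₁ y₂'`, which is constant in time for solutions of
`y'' + (σ / m) y = 0`; it is evaluated at time `0`. -/
def wronskianConst (y₁ y₂ : ℝ → ℝ) : ℝ :=
  deriv y₁ 0 * y₂ 0 - y₁ 0 * deriv y₂ 0

/-- `r₀ > 0` is so large that for `|t| ≥ r₀` the functions `|y₁(t)|`, `|y₂(t)|` lie within a
factor `2` of `|c₁| |t|^(1 - lam)`, `|c₂| |t|^lam` (with the constants belonging to the sign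
of `t`), and each tail integral of `W / (y₁² + y₂²)` has absolute value less than `π / 2`. -/
structure IsCutoffRadius (y₁ y₂ : ℝ → ℝ) (lam c₁p c₁m c₂p c₂m r₀ : ℝ) : Prop where
  pos : 0 < r₀
  bound₁p : ∀ t : ℝ, r₀ ≤ t →
    |c₁p| / 2 * |t| ^ (1 - lam) ≤ |y₁ t| ∧ |y₁ t| ≤ 2 * |c₁p| * |t| ^ (1 - lam)
  bound₁m : ∀ t : ℝ, t ≤ -r₀ →
    |c₁m| / 2 * |t| ^ (1 - lam) ≤ |y₁ t| ∧ |y₁ t| ≤ 2 * |c₁m| * |t| ^ (1 - lam)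
  bound₂p : ∀ t : ℝ, r₀ ≤ t →
    |c₂p| / 2 * |t| ^ lam ≤ |y₂ t| ∧ |y₂ t| ≤ 2 * |c₂p| * |t| ^ lam
  bound₂m : ∀ t : ℝ, t ≤ -r₀ →
    |c₂m| / 2 * |t| ^ lam ≤ |y₂ t| ∧ |y₂ t| ≤ 2 * |c₂m| * |t| ^ lam
  integrable_p : IntegrableOn
    (fun τ => wronskianConst y₁ y₂ / (y₁ τ ^ 2 + y₂ τ ^ 2)) (Ioi r₀) volume
  integrable_m : IntegrableOn
    (fun τ => wronskianConst y₁ y₂ / (y₁ τ ^ 2 + y₂ τ ^ 2)) (Iio (-r₀)) volume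
  integral_p : |∫ τ in Ioi r₀, wronskianConst y₁ y₂ / (y₁ τ ^ 2 + y₂ τ ^ 2)| < Real.pi / 2
  integral_m : |∫ τ in Iio (-r₀), wronskianConst y₁ y₂ / (y₁ τ ^ 2 + y₂ τ ^ 2)| < Real.pi / 2

/-- The region of comparable times; `ε = 1` and `ε = -1` give the two signs. -/
def comparableRegion (r₀ ε : ℝ) : Set (ℝ × ℝ) :=
  {p | p ∉ Icc (-r₀) r₀ ×ˢ Icc (-r₀) r₀ ∧ |p.1| / 2 ≤ |p.2| ∧ |p.2| ≤ 2 * |p.1| ∧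
    r₀ ≤ ε * p.1 ∧ r₀ ≤ ε * p.2}

/-- The region of non-comparable times; `ε = 1` and `ε = -1` give the two signs. -/
def nonComparableRegion (r₀ ε : ℝ) : Set (ℝ × ℝ) :=
  {p | p ∉ Icc (-r₀) r₀ ×ˢ Icc (-r₀) r₀ ∧ (|p.2| ≤ |p.1| / 2 ∨ 2 * |p.1| ≤ |p.2|) ∧
    r₀ ≤ ε * p.1 ∧ r₀ ≤ ε * p.2}

/-- The Hamiltonian `-Δ / (2m) + a |x|² / 2` on Schwartz functions (at time `t`, `a = σ(t)`). -/
def hamiltonian (n : ℕ) (m a : ℝ) (f : 𝓢(EuclideanSpace ℝ (Fin n), ℂ)) :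
    𝓢(EuclideanSpace ℝ (Fin n), ℂ) :=
  -((1 / (2 * m)) • Δ f) +
    (a / 2) • SchwartzMap.smulLeftCLM ℂ (fun x : EuclideanSpace ℝ (Fin n) => ‖x‖ ^ 2) f

/-- The pointwise formula for the Hamiltonian, with the Laplacian of functions. -/
theorem hamiltonian_apply (n : ℕ) (m a : ℝ) (f : 𝓢(EuclideanSpace ℝ (Fin n), ℂ))
    (x : EuclideanSpace ℝ (Fin n)) :
    hamiltonian n m a f x =
      -((1 / (2 * m)) • Laplacian.laplacian (f : EuclideanSpace ℝ (Fin n) → ℂ) x) +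
        (a / 2 * ‖x‖ ^ 2) • f x := by
  have h : (fun x : EuclideanSpace ℝ (Fin n) => ‖x‖ ^ 2).HasTemperateGrowth := by fun_prop
  simp only [hamiltonian, add_apply, neg_apply, smul_apply,
    SchwartzMap.laplacian_apply, SchwartzMap.smulLeftCLM_apply_apply h, smul_smul]

/-- `U` is a propagator of `H₀(t) = -Δ / (2m) + σ(t) |x|² / 2` on `L²(ℝⁿ)`: a strongly continuous
family of unitary operators with `U(t,s) U(s,τ) = U(t,τ)` and
`i ∂ₜ U(t,s) = H₀(t) U(t,s)`, `i ∂ₛ U(t,s) = -U(t,s) H₀(s)`.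
As `σ` is only bounded and measurable, the two equations are integrated in time; the first one is
tested against Schwartz functions (a core of `H₀(t)`), the second one is applied to them. -/
structure IsPropagator (n : ℕ) (m : ℝ) (σ : ℝ → ℝ)
    (U : ℝ → ℝ → (L2Space n →L[ℂ] L2Space n)) : Prop where
  mem_unitary : ∀ t s : ℝ, U t s ∈ unitary (L2Space n →L[ℂ] L2Space n)
  comp : ∀ t s τ : ℝ, U t s ∘L U s τ = U t τ
  strongly_continuous : ∀ φ : L2Space n, Continuous fun p : ℝ × ℝ => U p.1 p.2 φ
  forward : ∀ (s t₁ t₂ : ℝ) (φ : L2Space n) (ψ : 𝓢(EuclideanSpace ℝ (Fin n), ℂ)),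
    inner ℂ (ψ.toLp 2 volume) (U t₂ s φ) - inner ℂ (ψ.toLp 2 volume) (U t₁ s φ) =
      -Complex.I * ∫ τ in t₁..t₂, inner ℂ ((hamiltonian n m (σ τ) ψ).toLp 2 volume) (U τ s φ)
  backward : ∀ (t s₁ s₂ : ℝ) (φ : 𝓢(EuclideanSpace ℝ (Fin n), ℂ)),
    U t s₂ (φ.toLp 2 volume) - U t s₁ (φ.toLp 2 volume) =
      Complex.I • ∫ τ in s₁..s₂, U t τ ((hamiltonian n m (σ τ) φ).toLp 2 volume)

end

/-! By the group law and unitarity, `U t 0 ∘ (U s 0)*` is `U t s`, so the claim is a dispersive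
estimate for the propagator. Let `z`, `e` solve the oscillator equation with data `(1, 0)` and `(0,
1)` at time `t`. For `e s ≠ 0`, `U t s` is an integral operator of Mehler type whose kernel has
constant modulus `(m / (2π |e s|)) ^ (n / 2)`. This gives the `L¹ → L^∞` bound
(`IsPropagator.ae_norm_apply_le`), and interpolation with unitarity on `L²`
(`eLpNorm_apply_le_of_L2_of_L1`) gives the `L^q' → L^q` bound.

The kernel is identified by duality. Gaussians with parameters moving along `gaussCurve` solve the
Schrödinger equation, so their pairing with an orbit of `U` is constant
(`IsPropagator.inner_gaussian_const`). At time `t` they are `exp (i⟨ξ,x⟩ - ‖x‖²/2)`, and at time `s`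
they are the kernel applied to these (`IsNormalizedPair.exists_kernel`). Varying `ξ` turns the
equality of pairings into an equality of Fourier transforms, which determines `U t s φ`.

Since `σ` is only bounded and measurable, second derivatives need not exist everywhere.
`DrivenDeriv` replaces them by first order expansions in `t` and in a Lipschitz primitive of `σ`.
Whenever the `σ` terms cancel, an ordinary derivative remains.

It remains to bound `|e s| = |y₁ s y₂ t - y₂ s y₁ t| / |W|` from below. As `(y₂ / y₁)' = -W / y₁²`
has constant sign where `y₁ ≠ 0`, the growth of `y₁` gives `|e s| ≳ |t - s|` for comparable times
and `|e s| ≳ |t - s| ^ (1 - lam)` otherwise. The same identity forces `c₂ ≠ 0`, on which the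
existence of a cutoff radius rests. -/

noncomputable section

/-! ### Calculus of first order expansions driven by a Lipschitz function. -/

section DrivenCalculus

variable {E F : Type*} [NormedAddCommGroup E] [NormedSpace ℝ E]
  [NormedAddCommGroup F] [NormedSpace ℝ F]

/-- `p` has the first order expansion `(u - t) a + (S u - S t) b` at `t`. If `S` is an indefinite
integral of `σ`, this is an everywhere version of `p' = a + σ b`. -/
def DrivenDeriv (S : ℝ → ℝ) (p : ℝ → E) (a b : E) (t : ℝ) : Prop :=
  (fun u => p u - p t - ((u - t) • a + (S u - S t) • b)) =o[𝓝 t] (fun u => u - t)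

theorem HasDerivAt.drivenDeriv {p : ℝ → E} {a : E} {t : ℝ} (h : HasDerivAt p a t) (S : ℝ → ℝ) :
    DrivenDeriv S p a 0 t := by
  simpa [DrivenDeriv] using hasDerivAt_iff_isLittleO.1 h

theorem DrivenDeriv.hasDerivAt {S : ℝ → ℝ} {p : ℝ → E} {a : E} {t : ℝ}
    (h : DrivenDeriv S p a 0 t) : HasDerivAt p a t := by
  rw [hasDerivAt_iff_isLittleO]
  simpa [DrivenDeriv] using h

theorem DrivenDeriv.congr_deriv {S : ℝ → ℝ} {p : ℝ → E} {a b a' b' : E} {t : ℝ}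
    (h : DrivenDeriv S p a b t) (ha : a = a') (hb : b = b') : DrivenDeriv S p a' b' t :=
  ha ▸ hb ▸ h

theorem DrivenDeriv.isBigO {S : ℝ → ℝ} {K : ℝ} (hS : ∀ t u, |S u - S t| ≤ K * |u - t|)
    {p : ℝ → E} {a b : E} {t : ℝ} (h : DrivenDeriv S p a b t) :
    (fun u => p u - p t) =O[𝓝 t] (fun u => u - t) := by
  have h1 : (fun u => (u - t) • a + (S u - S t) • b) =O[𝓝 t] (fun u => u - t) := by
    refine Asymptotics.IsBigO.of_bound (‖a‖ + K * ‖b‖) (Eventually.of_forall fun u => ?_)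
    refine (norm_add_le _ _).trans ?_
    rw [norm_smul, norm_smul, Real.norm_eq_abs, Real.norm_eq_abs]
    nlinarith [mul_le_mul_of_nonneg_right (hS t u) (norm_nonneg b)]
  simpa using (Asymptotics.IsLittleO.isBigO h).add h1

theorem DrivenDeriv.continuousAt {S : ℝ → ℝ} {K : ℝ} (hS : ∀ t u, |S u - S t| ≤ K * |u - t|)
    {p : ℝ → E} {a b : E} {t : ℝ} (h : DrivenDeriv S p a b t) : ContinuousAt p t := by
  have h1 : Tendsto (fun u => u - t) (𝓝 t) (𝓝 0) := by
    have : ContinuousAt (fun u : ℝ => u - t) t := by fun_prop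
    simpa [ContinuousAt] using this
  have := (h.isBigO hS).trans_tendsto h1
  simpa using! this.add_const (p t)

/-- The Lipschitz bound makes `p u - p t = O(u - t)`, so the differentiability error of `f` at `p t`
is `o(u - t)`, and `L` acts linearly on the expansion. The product rules below are instances. -/
theorem DrivenDeriv.comp {S : ℝ → ℝ} {K : ℝ} (hS : ∀ t u, |S u - S t| ≤ K * |u - t|)
    {p : ℝ → E} {a b : E} {t : ℝ} (h : DrivenDeriv S p a b t) {f : E → F} {L : E →L[ℝ] F}
    (hf : HasFDerivAt f L (p t)) : DrivenDeriv S (fun u => f (p u)) (L a) (L b) t := by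
  have h1 := (hf.isLittleO.comp_tendsto (h.continuousAt hS)).trans_isBigO (h.isBigO hS)
  have h2 := (L.isBigO_comp (fun u => p u - p t - ((u - t) • a + (S u - S t) • b))
    (𝓝 t)).trans_isLittleO h
  refine (h1.add h2).congr_left fun u => ?_
  simp only [Function.comp, map_sub, map_add, map_smul]
  abel

theorem DrivenDeriv.prodMk {S : ℝ → ℝ} {p : ℝ → E} {a b : E} {q : ℝ → F} {c d : F} {t : ℝ}
    (hp : DrivenDeriv S p a b t) (hq : DrivenDeriv S q c d t) :
    DrivenDeriv S (fun u => (p u, q u)) (a, c) (b, d) t := by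
  have := Asymptotics.IsLittleO.prod_left hp hq
  exact this

theorem DrivenDeriv.add {S : ℝ → ℝ} {p q : ℝ → E} {a b c d : E} {t : ℝ}
    (hp : DrivenDeriv S p a b t) (hq : DrivenDeriv S q c d t) :
    DrivenDeriv S (fun u => p u + q u) (a + c) (b + d) t := by
  refine (Asymptotics.IsLittleO.add hp hq).congr_left fun u => ?_
  simp only [smul_add]
  abel

theorem DrivenDeriv.mul {A : Type*} [NormedRing A] [NormedAlgebra ℝ A] {S : ℝ → ℝ} {K : ℝ}
    (hS : ∀ t u, |S u - S t| ≤ K * |u - t|)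
    {p q : ℝ → A} {a b c d : A} {t : ℝ}
    (hp : DrivenDeriv S p a b t) (hq : DrivenDeriv S q c d t) :
    DrivenDeriv S (fun u => p u * q u) (p t * c + a * q t) (p t * d + b * q t) t := by
  have h := (hp.prodMk hq).comp hS (f := fun x : A × A => x.1 * x.2)
    (hasFDerivAt_fst.mul' hasFDerivAt_snd)
  simpa using h

theorem DrivenDeriv.const_mul {A : Type*} [NormedRing A] [NormedAlgebra ℝ A] {S : ℝ → ℝ} {K : ℝ}
    (hS : ∀ t u, |S u - S t| ≤ K * |u - t|)
    {q : ℝ → A} {c d : A} {t : ℝ} (k : A)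
    (hq : DrivenDeriv S q c d t) :
    DrivenDeriv S (fun u => k * q u) (k * c) (k * d) t := by
  simpa using ((hasDerivAt_const t k).drivenDeriv S).mul hS hq

theorem DrivenDeriv.ofReal {S : ℝ → ℝ} {K : ℝ} (hS : ∀ t u, |S u - S t| ≤ K * |u - t|)
    {p : ℝ → ℝ} {a b : ℝ} {t : ℝ} (hp : DrivenDeriv S p a b t) :
    DrivenDeriv S (fun u => (p u : ℂ)) (a : ℂ) (b : ℂ) t :=
  hp.comp hS (Complex.ofRealCLM.hasFDerivAt)

/-- The source of every conservation law here: once the `σ` terms cancel, `p` has derivative zero at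
every point, so no almost everywhere differentiation theory is needed. -/
theorem eq_of_drivenDeriv_eq_zero {S : ℝ → ℝ} {p : ℝ → E} (h : ∀ t, DrivenDeriv S p 0 0 t)
    (t s : ℝ) : p t = p s :=
  is_const_of_deriv_eq_zero (fun t => (h t).hasDerivAt.differentiableAt)
    (fun t => (h t).hasDerivAt.deriv) t s

end DrivenCalculus

/-! ### Primitives of bounded measurable functions. -/

section Primitive

variable {F : Type*} [NormedAddCommGroup F] [NormedSpace ℝ F]

theorem MeasureTheory.MemLp.exists_ae_bound {σ : ℝ → ℝ} (hσ : MemLp σ ∞ volume) :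
    ∃ K : ℝ, 0 ≤ K ∧ ∀ᵐ t ∂(volume : Measure ℝ), |σ t| ≤ K := by
  refine ⟨(eLpNorm σ ∞ volume).toReal, ENNReal.toReal_nonneg, ?_⟩
  filter_upwards [ae_le_eLpNormEssSup (f := σ) (μ := volume)] with t ht
  have h2 := ENNReal.toReal_mono (by simpa using hσ.eLpNorm_ne_top) ht
  simpa using h2

theorem intervalIntegrable_of_memLp_top {σ : ℝ → ℝ} (hσ : MemLp σ ∞ volume) (a b : ℝ) :
    IntervalIntegrable σ volume a b :=
  ((hσ.locallyIntegrable le_top).integrableOn_isCompact isCompact_uIcc).intervalIntegrable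

theorem abs_primitive_sub_le {σ : ℝ → ℝ} {K : ℝ} (hσ : MemLp σ ∞ volume)
    (hK : ∀ᵐ t ∂(volume : Measure ℝ), |σ t| ≤ K) (t u : ℝ) :
    |(∫ τ in (0 : ℝ)..u, σ τ) - ∫ τ in (0 : ℝ)..t, σ τ| ≤ K * |u - t| := by
  rw [intervalIntegral.integral_interval_sub_left (intervalIntegrable_of_memLp_top hσ _ _)
    (intervalIntegrable_of_memLp_top hσ _ _), ← Real.norm_eq_abs]
  exact intervalIntegral.norm_integral_le_of_norm_le_const_ae (hK.mono fun _ h _ => h)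

/-- An integral of `σ • g` with `g` continuous is, to first order, an increment of the primitive
of `σ` times the value of `g`. -/
theorem isLittleO_integral_smul_sub [CompleteSpace F] {σ : ℝ → ℝ} (hσ : MemLp σ ∞ volume)
    {g : ℝ → F}
    (hg : Continuous g) (t : ℝ) :
    (fun u => (∫ τ in t..u, σ τ • g τ) -
      ((∫ τ in (0 : ℝ)..u, σ τ) - ∫ τ in (0 : ℝ)..t, σ τ) • g t) =o[𝓝 t] (fun u => u - t) := by
  obtain ⟨K, hK0, hK⟩ := hσ.exists_ae_bound
  have hI : ∀ a b, IntervalIntegrable (fun τ => σ τ • g τ) volume a b := fun a b =>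
    (intervalIntegrable_of_memLp_top hσ a b).smul_continuousOn hg.continuousOn
  have hI' : ∀ a b, IntervalIntegrable (fun τ => σ τ • g t) volume a b := fun a b =>
    (intervalIntegrable_of_memLp_top hσ a b).smul_continuousOn continuousOn_const
  rw [Asymptotics.isLittleO_iff]
  intro c hc
  have hd : 0 < c / (K + 1) := by positivity
  obtain ⟨δ, hδ, hgδ⟩ := Metric.continuousAt_iff.1 (hg.continuousAt (x := t)) _ hd
  filter_upwards [Metric.ball_mem_nhds t hδ] with u hu
  rw [intervalIntegral.integral_interval_sub_left (intervalIntegrable_of_memLp_top hσ _ _)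
    (intervalIntegrable_of_memLp_top hσ _ _), ← intervalIntegral.integral_smul_const,
    ← intervalIntegral.integral_sub (hI _ _) (hI' _ _)]
  rw [Real.norm_eq_abs]
  refine intervalIntegral.norm_integral_le_of_norm_le_const_ae (hK.mono fun τ h hτ => ?_)
  rw [← smul_sub, norm_smul, Real.norm_eq_abs]
  have hτ' : dist τ t < δ := by
    rw [Real.dist_eq]
    have h1 : |u - t| < δ := by simpa [Real.dist_eq] using hu
    refine lt_of_le_of_lt ?_ h1
    rcases le_total t u with h2 | h2
    · rw [uIoc_of_le h2] at hτ
      rw [abs_of_pos (by linarith [hτ.1]), abs_of_nonneg (by linarith)]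
      linarith [hτ.2]
    · rw [uIoc_of_ge h2] at hτ
      rw [abs_of_nonpos (by linarith [hτ.2]), abs_of_nonpos (by linarith)]
      linarith [hτ.1]
  have h3 := (hgδ hτ').le
  rw [dist_eq_norm] at h3
  calc |σ τ| * ‖g τ - g t‖ ≤ (K + 1) * (c / (K + 1)) := by
        gcongr
        linarith
    _ = c := by field_simp

theorem isLittleO_integral_sub [CompleteSpace F] {g : ℝ → F} (hg : Continuous g) (t : ℝ) :
    (fun u => (∫ τ in t..u, g τ) - (u - t) • g t) =o[𝓝 t] (fun u => u - t) := by
  have := (hg.integral_hasStrictDerivAt t t).hasDerivAt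
  rw [hasDerivAt_iff_isLittleO] at this
  simpa using this

end Primitive

/-! ### The oscillator equation: Wronskian and uniqueness. -/

section Oscillator

theorem IsOscillatorSolution.hasDerivAt {m : ℝ} {σ y : ℝ → ℝ} (h : IsOscillatorSolution m σ y)
    (t : ℝ) : HasDerivAt y (deriv y t) t :=
  (h.contDiff.differentiable one_ne_zero t).hasDerivAt

theorem IsOscillatorSolution.continuous_deriv {m : ℝ} {σ y : ℝ → ℝ}
    (h : IsOscillatorSolution m σ y) : Continuous (deriv y) :=
  h.contDiff.continuous_deriv le_rfl

/-- The driven form of `y' = v`, `v' = -(σ / m) y`, where `S` is a primitive of `σ`. -/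
structure IsDrivenSolution (S : ℝ → ℝ) (m : ℝ) (y v : ℝ → ℝ) : Prop where
  pos : ∀ t, HasDerivAt y (v t) t
  vel : ∀ t, DrivenDeriv S v 0 (-(y t / m)) t

theorem IsOscillatorSolution.isDrivenSolution {m : ℝ} {σ y : ℝ → ℝ} (hσ : MemLp σ ∞ volume)
    (h : IsOscillatorSolution m σ y) :
    IsDrivenSolution (fun t => ∫ τ in (0 : ℝ)..t, σ τ) m y (deriv y) := by
  refine ⟨h.hasDerivAt, fun t => ?_⟩
  have hc : Continuous fun τ => y τ / m := h.contDiff.continuous.div_const m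
  have hI : ∀ a b, IntervalIntegrable (fun τ => σ τ / m * y τ) volume a b := by
    intro a b
    have := (intervalIntegrable_of_memLp_top hσ a b).smul_continuousOn hc.continuousOn
    refine this.congr fun x _ => ?_
    simp only [smul_eq_mul]
    ring
  refine (isLittleO_integral_smul_sub hσ hc t).neg_left.congr_left fun u => ?_
  rw [h.deriv_eq u, h.deriv_eq t]
  have e : ∫ τ in t..u, σ τ • (y τ / m) = ∫ τ in t..u, σ τ / m * y τ := by
    refine intervalIntegral.integral_congr fun x _ => ?_
    simp only [smul_eq_mul]
    ring
  rw [e, ← intervalIntegral.integral_interval_sub_left (hI 0 u) (hI 0 t)]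
  simp only [smul_eq_mul]
  ring

theorem IsDrivenSolution.combination {S : ℝ → ℝ} {m : ℝ} {y v z w : ℝ → ℝ} {K : ℝ}
    (hS : ∀ t u, |S u - S t| ≤ K * |u - t|)
    (hy : IsDrivenSolution S m y v) (hz : IsDrivenSolution S m z w) (a b : ℝ) :
    IsDrivenSolution S m (fun t => a * y t + b * z t) (fun t => a * v t + b * w t) where
  pos t := ((hy.pos t).const_mul a).add ((hz.pos t).const_mul b)
  vel t := by
    refine (((hy.vel t).const_mul hS a).add ((hz.vel t).const_mul hS b)).congr_deriv ?_ ?_ <;> ring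

/-- Both products pick up the same `σ` coefficient `-(y z / m)` and the same ordinary derivative `v
w`, and these cancel in the difference. -/
theorem IsDrivenSolution.wronskian_eq {S : ℝ → ℝ} {m : ℝ} {y v z w : ℝ → ℝ} {K : ℝ}
    (hS : ∀ t u, |S u - S t| ≤ K * |u - t|)
    (hy : IsDrivenSolution S m y v) (hz : IsDrivenSolution S m z w) (t s : ℝ) :
    v t * z t - y t * w t = v s * z s - y s * w s := by
  have h : ∀ t, DrivenDeriv S (fun t => v t * z t + (-1) * (y t * w t)) 0 0 t := by
    intro t
    refine (((hy.vel t).mul hS ((hz.pos t).drivenDeriv S)).add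
      ((((hy.pos t).drivenDeriv S).mul hS (hz.vel t)).const_mul hS (-1))).congr_deriv ?_ ?_ <;> ring
  have := eq_of_drivenDeriv_eq_zero h t s
  linarith

theorem CoefficientAssumption.wronskian_eq {m : ℝ} {σ y₁ y₂ : ℝ → ℝ} {lam c₁p c₁m c₂p c₂m : ℝ}
    (hA : CoefficientAssumption m σ y₁ y₂ lam c₁p c₁m c₂p c₂m) (t : ℝ) :
    deriv y₁ t * y₂ t - y₁ t * deriv y₂ t = wronskianConst y₁ y₂ := by
  obtain ⟨K, -, hK⟩ := hA.sigma_mem.exists_ae_bound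
  exact (hA.sol₁.isDrivenSolution hA.sigma_mem).wronskian_eq
    (abs_primitive_sub_le hA.sigma_mem hK) (hA.sol₂.isDrivenSolution hA.sigma_mem) t 0

theorem deriv_comp_neg_apply {y : ℝ → ℝ} (t : ℝ) : deriv (fun u => y (-u)) t = -deriv y (-t) :=
  deriv_comp_neg y t

theorem IsOscillatorSolution.comp_neg {m : ℝ} {σ y : ℝ → ℝ} (h : IsOscillatorSolution m σ y) :
    IsOscillatorSolution m (fun t => σ (-t)) (fun t => y (-t)) where
  contDiff := h.contDiff.comp contDiff_neg
  deriv_eq t := by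
    rw [deriv_comp_neg_apply, deriv_comp_neg_apply, h.deriv_eq (-t), neg_zero]
    have := intervalIntegral.integral_comp_neg (a := 0) (b := t) (fun τ => σ τ / m * y τ)
    rw [this, neg_zero, intervalIntegral.integral_symm]
    ring

/-- Grönwall's argument on the integrated equation: with `E = |y| + |y'|` and `G` its integral, zero
data give `E ≤ L G`, so `exp (-L t) G` is nonincreasing from `0`. -/
theorem IsOscillatorSolution.eq_zero_of_nonneg {m : ℝ} {σ y : ℝ → ℝ} (hσ : MemLp σ ∞ volume)
    (h : IsOscillatorSolution m σ y) (h0 : y 0 = 0) (h0' : deriv y 0 = 0) {t : ℝ} (ht : 0 ≤ t) :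
    y t = 0 := by
  obtain ⟨K, hK0, hK⟩ := hσ.exists_ae_bound
  set L : ℝ := 1 + K / |m| with hL
  have hL0 : 0 ≤ L := by positivity
  have hcy := h.contDiff.continuous
  have hcv := h.continuous_deriv
  set E : ℝ → ℝ := fun t => |y t| + |deriv y t| with hE
  have hcE : Continuous E := hcy.abs.add hcv.abs
  set G : ℝ → ℝ := fun t => ∫ τ in (0 : ℝ)..t, E τ with hG
  have hGd : ∀ t, HasDerivAt G (E t) t := fun t =>
    (hcE.integral_hasStrictDerivAt 0 t).hasDerivAt
  have hbound : ∀ t, 0 ≤ t → E t ≤ L * G t := by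
    intro t ht
    have h1 : |y t| ≤ G t := by
      have e : y t = ∫ τ in (0 : ℝ)..t, deriv y τ := by
        rw [intervalIntegral.integral_deriv_eq_sub' y rfl
          (fun x _ => (h.hasDerivAt x).differentiableAt) hcv.continuousOn, h0, sub_zero]
      rw [e, ← Real.norm_eq_abs]
      refine (intervalIntegral.norm_integral_le_integral_norm ht).trans ?_
      refine intervalIntegral.integral_mono_on ht (hcv.norm.intervalIntegrable _ _)
        (hcE.intervalIntegrable _ _) fun x _ => ?_
      simp [hE]
    have h2 : |deriv y t| ≤ K / |m| * G t := by
      rw [h.deriv_eq t, h0', zero_sub, abs_neg, ← Real.norm_eq_abs,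
        ← intervalIntegral.integral_const_mul]
      refine intervalIntegral.norm_integral_le_of_norm_le ht ?_
        ((hcE.const_smul (K / |m|)).intervalIntegrable _ _)
      filter_upwards [hK] with x hx _
      rw [norm_mul, norm_div, Real.norm_eq_abs, Real.norm_eq_abs, Real.norm_eq_abs]
      simp only [hE]
      gcongr
      linarith [abs_nonneg (deriv y x)]
    calc E t ≤ G t + K / |m| * G t := add_le_add h1 h2
      _ = L * G t := by rw [hL]; ring
  have hanti : AntitoneOn (fun t => Real.exp (-L * t) * G t) (Ici 0) := by
    have hd : ∀ t, HasDerivAt (fun t => Real.exp (-L * t) * G t)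
        (Real.exp (-L * t) * (-L * 1) * G t + Real.exp (-L * t) * E t) t := fun t =>
      (((hasDerivAt_id t).const_mul (-L)).exp).mul (hGd t)
    refine antitoneOn_of_deriv_nonpos (convex_Ici 0)
      (fun t _ => (hd t).continuousAt.continuousWithinAt)
      (fun t _ => (hd t).differentiableAt.differentiableWithinAt) fun t ht => ?_
    rw [interior_Ici] at ht
    rw [(hd t).deriv]
    nlinarith [hbound t (le_of_lt ht), Real.exp_pos (-L * t)]
  have h3 := hanti (mem_Ici.2 le_rfl) (mem_Ici.2 ht) ht
  have hG0 : G 0 = 0 := by simp [hG]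
  simp only [hG0, mul_zero] at h3
  have h4 : G t ≤ 0 := nonpos_of_mul_nonpos_right h3 (Real.exp_pos _)
  have h5 := hbound t ht
  have h6 : |y t| ≤ 0 := by
    have : |y t| ≤ E t := by simp [hE]
    nlinarith
  exact abs_nonpos_iff.1 h6

theorem IsOscillatorSolution.eq_zero {m : ℝ} {σ y : ℝ → ℝ} (hσ : MemLp σ ∞ volume)
    (h : IsOscillatorSolution m σ y) (h0 : y 0 = 0) (h0' : deriv y 0 = 0) : y = 0 := by
  funext t
  rcases le_total 0 t with ht | ht
  · exact h.eq_zero_of_nonneg hσ h0 h0' ht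
  · have h1 : MemLp (fun t => σ (-t)) ∞ volume :=
      hσ.comp_measurePreserving (Measure.measurePreserving_neg volume)
    have := h.comp_neg.eq_zero_of_nonneg h1 (by simpa using h0)
      (by rw [deriv_comp_neg_apply]; simpa using h0') (t := -t) (by linarith)
    simpa using this

theorem IsOscillatorSolution.combination {m : ℝ} {σ y z : ℝ → ℝ} (hσ : MemLp σ ∞ volume)
    (hy : IsOscillatorSolution m σ y) (hz : IsOscillatorSolution m σ z) (a b : ℝ) :
    IsOscillatorSolution m σ (fun t => a * y t + b * z t) where
  contDiff := (contDiff_const.mul hy.contDiff).add (contDiff_const.mul hz.contDiff)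
  deriv_eq t := by
    have hd : ∀ t, deriv (fun t => a * y t + b * z t) t = a * deriv y t + b * deriv z t := fun t =>
      (((hy.hasDerivAt t).const_mul a).add ((hz.hasDerivAt t).const_mul b)).deriv
    have hI : ∀ x : ℝ → ℝ, IsOscillatorSolution m σ x →
        IntervalIntegrable (fun τ => σ τ / m * x τ) volume 0 t := fun x hx =>
      (((intervalIntegrable_of_memLp_top hσ 0 t).div_const m)).mul_continuousOn
        hx.contDiff.continuous.continuousOn
    rw [hd, hd, hy.deriv_eq t, hz.deriv_eq t]
    have : ∫ τ in (0 : ℝ)..t, σ τ / m * (a * y τ + b * z τ) =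
        a * (∫ τ in (0 : ℝ)..t, σ τ / m * y τ) + b * ∫ τ in (0 : ℝ)..t, σ τ / m * z τ := by
      rw [← intervalIntegral.integral_const_mul, ← intervalIntegral.integral_const_mul,
        ← intervalIntegral.integral_add ((hI y hy).const_mul a) ((hI z hz).const_mul b)]
      refine intervalIntegral.integral_congr fun x _ => ?_
      ring
    rw [this]
    ring

/-- A combination with zero Cauchy data at `0` vanishes by uniqueness, hence is trivial by
independence. If `W = 0`, the coefficients `(y₂, -y₁)` and `(y₂', -y₁')` at `0` give such
combinations; so all data vanish, and then `1 • y₁ + 0 • y₂` is a nontrivial one. -/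
theorem CoefficientAssumption.wronskianConst_ne_zero {m : ℝ} {σ y₁ y₂ : ℝ → ℝ}
    {lam c₁p c₁m c₂p c₂m : ℝ} (hA : CoefficientAssumption m σ y₁ y₂ lam c₁p c₁m c₂p c₂m) :
    wronskianConst y₁ y₂ ≠ 0 := by
  intro hW
  have key : ∀ a b : ℝ, a * y₁ 0 + b * y₂ 0 = 0 → a * deriv y₁ 0 + b * deriv y₂ 0 = 0 →
      a = 0 ∧ b = 0 := by
    intro a b h1 h2
    have h := (hA.sol₁.combination hA.sigma_mem hA.sol₂ a b).eq_zero hA.sigma_mem h1 (by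
      exact (((hA.sol₁.hasDerivAt 0).const_mul a).add
        ((hA.sol₂.hasDerivAt 0).const_mul b)).deriv.trans h2)
    refine LinearIndependent.pair_iff.1 hA.indep a b ?_
    funext t
    simpa using congrFun h t
  unfold wronskianConst at hW
  obtain ⟨h1, h2⟩ := key (y₂ 0) (-y₁ 0) (by ring) (by linarith)
  obtain ⟨h3, h4⟩ := key (deriv y₂ 0) (-deriv y₁ 0) (by linarith) (by ring)
  exact one_ne_zero (key 1 0 (by linarith) (by linarith)).1

end Oscillator

/-! ### Exponentials that are Schwartz functions. -/

section SchwartzExp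

variable {V : Type*} [NormedAddCommGroup V] [NormedSpace ℝ V]

/-- Induction through `D (exp P) = exp P • D P` and the Leibniz formula. All orders up to `k` are
bounded together because the formula involves every lower order. -/
theorem norm_iteratedFDeriv_cexp_le {P : V → ℂ} (hP : P.HasTemperateGrowth) (k : ℕ) :
    ∃ (C : ℝ) (N : ℕ), 0 ≤ C ∧ ∀ j ≤ k, ∀ x,
      ‖iteratedFDeriv ℝ j (fun x => Complex.exp (P x)) x‖ ≤
        C * (1 + ‖x‖) ^ N * ‖Complex.exp (P x)‖ := by
  have hf : ContDiff ℝ ((⊤ : ℕ∞) : WithTop ℕ∞) fun x => Complex.exp (P x) := hP.1.cexp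
  have hfd : fderiv ℝ (fun x => Complex.exp (P x)) = fun x => Complex.exp (P x) • fderiv ℝ P x := by
    funext x
    exact ((hP.1.differentiable (by simp)) x).hasFDerivAt.cexp.fderiv
  induction k with
  | zero =>
    refine ⟨1, 0, zero_le_one, fun j hj x => ?_⟩
    obtain rfl : j = 0 := by omega
    simp
  | succ k ih =>
    obtain ⟨C, N, hC, h⟩ := ih
    obtain ⟨N', C', hC', h'⟩ := hP.norm_iteratedFDeriv_le_uniform (k + 1)
    -- The summand `C` covers the orders up to `k`; the factor `2 ^ k` is the sum of the binomial
    -- coefficients in the Leibniz formula.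
    refine ⟨C + 2 ^ k * (C * C'), N + N', by positivity, fun j hj x => ?_⟩
    have h1 : 1 ≤ 1 + ‖x‖ := by linarith [norm_nonneg x]
    rcases Nat.lt_or_ge j (k + 1) with hj' | hj'
    · refine (h j (by omega) x).trans ?_
      gcongr
      · linarith [show 0 ≤ 2 ^ k * (C * C') by positivity]
      · omega
    · obtain rfl : j = k + 1 := by omega
      rw [← norm_iteratedFDeriv_fderiv, hfd]
      refine (norm_iteratedFDeriv_smul_le (N := ((⊤ : ℕ∞) : WithTop ℕ∞)) hf
        ((hP.1.fderiv_right (m := ((⊤ : ℕ∞) : WithTop ℕ∞)) (by simp))) x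
          (by exact_mod_cast le_top)).trans ?_
      have h2 : ∀ i ∈ Finset.range (k + 1), (k.choose i : ℝ) *
          ‖iteratedFDeriv ℝ i (fun x => Complex.exp (P x)) x‖ *
          ‖iteratedFDeriv ℝ (k - i) (fderiv ℝ P) x‖ ≤
          (k.choose i : ℝ) * ((C * C') * (1 + ‖x‖) ^ (N + N') * ‖Complex.exp (P x)‖) := by
        intro i hi
        have := Finset.mem_range.1 hi
        rw [norm_iteratedFDeriv_fderiv, mul_assoc]
        refine mul_le_mul_of_nonneg_left ?_ (Nat.cast_nonneg _)
        calc _ ≤ (C * (1 + ‖x‖) ^ N * ‖Complex.exp (P x)‖) * (C' * (1 + ‖x‖) ^ N') := by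
              gcongr
              · exact h i (by omega) x
              · exact h' _ (by omega) x
          _ = _ := by ring
      refine (Finset.sum_le_sum h2).trans ?_
      rw [← Finset.sum_mul]
      have h3 : ∑ i ∈ Finset.range (k + 1), (k.choose i : ℝ) = 2 ^ k := by
        exact_mod_cast Nat.sum_range_choose k
      rw [h3]
      have : 0 ≤ C * (1 + ‖x‖) ^ (N + N') * ‖Complex.exp (P x)‖ := by positivity
      nlinarith

/-- The power is at most `N! exp (1 + r)`; completing the square in the combined exponent removes
`r`. -/
theorem pow_mul_exp_quadratic_le (N : ℕ) {a b c : ℝ} (hc : 0 < c) {r : ℝ} (hr : 0 ≤ r) :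
    (1 + r) ^ N * Real.exp (a + b * r - c * r ^ 2) ≤
      N.factorial * Real.exp (1 + a + (1 + b) ^ 2 / (4 * c)) := by
  have h1 : (1 + r) ^ N ≤ N.factorial * Real.exp (1 + r) := by
    have := Real.pow_div_factorial_le_exp (x := 1 + r) (by linarith) N
    rwa [div_le_iff₀' (by positivity)] at this
  calc (1 + r) ^ N * Real.exp (a + b * r - c * r ^ 2)
      ≤ N.factorial * Real.exp (1 + r) * Real.exp (a + b * r - c * r ^ 2) := by gcongr
    _ = N.factorial * Real.exp (1 + r + (a + b * r - c * r ^ 2)) := by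
        rw [mul_assoc, ← Real.exp_add]
    _ ≤ _ := by
        refine mul_le_mul_of_nonneg_left (Real.exp_le_exp.2 ?_) (Nat.cast_nonneg _)
        have : (1 + b) ^ 2 / (4 * c) - (1 + b) * r + c * r ^ 2 =
            (1 + b - 2 * c * r) ^ 2 / (4 * c) := by
          field_simp
          ring
        have h2 : 0 ≤ (1 + b - 2 * c * r) ^ 2 / (4 * c) := by positivity
        linarith

/-- The exponential of a function of temperate growth whose real part is bounded by a negative
definite quadratic polynomial is a Schwartz function. -/
def schwartzExp (P : V → ℂ) (hP : P.HasTemperateGrowth)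
    (h : ∃ a b c : ℝ, 0 < c ∧ ∀ x, (P x).re ≤ a + b * ‖x‖ - c * ‖x‖ ^ 2) : 𝓢(V, ℂ) where
  toFun x := Complex.exp (P x)
  smooth' := hP.1.cexp
  decay' k n := by
    obtain ⟨a, b, c, hc, hPre⟩ := h
    obtain ⟨C, N, hC, hn⟩ := norm_iteratedFDeriv_cexp_le hP n
    refine ⟨C * ((k + N).factorial * Real.exp (1 + a + (1 + b) ^ 2 / (4 * c))), fun x => ?_⟩
    calc ‖x‖ ^ k * ‖iteratedFDeriv ℝ n (fun x => Complex.exp (P x)) x‖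
        ≤ (1 + ‖x‖) ^ k * (C * (1 + ‖x‖) ^ N * Real.exp (a + b * ‖x‖ - c * ‖x‖ ^ 2)) := by
          gcongr
          · linarith
          · refine (hn n le_rfl x).trans ?_
            rw [Complex.norm_exp]
            gcongr
            exact hPre x
      _ = C * ((1 + ‖x‖) ^ (k + N) * Real.exp (a + b * ‖x‖ - c * ‖x‖ ^ 2)) := by ring
      _ ≤ _ := mul_le_mul_of_nonneg_left (pow_mul_exp_quadratic_le _ hc (norm_nonneg x)) hC

end SchwartzExp

/-! ### Gaussians with complex parameters. -/

section Gaussian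

variable {V : Type*} [NormedAddCommGroup V] [InnerProductSpace ℝ V]

/-- The polynomial `α + β ⟨ξ, x⟩ - γ ‖x‖² / 2`, which is linear in `p = (α, β, γ)`. -/
def gaussExponent (ξ : V) (p : ℂ × ℂ × ℂ) (x : V) : ℂ :=
  p.1 + p.2.1 * (⟪ξ, x⟫_ℝ : ℝ) - p.2.2 / 2 * ((‖x‖ ^ 2 : ℝ) : ℂ)

theorem gaussExponent_add (ξ : V) (p q : ℂ × ℂ × ℂ) (x : V) :
    gaussExponent ξ (p + q) x = gaussExponent ξ p x + gaussExponent ξ q x := by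
  simp only [gaussExponent, Prod.fst_add, Prod.snd_add]
  ring

theorem gaussExponent_smul (ξ : V) (c : ℝ) (p : ℂ × ℂ × ℂ) (x : V) :
    gaussExponent ξ (c • p) x = c • gaussExponent ξ p x := by
  simp only [gaussExponent, Prod.smul_fst, Prod.smul_snd, Complex.real_smul]
  ring

theorem gaussExponent_hasTemperateGrowth (ξ : V) (p : ℂ × ℂ × ℂ) :
    (gaussExponent ξ p).HasTemperateGrowth := by
  have h1 : (fun x : V => ((⟪ξ, x⟫_ℝ : ℝ) : ℂ)).HasTemperateGrowth :=
    Function.Complex.hasTemperateGrowth_ofReal.comp (Function.hasTemperateGrowth_inner_right ξ)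
  have h2 : (fun x : V => ((‖x‖ ^ 2 : ℝ) : ℂ)).HasTemperateGrowth :=
    Function.Complex.hasTemperateGrowth_ofReal.comp (Function.hasTemperateGrowth_norm_sq V)
  exact ((Function.HasTemperateGrowth.const p.1).add
    ((Function.HasTemperateGrowth.const p.2.1).mul h1)).sub
    ((Function.HasTemperateGrowth.const (p.2.2 / 2)).mul h2)

theorem norm_gaussExponent_le (ξ : V) (p : ℂ × ℂ × ℂ) (x : V) :
    ‖gaussExponent ξ p x‖ ≤ ‖p‖ * ((2 + ‖ξ‖) * (1 + ‖x‖ ^ 2)) := by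
  have hp1 : ‖p.1‖ ≤ ‖p‖ := norm_fst_le p
  have hp2 : ‖p.2.1‖ ≤ ‖p‖ := (norm_fst_le p.2).trans (norm_snd_le p)
  have hp3 : ‖p.2.2‖ ≤ ‖p‖ := (norm_snd_le p.2).trans (norm_snd_le p)
  have hin : ‖((⟪ξ, x⟫_ℝ : ℝ) : ℂ)‖ ≤ ‖ξ‖ * (1 + ‖x‖ ^ 2) := by
    rw [Complex.norm_real]
    refine (norm_inner_le_norm ξ x).trans ?_
    gcongr
    nlinarith [sq_nonneg (‖x‖ - 1)]
  have hsq : ‖((‖x‖ ^ 2 : ℝ) : ℂ)‖ = ‖x‖ ^ 2 := by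
    rw [Complex.norm_real]
    simp
  calc ‖gaussExponent ξ p x‖
      ≤ ‖p.1‖ + ‖p.2.1‖ * ‖((⟪ξ, x⟫_ℝ : ℝ) : ℂ)‖ + ‖p.2.2‖ / 2 * ‖((‖x‖ ^ 2 : ℝ) : ℂ)‖ := by
        refine (norm_sub_le _ _).trans ?_
        refine add_le_add ((norm_add_le _ _).trans ?_) ?_
        · rw [norm_mul]
        · rw [norm_mul, norm_div]
          simp
    _ ≤ ‖p‖ + ‖p‖ * (‖ξ‖ * (1 + ‖x‖ ^ 2)) + ‖p‖ / 2 * ‖x‖ ^ 2 := by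
        rw [hsq]
        gcongr
    _ ≤ _ := by
        nlinarith [norm_nonneg p, mul_nonneg (norm_nonneg p) (sq_nonneg ‖x‖)]

theorem gaussExponent_re_le (ξ : V) {p : ℂ × ℂ × ℂ} (hp : 0 < p.2.2.re) :
    ∃ a b c : ℝ, 0 < c ∧ ∀ x, (gaussExponent ξ p x).re ≤ a + b * ‖x‖ - c * ‖x‖ ^ 2 := by
  refine ⟨p.1.re, ‖p.2.1‖ * ‖ξ‖, p.2.2.re / 2, by linarith, fun x => ?_⟩
  have h1 : (p.2.1 * (⟪ξ, x⟫_ℝ : ℝ)).re ≤ ‖p.2.1‖ * ‖ξ‖ * ‖x‖ := by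
    refine (Complex.re_le_norm _).trans ?_
    rw [norm_mul, mul_assoc, Complex.norm_real]
    gcongr
    exact norm_inner_le_norm ξ x
  have h2 : (p.2.2 / 2 * ((‖x‖ ^ 2 : ℝ) : ℂ)).re = p.2.2.re / 2 * ‖x‖ ^ 2 := by
    rw [Complex.re_mul_ofReal]
    simp
  simp only [gaussExponent, Complex.sub_re, Complex.add_re]
  linarith

/-- The Gaussian `exp (α + β ⟨ξ, x⟩ - γ ‖x‖² / 2)` as a Schwartz function (zero if `Re γ ≤ 0`). -/
def gaussian (ξ : V) (p : ℂ × ℂ × ℂ) : 𝓢(V, ℂ) :=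
  if hp : 0 < p.2.2.re then
    schwartzExp (gaussExponent ξ p) (gaussExponent_hasTemperateGrowth ξ p)
      (gaussExponent_re_le ξ hp)
  else 0

theorem gaussian_apply (ξ : V) {p : ℂ × ℂ × ℂ} (hp : 0 < p.2.2.re) (x : V) :
    gaussian ξ p x = Complex.exp (gaussExponent ξ p x) := by
  rw [gaussian, dif_pos hp]
  rfl

/-- Multiplication by the polynomial `α + β ⟨ξ, x⟩ - γ ‖x‖² / 2` on Schwartz functions. -/
def gaussMul (ξ : V) (q : ℂ × ℂ × ℂ) (f : 𝓢(V, ℂ)) : 𝓢(V, ℂ) :=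
  SchwartzMap.smulLeftCLM ℂ (gaussExponent ξ q) f

theorem gaussMul_apply (ξ : V) (q : ℂ × ℂ × ℂ) (f : 𝓢(V, ℂ)) (x : V) :
    gaussMul ξ q f x = gaussExponent ξ q x * f x := by
  rw [gaussMul, SchwartzMap.smulLeftCLM_apply_apply (gaussExponent_hasTemperateGrowth ξ q),
    smul_eq_mul]

end Gaussian

/-! ### Differentiability in `L²` of a Gaussian with respect to its parameters. -/

section GaussianDeriv

variable {V : Type*} [NormedAddCommGroup V] [InnerProductSpace ℝ V] [FiniteDimensional ℝ V]
  [MeasurableSpace V] [BorelSpace V]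

/-- The Fréchet derivative of the `L²`-valued map `p ↦ gaussian ξ p`. -/
def gaussDeriv (ξ : V) (p : ℂ × ℂ × ℂ) : (ℂ × ℂ × ℂ) →L[ℝ] Lp ℂ 2 (volume : Measure V) :=
  LinearMap.toContinuousLinearMap
    { toFun := fun q => (gaussMul ξ q (gaussian ξ p)).toLp 2 volume
      map_add' := fun q r => by
        have : gaussMul ξ (q + r) (gaussian ξ p) =
            gaussMul ξ q (gaussian ξ p) + gaussMul ξ r (gaussian ξ p) := by
          ext x
          simp only [gaussMul_apply, add_apply, gaussExponent_add, add_mul]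
        rw [this]
        exact map_add (SchwartzMap.toLpCLM ℝ ℂ 2 (volume : Measure V)) _ _
      map_smul' := fun c q => by
        have : gaussMul ξ (c • q) (gaussian ξ p) = c • gaussMul ξ q (gaussian ξ p) := by
          ext x
          simp only [gaussMul_apply, smul_apply, gaussExponent_smul, smul_mul_assoc]
        rw [this]
        exact map_smul (SchwartzMap.toLpCLM ℝ ℂ 2 (volume : Measure V)) _ _ }

theorem gaussDeriv_apply (ξ : V) (p q : ℂ × ℂ × ℂ) :
    gaussDeriv ξ p q = (gaussMul ξ q (gaussian ξ p)).toLp 2 volume := rfl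

/-- With `z`, `w` the exponents of `p`, `h`, the Taylor error is `e^z (e^w - 1 - w)`, of modulus at
most `|e^z| |w|² e^|w|`. Since `w` is linear in `h` and at most quadratic in `x`, a small `h` costs
only part of the Gaussian decay. The error is thus at most `‖h‖²` times one fixed Schwartz function.
-/
theorem hasFDerivAt_gaussian_toLp (ξ : V) {p : ℂ × ℂ × ℂ} (hp : 0 < p.2.2.re) :
    HasFDerivAt (fun p => (gaussian ξ p).toLp 2 (volume : Measure V)) (gaussDeriv ξ p) p := by
  set A : ℝ := 2 + ‖ξ‖ with hA
  have hA0 : 0 < A := by positivity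
  set ρ : ℝ := p.2.2.re / 4 with hρ
  have hρ0 : 0 < ρ := by rw [hρ]; linarith
  -- This shift adds exactly `ρ (1 + ‖x‖²)` to the exponent and halves `Re γ`, which therefore stays
  -- positive.
  set p' : ℂ × ℂ × ℂ := (p.1 + (ρ : ℂ), p.2.1, p.2.2 - 2 * (ρ : ℂ)) with hp'
  have hp'0 : 0 < p'.2.2.re := by
    simp only [hp', Complex.sub_re, Complex.mul_re, Complex.ofReal_re, Complex.re_ofNat,
      Complex.im_ofNat, Complex.ofReal_im]
    linarith
  -- Multiplication by this polynomial is multiplication by `1 + ‖x‖²`; two copies absorb `|w|²`.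
  set q₀ : ℂ × ℂ × ℂ := (1, 0, -2) with hq₀
  have hq₀x : ∀ x : V, gaussExponent ξ q₀ x = ((1 + ‖x‖ ^ 2 : ℝ) : ℂ) := fun x => by
    simp only [gaussExponent, hq₀]
    push_cast
    ring
  set M : 𝓢(V, ℂ) := gaussMul ξ q₀ (gaussMul ξ q₀ (gaussian ξ p')) with hM
  have hMx : ∀ x, ‖M x‖ = (1 + ‖x‖ ^ 2) ^ 2 * Real.exp ((gaussExponent ξ p x).re
      + ρ * (1 + ‖x‖ ^ 2)) := fun x => by
    have e : (gaussExponent ξ p' x).re = (gaussExponent ξ p x).re + ρ * (1 + ‖x‖ ^ 2) := by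
      have : gaussExponent ξ p' x = gaussExponent ξ p x + ((ρ * (1 + ‖x‖ ^ 2) : ℝ) : ℂ) := by
        simp only [gaussExponent, hp']
        push_cast
        ring
      rw [this, Complex.add_re, Complex.ofReal_re]
    rw [hM, gaussMul_apply, gaussMul_apply, gaussian_apply ξ hp'0, hq₀x, norm_mul, norm_mul,
      Complex.norm_exp, e, Complex.norm_real, Real.norm_of_nonneg (by positivity)]
    ring
  rw [hasFDerivAt_iff_isLittleO_nhds_zero]
  have hO : (fun h : ℂ × ℂ × ℂ => (gaussian ξ (p + h)).toLp 2 (volume : Measure V) -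
      (gaussian ξ p).toLp 2 volume - gaussDeriv ξ p h) =O[𝓝 0] fun h => ‖h‖ ^ 2 := by
    refine Asymptotics.IsBigO.of_bound (A ^ 2 * ‖M.toLp 2 (volume : Measure V)‖) ?_
    filter_upwards [Metric.ball_mem_nhds (0 : ℂ × ℂ × ℂ) (ε := ρ / A) (by positivity)] with h hh
    have hhρ : ‖h‖ * A ≤ ρ := by
      have := (mem_ball_zero_iff.1 hh).le
      rwa [le_div_iff₀ hA0] at this
    have hh2 : ‖h‖ ≤ ρ := by nlinarith [norm_nonneg h, norm_nonneg ξ]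
    have hph : 0 < (p + h).2.2.re := by
      have h1 : |h.2.2.re| ≤ ‖h‖ :=
        (Complex.abs_re_le_norm _).trans ((norm_snd_le h.2).trans (norm_snd_le h))
      have h2 := neg_abs_le h.2.2.re
      simp only [Prod.snd_add, Complex.add_re]
      linarith
    rw [norm_pow, norm_norm]
    have hle : ‖(gaussian ξ (p + h)).toLp 2 (volume : Measure V) -
      (gaussian ξ p).toLp 2 volume - gaussDeriv ξ p h‖ ≤
        (A ^ 2 * ‖h‖ ^ 2) * ‖M.toLp 2 (volume : Measure V)‖ := by
      refine Lp.norm_le_mul_norm_of_ae_le_mul ?_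
      rw [gaussDeriv_apply]
      filter_upwards [Lp.coeFn_sub ((gaussian ξ (p + h)).toLp 2 (volume : Measure V) -
        (gaussian ξ p).toLp 2 volume) ((gaussMul ξ h (gaussian ξ p)).toLp 2 volume),
        Lp.coeFn_sub ((gaussian ξ (p + h)).toLp 2 (volume : Measure V))
          ((gaussian ξ p).toLp 2 volume),
        (gaussian ξ (p + h)).coeFn_toLp 2 (volume : Measure V),
        (gaussian ξ p).coeFn_toLp 2 (volume : Measure V),
        (gaussMul ξ h (gaussian ξ p)).coeFn_toLp 2 (volume : Measure V),
        M.coeFn_toLp 2 (volume : Measure V)] with x h1 h2 h3 h4 h5 h6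
      rw [h1, Pi.sub_apply, h2, Pi.sub_apply, h3, h4, h5, h6, hMx, gaussMul_apply,
        gaussian_apply ξ hph, gaussian_apply ξ hp, gaussExponent_add, Complex.exp_add]
      set w := gaussExponent ξ h x
      set z := gaussExponent ξ p x
      have hw : ‖w‖ ≤ ‖h‖ * (A * (1 + ‖x‖ ^ 2)) := norm_gaussExponent_le ξ h x
      have hw' : ‖w‖ ≤ ρ * (1 + ‖x‖ ^ 2) := by
        refine hw.trans ?_
        rw [← mul_assoc]
        gcongr
      have hexp : ‖Complex.exp w - 1 - w‖ ≤ ‖w‖ ^ 2 * Real.exp ‖w‖ := by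
        have := Complex.norm_exp_sub_sum_le_norm_mul_exp w 2
        simpa [Finset.sum_range_succ, sub_sub] using this
      calc ‖Complex.exp z * Complex.exp w - Complex.exp z - w * Complex.exp z‖
          = Real.exp z.re * ‖Complex.exp w - 1 - w‖ := by
            rw [← Complex.norm_exp, ← norm_mul]
            congr 1
            ring
        _ ≤ Real.exp z.re * ((‖h‖ * (A * (1 + ‖x‖ ^ 2))) ^ 2 *
              Real.exp (ρ * (1 + ‖x‖ ^ 2))) := by
            gcongr
            refine hexp.trans ?_
            gcongr
        _ = _ := by
            rw [Real.exp_add]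
            ring
    calc _ ≤ _ := hle
      _ = _ := by ring
  refine hO.trans_isLittleO ?_
  have := Asymptotics.isLittleO_norm_pow_id (E' := ℂ × ℂ × ℂ) (n := 2) (by norm_num)
  exact this

end GaussianDeriv

/-! ### The Hamiltonian acting on a Gaussian. -/

section GaussianLaplacian

open LineDeriv

variable {V : Type*} [NormedAddCommGroup V] [InnerProductSpace ℝ V]

/-- Along a line the exponent is a quadratic polynomial in `t`, from which directional derivatives
are read off. -/
theorem gaussExponent_add_smul (ξ : V) (p : ℂ × ℂ × ℂ) (x e : V) (t : ℝ) :
    gaussExponent ξ p (x + t • e) = gaussExponent ξ p x +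
      ((t : ℂ) * (p.2.1 * (⟪ξ, e⟫_ℝ : ℝ) - p.2.2 * (⟪x, e⟫_ℝ : ℝ)) -
        (t : ℂ) ^ 2 * (p.2.2 / 2 * ((‖e‖ ^ 2 : ℝ) : ℂ))) := by
  simp only [gaussExponent, norm_add_sq_real, inner_add_right, real_inner_smul_right, norm_smul,
    Real.norm_eq_abs, mul_pow, sq_abs]
  push_cast
  ring

theorem hasDerivAt_cexp_gaussExponent (ξ : V) (p : ℂ × ℂ × ℂ) (x e : V) :
    HasDerivAt (fun t : ℝ => Complex.exp (gaussExponent ξ p (x + t • e)))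
      ((p.2.1 * (⟪ξ, e⟫_ℝ : ℝ) - p.2.2 * (⟪x, e⟫_ℝ : ℝ)) *
        Complex.exp (gaussExponent ξ p x)) 0 := by
  simp only [gaussExponent_add_smul]
  set k := p.2.1 * (⟪ξ, e⟫_ℝ : ℝ) - p.2.2 * (⟪x, e⟫_ℝ : ℝ)
  set l := p.2.2 / 2 * ((‖e‖ ^ 2 : ℝ) : ℂ)
  have ht : HasDerivAt (fun t : ℝ => (t : ℂ)) 1 0 := Complex.ofRealCLM.hasDerivAt
  have h := (((ht.mul_const k).sub ((ht.pow 2).mul_const l)).const_add (gaussExponent ξ p x)).cexp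
  refine h.congr_deriv ?_
  simp
  ring

theorem lineDeriv_gaussian_apply (ξ : V) {p : ℂ × ℂ × ℂ} (hp : 0 < p.2.2.re) (e x : V) :
    ∂_{e} (gaussian ξ p) x =
      (p.2.1 * (⟪ξ, e⟫_ℝ : ℝ) - p.2.2 * (⟪x, e⟫_ℝ : ℝ)) * Complex.exp (gaussExponent ξ p x) := by
  rw [SchwartzMap.lineDerivOp_apply, lineDeriv]
  simp only [gaussian_apply ξ hp]
  exact (hasDerivAt_cexp_gaussExponent ξ p x e).deriv

theorem lineDeriv_lineDeriv_gaussian_apply (ξ : V) {p : ℂ × ℂ × ℂ} (hp : 0 < p.2.2.re) (e x : V) :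
    ∂_{e} (∂_{e} (gaussian ξ p)) x =
      ((p.2.1 * (⟪ξ, e⟫_ℝ : ℝ) - p.2.2 * (⟪x, e⟫_ℝ : ℝ)) ^ 2 - p.2.2 * ((‖e‖ ^ 2 : ℝ) : ℂ)) *
        Complex.exp (gaussExponent ξ p x) := by
  rw [SchwartzMap.lineDerivOp_apply, lineDeriv]
  simp only [lineDeriv_gaussian_apply ξ hp]
  have ht : HasDerivAt (fun t : ℝ => (t : ℂ)) 1 0 := Complex.ofRealCLM.hasDerivAt
  have h1 : HasDerivAt (fun t : ℝ => p.2.1 * (⟪ξ, e⟫_ℝ : ℝ) - p.2.2 * (⟪x + t • e, e⟫_ℝ : ℝ))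
      (-(p.2.2 * ((‖e‖ ^ 2 : ℝ) : ℂ))) 0 := by
    have h2 : ∀ t : ℝ, p.2.1 * (⟪ξ, e⟫_ℝ : ℝ) - p.2.2 * (⟪x + t • e, e⟫_ℝ : ℝ) =
        p.2.1 * (⟪ξ, e⟫_ℝ : ℝ) - p.2.2 * (⟪x, e⟫_ℝ : ℝ) +
          (t : ℂ) * -(p.2.2 * ((‖e‖ ^ 2 : ℝ) : ℂ)) := fun t => by
      rw [inner_add_left, real_inner_smul_left, real_inner_self_eq_norm_sq]
      push_cast
      ring
    simp only [h2]
    have h3 := (ht.mul_const (-(p.2.2 * ((‖e‖ ^ 2 : ℝ) : ℂ)))).const_add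
      (p.2.1 * (⟪ξ, e⟫_ℝ : ℝ) - p.2.2 * (⟪x, e⟫_ℝ : ℝ))
    rwa [one_mul] at h3
  refine (h1.mul (hasDerivAt_cexp_gaussExponent ξ p x e)).deriv.trans ?_
  simp only [zero_smul, add_zero]
  ring

theorem laplacian_gaussian {n : ℕ} (ξ : EuclideanSpace ℝ (Fin n)) {p : ℂ × ℂ × ℂ}
    (hp : 0 < p.2.2.re) :
    Δ (gaussian ξ p) = gaussMul ξ (p.2.1 ^ 2 * ((‖ξ‖ ^ 2 : ℝ) : ℂ) - n * p.2.2,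
      -2 * p.2.1 * p.2.2, -2 * p.2.2 ^ 2) (gaussian ξ p) := by
  ext x
  rw [SchwartzMap.laplacian_eq_sum (EuclideanSpace.basisFun (Fin n) ℝ), sum_apply, gaussMul_apply,
    gaussian_apply ξ hp]
  simp only [lineDeriv_lineDeriv_gaussian_apply ξ hp]
  rw [← Finset.sum_mul]
  congr 1
  have e1 : ∀ i, ‖(EuclideanSpace.basisFun (Fin n) ℝ) i‖ = 1 := fun i =>
    (EuclideanSpace.basisFun (Fin n) ℝ).norm_eq_one i
  have hx : ∑ i, ⟪x, (EuclideanSpace.basisFun (Fin n) ℝ) i⟫_ℝ ^ 2 = ‖x‖ ^ 2 := by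
    have := (EuclideanSpace.basisFun (Fin n) ℝ).sum_inner_mul_inner x x
    rw [real_inner_self_eq_norm_sq] at this
    rw [← this]
    exact Finset.sum_congr rfl fun i _ => by rw [sq, real_inner_comm x]
  have hξ : ∑ i, ⟪ξ, (EuclideanSpace.basisFun (Fin n) ℝ) i⟫_ℝ ^ 2 = ‖ξ‖ ^ 2 := by
    have := (EuclideanSpace.basisFun (Fin n) ℝ).sum_inner_mul_inner ξ ξ
    rw [real_inner_self_eq_norm_sq] at this
    rw [← this]
    exact Finset.sum_congr rfl fun i _ => by rw [sq, real_inner_comm ξ]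
  have hξx : ∑ i, ⟪ξ, (EuclideanSpace.basisFun (Fin n) ℝ) i⟫_ℝ *
      ⟪x, (EuclideanSpace.basisFun (Fin n) ℝ) i⟫_ℝ = ⟪ξ, x⟫_ℝ := by
    rw [← (EuclideanSpace.basisFun (Fin n) ℝ).sum_inner_mul_inner ξ x]
    exact Finset.sum_congr rfl fun i _ => by rw [real_inner_comm x]
  simp only [e1, gaussExponent]
  rw [← hx, ← hξ, ← hξx]
  push_cast
  simp only [one_pow, mul_one, Finset.sum_sub_distrib, sub_sq, Finset.sum_add_distrib,
    Finset.mul_sum, Finset.sum_const, Finset.card_univ, Fintype.card_fin, nsmul_eq_mul]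
  simp only [mul_pow, ← Finset.mul_sum]
  have : ∀ i, 2 * (p.2.1 * (⟪ξ, (EuclideanSpace.basisFun (Fin n) ℝ) i⟫_ℝ : ℂ)) *
      (p.2.2 * (⟪x, (EuclideanSpace.basisFun (Fin n) ℝ) i⟫_ℝ : ℂ)) = 2 * p.2.1 * p.2.2 *
      ((⟪ξ, (EuclideanSpace.basisFun (Fin n) ℝ) i⟫_ℝ : ℂ) *
        (⟪x, (EuclideanSpace.basisFun (Fin n) ℝ) i⟫_ℝ : ℂ)) := fun i => by ring
  simp only [this, ← Finset.mul_sum]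
  ring

/-- The vector field on Gaussian parameters generated by the free part of the Hamiltonian. -/
def gaussField (n : ℕ) (m : ℝ) (ξ : EuclideanSpace ℝ (Fin n)) (p : ℂ × ℂ × ℂ) : ℂ × ℂ × ℂ :=
  (Complex.I / (2 * m) * (p.2.1 ^ 2 * ((‖ξ‖ ^ 2 : ℝ) : ℂ) - n * p.2.2),
    -(Complex.I / m) * p.2.1 * p.2.2, -(Complex.I / m) * p.2.2 ^ 2)

/-- The Hamiltonian maps a Gaussian to a quadratic polynomial times itself, that is, to a tangent
vector of the Gaussian family. Hence the Schrödinger equation on this family is the parameter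
equation `p' = gaussField p + σ (0, 0, i)`, whose last component is a Riccati equation for `γ`. -/
theorem hamiltonian_gaussian {n : ℕ} (m a : ℝ) (ξ : EuclideanSpace ℝ (Fin n)) {p : ℂ × ℂ × ℂ}
    (hp : 0 < p.2.2.re) :
    hamiltonian n m a (gaussian ξ p) = Complex.I • (gaussMul ξ (gaussField n m ξ p) (gaussian ξ p) +
      a • gaussMul ξ (0, 0, Complex.I) (gaussian ξ p)) := by
  have h : (fun x : EuclideanSpace ℝ (Fin n) => ‖x‖ ^ 2).HasTemperateGrowth := by fun_prop
  ext x
  rw [hamiltonian, laplacian_gaussian ξ hp]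
  simp only [add_apply, neg_apply, smul_apply, SchwartzMap.smulLeftCLM_apply_apply h,
    gaussMul_apply, gaussExponent, gaussField, Complex.real_smul, smul_eq_mul]
  set G := gaussian ξ p x
  push_cast
  linear_combination (-(1 / (2 * (m : ℂ))) *
    (p.2.1 ^ 2 * (‖ξ‖ : ℂ) ^ 2 - n * p.2.2 - 2 * p.2.1 * p.2.2 * (⟪ξ, x⟫_ℝ : ℂ) +
      p.2.2 ^ 2 * (‖x‖ : ℂ) ^ 2) * G + (a : ℂ) / 2 * (‖x‖ : ℂ) ^ 2 * G) * Complex.I_sq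

end GaussianLaplacian

/-! ### Pairing moving Gaussians with orbits of the propagator. -/

section Propagator

variable {n : ℕ}

theorem inner_real_smul_left_complex {H : Type*} [NormedAddCommGroup H] [InnerProductSpace ℂ H]
    [Module ℝ H] [IsScalarTower ℝ ℂ H] (r : ℝ) (x y : H) :
    inner ℂ (r • x) y = r • inner ℂ x y := by
  rw [← algebraMap_smul ℂ r x, inner_smul_left, Complex.coe_algebraMap, Complex.conj_ofReal,
    Complex.real_smul]

/-- A product rule in which `w` itself need not be differentiable: `p u - p t` is paired with `w u →
w t` in norm, and only the scalar function `⟨p t, w u⟩` needs an expansion. This suits orbits of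
`U`, which satisfy the equation weakly. -/
theorem DrivenDeriv.inner_left {H : Type*} [NormedAddCommGroup H] [InnerProductSpace ℂ H]
    {S : ℝ → ℝ} {K : ℝ} (hS : ∀ t u, |S u - S t| ≤ K * |u - t|)
    {p w : ℝ → H} {a b : H} {c d : ℂ} {t : ℝ} (hp : DrivenDeriv S p a b t)
    (hw : ContinuousAt w t) (hpw : DrivenDeriv S (fun u => inner ℂ (p t) (w u)) c d t) :
    DrivenDeriv S (fun u => inner ℂ (p u) (w u)) (inner ℂ a (w t) + c) (inner ℂ b (w t) + d) t := by
  have hw1 : w =O[𝓝 t] (fun _ => (1 : ℝ)) := hw.isBigO_one ℝ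
  have hw0 : (fun u => w u - w t) =o[𝓝 t] (fun _ => (1 : ℝ)) := by
    rw [Asymptotics.isLittleO_one_iff]
    simpa using! hw.sub_const (w t)
  have hSO : (fun u => (u - t) • a + (S u - S t) • b) =O[𝓝 t] (fun u => u - t) := by
    refine Asymptotics.IsBigO.of_bound (‖a‖ + K * ‖b‖) (Eventually.of_forall fun u => ?_)
    refine (norm_add_le _ _).trans ?_
    rw [norm_smul, norm_smul, Real.norm_eq_abs, Real.norm_eq_abs]
    nlinarith [mul_le_mul_of_nonneg_right (hS t u) (norm_nonneg b)]
  have hinner : ∀ f g : ℝ → H, (fun u => inner ℂ (f u) (g u)) =O[𝓝 t]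
      fun u => ‖f u‖ * ‖g u‖ := fun f g =>
    Asymptotics.IsBigO.of_bound 1 (Eventually.of_forall fun u => by
      rw [norm_mul, norm_norm, norm_norm, one_mul]
      exact norm_inner_le_norm _ _)
  have h1 : (fun u => inner ℂ (p u - p t - ((u - t) • a + (S u - S t) • b)) (w u)) =o[𝓝 t]
      fun u => u - t := by
    refine (hinner _ _).trans_isLittleO ?_
    simpa using (Asymptotics.IsLittleO.norm_left hp).mul_isBigO hw1.norm_left
  have h2 : (fun u => inner ℂ ((u - t) • a + (S u - S t) • b) (w u - w t)) =o[𝓝 t]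
      fun u => u - t := by
    refine (hinner _ _).trans_isLittleO ?_
    simpa using hSO.norm_left.mul_isLittleO hw0.norm_left
  refine ((h1.add h2).add hpw).congr_left fun u => ?_
  simp only [inner_sub_left, inner_add_left, inner_sub_right, inner_real_smul_left_complex,
    smul_add]
  ring

theorem hamiltonian_gaussian_toLp (m a : ℝ) (ξ : EuclideanSpace ℝ (Fin n)) {p : ℂ × ℂ × ℂ}
    (hp : 0 < p.2.2.re) :
    (hamiltonian n m a (gaussian ξ p)).toLp 2 volume =
      Complex.I • (gaussDeriv ξ p (gaussField n m ξ p) + a • gaussDeriv ξ p (0, 0, Complex.I)) := by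
  rw [hamiltonian_gaussian m a ξ hp]
  simp only [gaussDeriv_apply]
  have h1 := map_smul (SchwartzMap.toLpCLM ℂ ℂ 2 (volume : Measure (EuclideanSpace ℝ (Fin n))))
    Complex.I (gaussMul ξ (gaussField n m ξ p) (gaussian ξ p) +
      a • gaussMul ξ (0, 0, Complex.I) (gaussian ξ p))
  have h2 := map_add (SchwartzMap.toLpCLM ℝ ℂ 2 (volume : Measure (EuclideanSpace ℝ (Fin n))))
    (gaussMul ξ (gaussField n m ξ p) (gaussian ξ p))
    (a • gaussMul ξ (0, 0, Complex.I) (gaussian ξ p))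
  have h3 := map_smul (SchwartzMap.toLpCLM ℝ ℂ 2 (volume : Measure (EuclideanSpace ℝ (Fin n)))) a
    (gaussMul ξ (0, 0, Complex.I) (gaussian ξ p))
  simp only [SchwartzMap.toLpCLM_apply] at h1 h2 h3
  rw [h1, h2, h3]

/-- The weak equation tested on a Gaussian frozen in time. The integrand splits into a continuous
part and `σ` times a continuous part; the factor `i` pulled out of the conjugate-linear slot meets
`-i`, which produces the sign. -/
theorem IsPropagator.drivenDeriv_inner_gaussian {m : ℝ} {σ : ℝ → ℝ}
    {U : ℝ → ℝ → (L2Space n →L[ℂ] L2Space n)} (hσ : MemLp σ ∞ volume) (hU : IsPropagator n m σ U)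
    (ξ : EuclideanSpace ℝ (Fin n)) {p : ℂ × ℂ × ℂ} (hp : 0 < p.2.2.re) (r : ℝ) (φ : L2Space n)
    (t : ℝ) :
    DrivenDeriv (fun t => ∫ τ in (0 : ℝ)..t, σ τ)
      (fun u => inner ℂ ((gaussian ξ p).toLp 2 volume) (U u r φ))
      (-inner ℂ (gaussDeriv ξ p (gaussField n m ξ p)) (U t r φ))
      (-inner ℂ (gaussDeriv ξ p (0, 0, Complex.I)) (U t r φ)) t := by
  set a := gaussDeriv ξ p (gaussField n m ξ p)
  set b := gaussDeriv ξ p (0, 0, Complex.I)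
  have hc : Continuous fun u => U u r φ :=
    (hU.strongly_continuous φ).comp (by fun_prop : Continuous fun u : ℝ => (u, r))
  have hca : Continuous fun u => inner ℂ a (U u r φ) := continuous_const.inner hc
  have hcb : Continuous fun u => inner ℂ b (U u r φ) := continuous_const.inner hc
  refine ((isLittleO_integral_sub hca t).add
    (isLittleO_integral_smul_sub hσ hcb t)).neg_left.congr_left fun u => ?_
  rw [hU.forward r t u φ (gaussian ξ p)]
  have e : ∀ τ, inner ℂ ((hamiltonian n m (σ τ) (gaussian ξ p)).toLp 2 volume) (U τ r φ) =
      -Complex.I * (inner ℂ a (U τ r φ) + σ τ • inner ℂ b (U τ r φ)) := fun τ => by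
    rw [hamiltonian_gaussian_toLp m _ ξ hp, inner_smul_left, inner_add_left,
      inner_real_smul_left_complex, Complex.conj_I]
  simp only [e]
  rw [intervalIntegral.integral_const_mul, intervalIntegral.integral_add
    (hca.intervalIntegrable _ _)
    ((intervalIntegrable_of_memLp_top hσ _ _).smul_continuousOn hcb.continuousOn)]
  simp only [smul_neg]
  linear_combination -((∫ τ in t..u, inner ℂ a (U τ r φ)) +
    ∫ τ in t..u, σ τ • inner ℂ b (U τ r φ)) * Complex.I_sq

/-- A curve of Gaussians that formally solves the Schrödinger equation has constant inner product
with every orbit of the propagator. -/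
theorem IsPropagator.inner_gaussian_const {m : ℝ} {σ : ℝ → ℝ}
    {U : ℝ → ℝ → (L2Space n →L[ℂ] L2Space n)} (hσ : MemLp σ ∞ volume) (hU : IsPropagator n m σ U)
    (ξ : EuclideanSpace ℝ (Fin n)) {p : ℝ → ℂ × ℂ × ℂ} (hp : ∀ t, 0 < (p t).2.2.re)
    (hd : ∀ t, DrivenDeriv (fun t => ∫ τ in (0 : ℝ)..t, σ τ) p (gaussField n m ξ (p t))
      (0, 0, Complex.I) t) (r : ℝ) (φ : L2Space n) (t s : ℝ) :
    inner ℂ ((gaussian ξ (p t)).toLp 2 volume) (U t r φ) =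
      inner ℂ ((gaussian ξ (p s)).toLp 2 volume) (U s r φ) := by
  obtain ⟨K, -, hK⟩ := hσ.exists_ae_bound
  have hS := abs_primitive_sub_le hσ hK
  refine eq_of_drivenDeriv_eq_zero (S := fun t => ∫ τ in (0 : ℝ)..t, σ τ)
    (p := fun t => inner ℂ ((gaussian ξ (p t)).toLp 2 volume) (U t r φ)) (fun t => ?_) t s
  have hc : Continuous fun u => U u r φ :=
    (hU.strongly_continuous φ).comp (by fun_prop : Continuous fun u : ℝ => (u, r))
  -- The motion of the Gaussian cancels that of the orbit, separately in the `t` and in the `σ`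
  -- coefficient.
  refine (((hd t).comp hS (hasFDerivAt_gaussian_toLp ξ (hp t))).inner_left hS hc.continuousAt
    (hU.drivenDeriv_inner_gaussian hσ ξ (hp t) r φ t)).congr_deriv ?_ ?_ <;>
  exact add_neg_cancel _

end Propagator

/-! ### Explicit solution of the Gaussian parameter equation. -/

section GaussianCurve

/-- Two driven solutions with the initial values `(1, 0)` and `(0, 1)` at time `t`. -/
structure IsNormalizedPair (S : ℝ → ℝ) (m t : ℝ) (z vz e ve : ℝ → ℝ) : Prop where
  sol₁ : IsDrivenSolution S m z vz
  sol₂ : IsDrivenSolution S m e ve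
  pos₁ : z t = 1
  vel₁ : vz t = 0
  pos₂ : e t = 0
  vel₂ : ve t = 1

/-- The complex combination `z + (i / m) e`. -/
def complexCombination (m : ℝ) (z e : ℝ → ℝ) (τ : ℝ) : ℂ := z τ + Complex.I / m * e τ

/-- The parameters of the Gaussian solution equal to `exp (i ⟨ξ, x⟩ - ‖x‖² / 2)` at time `t`. -/
def gaussCurve (n : ℕ) (m t : ℝ) (z vz e ve : ℝ → ℝ) (ξ : EuclideanSpace ℝ (Fin n)) (τ : ℝ) :
    ℂ × ℂ × ℂ :=
  (-(n / 2 : ℂ) * (∫ r in t..τ, complexCombination m vz ve r / complexCombination m z e r) -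
      Complex.I / (2 * m) * ((‖ξ‖ ^ 2 : ℝ) : ℂ) * (e τ * (complexCombination m z e τ)⁻¹),
    Complex.I * (complexCombination m z e τ)⁻¹,
    -(Complex.I * m) * (complexCombination m vz ve τ * (complexCombination m z e τ)⁻¹))

variable {S : ℝ → ℝ} {K m t : ℝ} {z vz e ve : ℝ → ℝ}

theorem IsNormalizedPair.wronskian (hS : ∀ t u, |S u - S t| ≤ K * |u - t|)
    (h : IsNormalizedPair S m t z vz e ve) (τ : ℝ) : z τ * ve τ - vz τ * e τ = 1 := by
  have := h.sol₁.wronskian_eq hS h.sol₂ τ t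
  rw [h.pos₁, h.vel₁, h.pos₂, h.vel₂] at this
  linarith

/-- The real and imaginary parts are `z` and `e / m`; a common zero would contradict the Wronskian
being `1`. -/
theorem IsNormalizedPair.complexCombination_ne_zero (hm : m ≠ 0)
    (hS : ∀ t u, |S u - S t| ≤ K * |u - t|)
    (h : IsNormalizedPair S m t z vz e ve) (τ : ℝ) : complexCombination m z e τ ≠ 0 := by
  intro h0
  have hre := congrArg Complex.re h0
  have him := congrArg Complex.im h0
  have e1 : Complex.I / (m : ℂ) * (e τ : ℂ) = ((e τ / m : ℝ) : ℂ) * Complex.I := by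
    push_cast
    ring
  rw [complexCombination, e1] at hre him
  simp at hre him
  have he : e τ = 0 := by tauto
  have := h.wronskian hS τ
  rw [hre, he] at this
  simp at this

theorem IsNormalizedPair.hasDerivAt (h : IsNormalizedPair S m t z vz e ve) (τ : ℝ) :
    HasDerivAt (complexCombination m z e) (complexCombination m vz ve τ) τ :=
  ((h.sol₁.pos τ).ofReal_comp).add (((h.sol₂.pos τ).ofReal_comp).const_mul _)

theorem IsNormalizedPair.drivenDeriv (hS : ∀ t u, |S u - S t| ≤ K * |u - t|)
    (h : IsNormalizedPair S m t z vz e ve) (τ : ℝ) :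
    DrivenDeriv S (complexCombination m vz ve) 0 (-(complexCombination m z e τ / m)) τ := by
  refine (((h.sol₁.vel τ).ofReal hS).add (((h.sol₂.vel τ).ofReal hS).const_mul hS
    (Complex.I / m))).congr_deriv ?_ ?_
  · simp
  · rw [complexCombination]
    push_cast
    ring

theorem IsNormalizedPair.continuous_quotient (hm : m ≠ 0)
    (hS : ∀ t u, |S u - S t| ≤ K * |u - t|) (h : IsNormalizedPair S m t z vz e ve) :
    Continuous fun r => complexCombination m vz ve r / complexCombination m z e r := by
  have h1 : Continuous (complexCombination m z e) :=
    continuous_iff_continuousAt.2 fun τ => (h.hasDerivAt τ).continuousAt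
  have h2 : Continuous (complexCombination m vz ve) :=
    continuous_iff_continuousAt.2 fun τ => (h.drivenDeriv hS τ).continuousAt hS
  exact h2.div h1 (h.complexCombination_ne_zero hm hS)

/-- With `Q = z + (i/m) e`, the Wronskian identity gives `Re γ = 1 / |Q|²`. -/
theorem IsNormalizedPair.gaussCurve_re_pos (n : ℕ) (hm : 0 < m)
    (hS : ∀ t u, |S u - S t| ≤ K * |u - t|) (h : IsNormalizedPair S m t z vz e ve)
    (ξ : EuclideanSpace ℝ (Fin n)) (τ : ℝ) :
    0 < (gaussCurve n m t z vz e ve ξ τ).2.2.re := by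
  have hQ := h.complexCombination_ne_zero hm.ne' hS τ
  have hW := h.wronskian hS τ
  have key : (gaussCurve n m t z vz e ve ξ τ).2.2.re =
      (Complex.normSq (complexCombination m z e τ))⁻¹ := by
    have e1 : ∀ z e : ℝ → ℝ, complexCombination m z e τ = ⟨z τ, e τ / m⟩ := fun z e => by
      apply Complex.ext
      · simp [complexCombination, Complex.div_re, Complex.div_im]
      · simp [complexCombination, Complex.div_re, Complex.div_im]
        field_simp
    have hN : Complex.normSq (complexCombination m z e τ) ≠ 0 := by
      simpa [Complex.normSq_eq_zero] using hQ
    simp only [gaussCurve]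
    rw [Complex.inv_def, e1 vz ve]
    generalize hNN : Complex.normSq (complexCombination m z e τ) = N at hN ⊢
    rw [e1 z e]
    simp
    have : m * (ve τ / m * (z τ * N⁻¹) + -(vz τ * (e τ / m * N⁻¹))) = N⁻¹ := by
      field_simp
      linarith
    linarith
  rw [key]
  exact inv_pos.2 (Complex.normSq_pos.2 hQ)

/-- The substitution `γ = -i m Q' / Q` linearises the Riccati equation, since `Q` solves the
oscillator equation. Then `β = i / Q`, and `α` integrates because `(e / Q)' = 1 / Q²`. -/
theorem IsNormalizedPair.gaussCurve_drivenDeriv (n : ℕ) (hm : 0 < m)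
    (hS : ∀ t u, |S u - S t| ≤ K * |u - t|) (h : IsNormalizedPair S m t z vz e ve)
    (ξ : EuclideanSpace ℝ (Fin n)) (τ : ℝ) :
    DrivenDeriv S (gaussCurve n m t z vz e ve ξ)
      (gaussField n m ξ (gaussCurve n m t z vz e ve ξ τ)) (0, 0, Complex.I) τ := by
  have hQ := h.complexCombination_ne_zero hm.ne' hS τ
  have hW := h.wronskian hS τ
  have hmC : (m : ℂ) ≠ 0 := by exact_mod_cast hm.ne'
  have hQd := h.hasDerivAt τ
  have hint : HasDerivAt (fun τ => ∫ r in t..τ, complexCombination m vz ve r /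
      complexCombination m z e r) (complexCombination m vz ve τ / complexCombination m z e τ) τ :=
    ((h.continuous_quotient hm.ne' hS).integral_hasStrictDerivAt t τ).hasDerivAt
  -- The part of `Q` proportional to `e` drops out of the Wronskian of `e` and `Q`.
  have hWC : (ve τ : ℂ) * complexCombination m z e τ - e τ * complexCombination m vz ve τ = 1 := by
    have : (z τ : ℂ) * ve τ - vz τ * e τ = 1 := by exact_mod_cast hW
    simp only [complexCombination]
    linear_combination this
  have h1 := ((hint.const_mul (-(n / 2 : ℂ))).sub
    (((h.sol₂.pos τ).ofReal_comp.mul (hQd.inv hQ)).const_mul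
      (Complex.I / (2 * m) * ((‖ξ‖ ^ 2 : ℝ) : ℂ)))).drivenDeriv S
  have h2 := ((hQd.inv hQ).const_mul Complex.I).drivenDeriv S
  have h3 := ((h.drivenDeriv hS τ).mul hS ((hQd.inv hQ).drivenDeriv S)).const_mul hS
    (-(Complex.I * m))
  refine (h1.prodMk (h2.prodMk h3)).congr_deriv ?_ ?_
  · simp only [gaussField, gaussCurve, Pi.inv_apply]
    generalize complexCombination m z e τ = Q at hQ hWC ⊢
    generalize complexCombination m vz ve τ = P at hWC ⊢
    refine Prod.ext ?_ (Prod.ext ?_ ?_)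
    · simp only
      have hI := Complex.I_sq
      field_simp
      linear_combination (-(Complex.I * ((‖ξ‖ ^ 2 : ℝ) : ℂ))) * hWC +
        (-Complex.I * ((‖ξ‖ ^ 2 : ℝ) : ℂ) - m * n * P * Q) * hI
    · simp only
      have hI := Complex.I_sq
      field_simp
      linear_combination -P * hI
    · simp only
      have hI := Complex.I_sq
      field_simp
      linear_combination P ^ 2 * hI
  · refine Prod.ext rfl (Prod.ext rfl ?_)
    simp only [Pi.inv_apply]
    field_simp
    ring

theorem IsNormalizedPair.gaussCurve_self (n : ℕ) (h : IsNormalizedPair S m t z vz e ve)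
    (hm : m ≠ 0) (ξ : EuclideanSpace ℝ (Fin n)) :
    gaussCurve n m t z vz e ve ξ t = (0, Complex.I, 1) := by
  have hmC : (m : ℂ) ≠ 0 := by exact_mod_cast hm
  simp only [gaussCurve, complexCombination, h.pos₁, h.pos₂, h.vel₁, h.vel₂]
  refine Prod.ext (by simp) (Prod.ext (by simp) ?_)
  simp
  field_simp
  linear_combination -Complex.I_sq

/-- The integral is a continuous logarithm of `Q`, so `α` contains a well defined branch of `Q ^
(-n/2)`. The proof checks that `Q exp (-J)` has zero derivative. -/
theorem IsNormalizedPair.exp_integral_quotient (hm : m ≠ 0)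
    (hS : ∀ t u, |S u - S t| ≤ K * |u - t|) (h : IsNormalizedPair S m t z vz e ve) (τ : ℝ) :
    Complex.exp (∫ r in t..τ, complexCombination m vz ve r / complexCombination m z e r) =
      complexCombination m z e τ := by
  set J : ℝ → ℂ := fun τ => ∫ r in t..τ, complexCombination m vz ve r / complexCombination m z e r
  have hint : ∀ τ, HasDerivAt J (complexCombination m vz ve τ / complexCombination m z e τ) τ :=
    fun τ => ((h.continuous_quotient hm hS).integral_hasStrictDerivAt t τ).hasDerivAt
  have hd : ∀ τ, HasDerivAt (fun τ => complexCombination m z e τ * Complex.exp (-J τ)) 0 τ := by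
    intro τ
    have hQ := h.complexCombination_ne_zero hm hS τ
    refine ((h.hasDerivAt τ).mul (hint τ).neg.cexp).congr_deriv ?_
    field_simp
    ring
  have h1 := is_const_of_deriv_eq_zero (fun τ => (hd τ).differentiableAt)
    (fun τ => (hd τ).deriv) τ t
  have h2 : complexCombination m z e t = 1 := by simp [complexCombination, h.pos₁, h.pos₂]
  simp only [h2] at h1
  have h3 : J t = 0 := intervalIntegral.integral_same
  rw [h3, neg_zero, Complex.exp_zero, mul_one, Complex.exp_neg] at h1
  have h4 := Complex.exp_ne_zero (J τ)
  field_simp at h1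
  exact h1.symm

end GaussianCurve

/-! ### The integral kernel on Gaussians. -/

section Kernel

variable {S : ℝ → ℝ} {K m t : ℝ} {z vz e ve : ℝ → ℝ}

/-- The phase of the integral kernel of the propagator. -/
def kernelPhase {n : ℕ} (m a b D : ℝ) (y x : EuclideanSpace ℝ (Fin n)) : ℝ :=
  m / (2 * D) * (b * ‖y‖ ^ 2 - 2 * ⟪x, y⟫_ℝ + a * ‖x‖ ^ 2)

/-- The phase is real, so the integrand is a Gaussian with quadratic coefficient of real part `1/2`
and frequency `ξ - (m/D) y`. -/
theorem integral_kernel_gaussian {n : ℕ} (m a b D : ℝ) (ξ y : EuclideanSpace ℝ (Fin n)) :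
    ∫ x, Complex.exp (Complex.I * kernelPhase m a b D y x) *
        Complex.exp (gaussExponent ξ (0, Complex.I, 1) x) =
      (Real.pi / ((1 - Complex.I * m * a / D) / 2) : ℂ) ^ (n / 2 : ℂ) *
        Complex.exp (Complex.I * m * b / (2 * D) * ‖y‖ ^ 2 -
          (‖ξ‖ ^ 2 - 2 * (m / D) * ⟪ξ, y⟫_ℝ + (m / D) ^ 2 * ‖y‖ ^ 2) /
            (2 * (1 - Complex.I * m * a / D))) := by
  have hb : 0 < ((1 - Complex.I * m * a / D) / 2 : ℂ).re := by
    have : (1 - Complex.I * m * a / D : ℂ) / 2 = ((1 / 2 : ℝ) : ℂ) +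
        ((-(m * a / D) / 2 : ℝ) : ℂ) * Complex.I := by
      push_cast
      ring
    rw [this]
    simp
  have h := GaussianFourier.integral_cexp_neg_mul_sq_norm_add hb Complex.I (ξ - (m / D) • y)
  rw [finrank_euclideanSpace, Fintype.card_fin] at h
  have e1 : ∀ x : EuclideanSpace ℝ (Fin n),
      Complex.exp (Complex.I * kernelPhase m a b D y x) *
        Complex.exp (gaussExponent ξ (0, Complex.I, 1) x) =
      Complex.exp (Complex.I * m * b / (2 * D) * ‖y‖ ^ 2) *
        Complex.exp (-((1 - Complex.I * m * a / D) / 2) * ‖x‖ ^ 2 +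
          Complex.I * ⟪ξ - (m / D) • y, x⟫_ℝ) := fun x => by
    rw [← Complex.exp_add, ← Complex.exp_add]
    congr 1
    simp only [kernelPhase, gaussExponent, inner_sub_left, real_inner_smul_left,
      real_inner_comm x y]
    push_cast
    ring
  simp only [e1]
  rw [integral_const_mul, h, mul_left_comm, ← Complex.exp_add]
  congr 2
  have e2 : ((‖ξ - (m / D) • y‖ : ℝ) : ℂ) ^ 2 =
      ‖ξ‖ ^ 2 - 2 * (m / D) * ⟪ξ, y⟫_ℝ + (m / D) ^ 2 * ‖y‖ ^ 2 := by
    have := norm_sub_sq_real ξ ((m / D) • y)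
    rw [norm_smul, real_inner_smul_right, mul_pow, Real.norm_eq_abs, sq_abs] at this
    rw [← Complex.ofReal_pow, this]
    push_cast
    ring
  rw [e2, Complex.I_sq]
  have e3 : (4 * ((1 - Complex.I * m * a / D) / 2) : ℂ) = 2 * (1 - Complex.I * m * a / D) := by ring
  rw [e3]
  ring

/-- Both sides are Gaussians in `y` with matching exponents, and `c` is the quotient of their
prefactors, independent of `ξ` and `y`. Branches of the power `n/2` affect only its phase; in the
modulus `|Q|` cancels. -/
theorem IsNormalizedPair.exists_kernel (n : ℕ) (hm : 0 < m)
    (hS : ∀ t u, |S u - S t| ≤ K * |u - t|) (h : IsNormalizedPair S m t z vz e ve) {s : ℝ}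
    (hs : e s ≠ 0) :
    ∃ c : ℂ, ‖c‖ = (m / (2 * Real.pi * |e s|)) ^ (n / 2 : ℝ) ∧
      ∀ ξ y : EuclideanSpace ℝ (Fin n),
        Complex.exp (gaussExponent ξ (gaussCurve n m t z vz e ve ξ s) y) =
          c * ∫ x, Complex.exp (Complex.I * kernelPhase m (z s) (ve s) (e s) y x) *
            Complex.exp (gaussExponent ξ (0, Complex.I, 1) x) := by
  have hQ := h.complexCombination_ne_zero hm.ne' hS s
  have hW := h.wronskian hS s
  have hmC : (m : ℂ) ≠ 0 := by exact_mod_cast hm.ne'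
  have hsC : (e s : ℂ) ≠ 0 := by exact_mod_cast hs
  have hWC : (ve s : ℂ) * complexCombination m z e s - e s * complexCombination m vz ve s = 1 := by
    have : (z s : ℂ) * ve s - vz s * e s = 1 := by exact_mod_cast hW
    simp only [complexCombination]
    linear_combination this
  have hB : (1 - Complex.I * m * z s / e s : ℂ) =
      -(Complex.I * m) * complexCombination m z e s / e s := by
    simp only [complexCombination]
    field_simp
    linear_combination (e s : ℂ) * Complex.I_sq
  set J := ∫ r in t..s, complexCombination m vz ve r / complexCombination m z e r with hJ
  have hexpJ := h.exp_integral_quotient hm.ne' hS s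
  rw [← hJ] at hexpJ
  set Q := complexCombination m z e s with hQdef
  have hbase : ‖(Real.pi / ((1 - Complex.I * m * z s / e s) / 2) : ℂ)‖ =
      2 * Real.pi * |e s| / (m * ‖Q‖) := by
    rw [hB]
    simp [abs_of_pos Real.pi_pos, abs_of_pos hm]
    field_simp
  have hQ0 : 0 < ‖Q‖ := norm_pos_iff.2 hQ
  have he0 : 0 < |e s| := abs_pos.2 hs
  have hpi := Real.pi_pos
  have hpow : ‖(Real.pi / ((1 - Complex.I * m * z s / e s) / 2) : ℂ) ^ (n / 2 : ℂ)‖ =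
      (2 * Real.pi * |e s| / (m * ‖Q‖)) ^ (n / 2 : ℝ) := by
    rw [← hbase, ← Complex.norm_cpow_real]
    push_cast
    rfl
  have hne : (Real.pi / ((1 - Complex.I * m * z s / e s) / 2) : ℂ) ^ (n / 2 : ℂ) ≠ 0 := by
    rw [← norm_ne_zero_iff, hpow]
    positivity
  refine ⟨Complex.exp (-(n / 2 : ℂ) * J) /
    (Real.pi / ((1 - Complex.I * m * z s / e s) / 2) : ℂ) ^ (n / 2 : ℂ), ?_, fun ξ y => ?_⟩
  · rw [norm_div, hpow]
    have e1 : ‖Complex.exp (-(n / 2 : ℂ) * J)‖ = (‖Q‖⁻¹) ^ (n / 2 : ℝ) := by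
      rw [← hexpJ, Complex.norm_exp, Complex.norm_exp, ← Real.exp_neg, ← Real.exp_mul]
      congr 1
      have : (-(n / 2 : ℂ) * J) = ((-(n / 2) : ℝ) : ℂ) * J := by push_cast; ring
      rw [this, Complex.re_ofReal_mul]
      ring
    rw [e1, ← Real.div_rpow (by positivity) (by positivity)]
    congr 1
    field_simp
  · rw [integral_kernel_gaussian, ← mul_assoc, div_mul_cancel₀ _ hne, ← Complex.exp_add]
    congr 1
    simp only [gaussExponent, gaussCurve]
    rw [← hJ, ← hQdef, hB]
    generalize complexCombination m vz ve s = P at hWC ⊢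
    have hI := Complex.I_sq
    have hI0 := Complex.I_ne_zero
    push_cast
    field_simp
    linear_combination ((m : ℂ) ^ 2 * (‖y‖ : ℂ) ^ 2) * hWC +
      (-(‖ξ‖ : ℂ) ^ 2 * e s ^ 2 + 2 * m * e s * (⟪ξ, y⟫_ℝ : ℂ) + m ^ 2 * P * (‖y‖ : ℂ) ^ 2 * e s -
        m ^ 2 * Q * (‖y‖ : ℂ) ^ 2 * ve s) * hI

end Kernel

/-! ### Injectivity of the Fourier transform on integrable functions. -/

section FourierInjective

open scoped FourierTransform

/-- Each test function is the Fourier transform of a Schwartz function, and the transform can be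
moved onto `f`, where it vanishes. -/
theorem ae_eq_zero_of_fourier_eq_zero {V : Type*} [NormedAddCommGroup V] [InnerProductSpace ℝ V]
    [FiniteDimensional ℝ V] [MeasurableSpace V] [BorelSpace V] {f : V → ℂ} (hf : Integrable f)
    (h : ∀ w, 𝓕 f w = 0) : f =ᵐ[volume] 0 := by
  refine ae_eq_zero_of_integral_contDiff_smul_eq_zero hf.locallyIntegrable fun g hg hgc => ?_
  have hgc' : HasCompactSupport fun x => (g x : ℂ) :=
    hgc.comp_left (g := fun r : ℝ => (r : ℂ)) (by simp)
  have hg' : ContDiff ℝ ((⊤ : ℕ∞) : WithTop ℕ∞) fun x => (g x : ℂ) :=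
    Complex.ofRealCLM.contDiff.comp hg
  set ψ : 𝓢(V, ℂ) := hgc'.toSchwartzMap hg' with hψ
  have h1 : ∀ x, (𝓕 ((𝓕⁻ ψ : 𝓢(V, ℂ)) : V → ℂ)) x = (g x : ℂ) := fun x => by
    have : 𝓕 (𝓕⁻ ψ) = ψ := FourierTransform.fourier_fourierInv_eq ψ
    have h2 := congrArg (fun u : 𝓢(V, ℂ) => u x) this
    exact h2
  have h3 := VectorFourier.integral_fourierIntegral_smul_eq_flip (μ := (volume : Measure V))
    (ν := (volume : Measure V)) (L := innerₗ V) (f := ((𝓕⁻ ψ : 𝓢(V, ℂ)) : V → ℂ)) (g := f)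
    Real.continuous_fourierChar continuous_inner (𝓕⁻ ψ : 𝓢(V, ℂ)).integrable hf
  have h4 : ∀ x, VectorFourier.fourierIntegral Real.fourierChar volume (innerₗ V).flip f x = 0 := by
    intro x
    rw [flip_innerₗ]
    exact h x
  simp only [h4, smul_zero, integral_zero] at h3
  rw [← h3]
  refine integral_congr_ae (Eventually.of_forall fun x => ?_)
  have := h1 x
  change g x • f x = ((𝓕 ((𝓕⁻ ψ : 𝓢(V, ℂ)) : V → ℂ)) x) • f x
  rw [this]
  simp

end FourierInjective

/-! ### The dispersive estimate. -/

section Dispersive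

open scoped FourierTransform ComplexConjugate

variable {n : ℕ}

theorem inner_gaussian_toLp (ξ : EuclideanSpace ℝ (Fin n)) {p : ℂ × ℂ × ℂ} (hp : 0 < p.2.2.re)
    (φ : L2Space n) :
    inner ℂ ((gaussian ξ p).toLp 2 volume) φ =
      ∫ x, conj (Complex.exp (gaussExponent ξ p x)) * φ x := by
  rw [L2.inner_def]
  refine integral_congr_ae ?_
  filter_upwards [(gaussian ξ p).coeFn_toLp 2 (volume : Measure (EuclideanSpace ℝ (Fin n)))]
    with x hx
  rw [hx, gaussian_apply ξ hp, RCLike.inner_apply, mul_comm]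

theorem integrable_conj_gaussian_mul (ξ : EuclideanSpace ℝ (Fin n)) {p : ℂ × ℂ × ℂ}
    (hp : 0 < p.2.2.re) (φ : L2Space n) :
    Integrable fun x => conj (Complex.exp (gaussExponent ξ p x)) * φ x := by
  refine (L2.integrable_inner (𝕜 := ℂ) ((gaussian ξ p).toLp 2 volume) φ).congr ?_
  filter_upwards [(gaussian ξ p).coeFn_toLp 2 (volume : Measure (EuclideanSpace ℝ (Fin n)))]
    with x hx
  rw [hx, gaussian_apply ξ hp, RCLike.inner_apply, mul_comm]

theorem continuous_kernel (m a b D : ℝ) :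
    Continuous fun q : EuclideanSpace ℝ (Fin n) × EuclideanSpace ℝ (Fin n) =>
      Complex.exp (Complex.I * kernelPhase m a b D q.2 q.1) := by
  unfold kernelPhase
  fun_prop

theorem norm_kernel (m a b D : ℝ) (y x : EuclideanSpace ℝ (Fin n)) :
    ‖Complex.exp (Complex.I * kernelPhase m a b D y x)‖ = 1 := by
  rw [mul_comm, Complex.norm_exp_ofReal_mul_I]

theorem integrable_kernel_prod (m a b D : ℝ) (ξ : EuclideanSpace ℝ (Fin n))
    {p : ℂ × ℂ × ℂ} (hp : 0 < p.2.2.re) {φ : EuclideanSpace ℝ (Fin n) → ℂ} (hφ : Integrable φ) :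
    Integrable (fun q : EuclideanSpace ℝ (Fin n) × EuclideanSpace ℝ (Fin n) =>
      conj (Complex.exp (Complex.I * kernelPhase m a b D q.2 q.1)) *
        (conj (Complex.exp (gaussExponent ξ p q.1)) * φ q.2)) (volume.prod volume) := by
  have hg : Integrable fun x => conj (Complex.exp (gaussExponent ξ p x)) := by
    have := ((gaussian ξ p).integrable (μ := volume)).congr (Eventually.of_forall fun x =>
      gaussian_apply ξ hp x)
    exact (Complex.conjLIE.integrable_comp_iff
      (φ := fun x => Complex.exp (gaussExponent ξ p x))).2 this
  refine (hg.mul_prod hφ).bdd_mul (c := 1)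
    ((Complex.continuous_conj.comp (continuous_kernel m a b D)).aestronglyMeasurable)
    (Eventually.of_forall fun q => ?_)
  exact ((RCLike.norm_conj _).trans (norm_kernel m a b D q.2 q.1)).le

/-- The `L¹ → L^∞` estimate for the propagator. -/
theorem IsPropagator.ae_norm_apply_le {m : ℝ} {σ : ℝ → ℝ}
    {U : ℝ → ℝ → (L2Space n →L[ℂ] L2Space n)} (hm : 0 < m) (hσ : MemLp σ ∞ volume)
    (hU : IsPropagator n m σ U) (hU1 : ∀ s φ, U s s φ = φ) {t : ℝ} {z vz e ve : ℝ → ℝ}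
    (h : IsNormalizedPair (fun t => ∫ τ in (0 : ℝ)..t, σ τ) m t z vz e ve) {s : ℝ}
    (hs : e s ≠ 0) {φ : L2Space n} (hφ : Integrable φ) :
    ∀ᵐ x, ‖U t s φ x‖ ≤ (m / (2 * Real.pi * |e s|)) ^ (n / 2 : ℝ) * ∫ y, ‖φ y‖ := by
  obtain ⟨K, -, hK⟩ := hσ.exists_ae_bound
  have hS := abs_primitive_sub_le hσ hK
  obtain ⟨c, hc, hker⟩ := h.exists_kernel n hm hS hs
  set k : EuclideanSpace ℝ (Fin n) → EuclideanSpace ℝ (Fin n) → ℂ := fun y x =>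
    Complex.exp (Complex.I * kernelPhase m (z s) (ve s) (e s) y x) with hk
  set g : EuclideanSpace ℝ (Fin n) → EuclideanSpace ℝ (Fin n) → ℂ := fun ξ x =>
    Complex.exp (gaussExponent ξ (0, Complex.I, 1) x) with hg
  have hp1 : 0 < ((0, Complex.I, 1) : ℂ × ℂ × ℂ).2.2.re := by simp
  set T : EuclideanSpace ℝ (Fin n) → ℂ := fun x => conj c * ∫ y, conj (k y x) * φ y with hT
  have hprod : ∀ ξ, Integrable (fun q : EuclideanSpace ℝ (Fin n) × EuclideanSpace ℝ (Fin n) =>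
      conj (k q.2 q.1) * (conj (g ξ q.1) * φ q.2)) (volume.prod volume) := fun ξ =>
    integrable_kernel_prod m _ _ _ ξ hp1 hφ
  have hpull : ∀ ξ x, ∫ y, conj (k y x) * (conj (g ξ x) * φ y) =
      conj (g ξ x) * ∫ y, conj (k y x) * φ y := fun ξ x => by
    rw [← integral_const_mul]
    exact integral_congr_ae (Eventually.of_forall fun y => by simp only []; ring)
  have hTint : ∀ ξ, Integrable fun x => conj (g ξ x) * T x := fun ξ => by
    have h1 := ((hprod ξ).integral_prod_left).const_mul (conj c)
    refine h1.congr (Eventually.of_forall fun x => ?_)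
    simp only [hpull, hT]
    ring
  -- The conserved pairing is evaluated at time `t`, where the Gaussian is explicit, and at time
  -- `s`, where the orbit is `φ`. The kernel formula and Fubini then move the kernel onto `φ`.
  have hduality : ∀ ξ, ∫ x, conj (g ξ x) * (U t s φ) x = ∫ x, conj (g ξ x) * T x := by
    intro ξ
    have h1 := hU.inner_gaussian_const hσ ξ (h.gaussCurve_re_pos n hm hS ξ)
      (h.gaussCurve_drivenDeriv n hm hS ξ) s φ t s
    rw [h.gaussCurve_self n hm.ne' ξ, hU1, inner_gaussian_toLp ξ hp1,
      inner_gaussian_toLp ξ (h.gaussCurve_re_pos n hm hS ξ s)] at h1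
    rw [h1]
    have h2 : ∀ y, conj (Complex.exp (gaussExponent ξ (gaussCurve n m t z vz e ve ξ s) y)) * φ y =
        conj c * ∫ x, conj (k y x) * (conj (g ξ x) * φ y) := fun y => by
      rw [hker ξ y, map_mul, ← integral_conj, mul_assoc, ← integral_mul_const]
      congr 1
      refine integral_congr_ae (Eventually.of_forall fun x => ?_)
      simp only [map_mul, hk, hg]
      ring
    have h3 : ∀ x, conj (g ξ x) * T x =
        conj c * ∫ y, conj (k y x) * (conj (g ξ x) * φ y) := fun x => by
      rw [hpull, hT]
      ring
    simp only [h2, h3]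
    rw [integral_const_mul, integral_const_mul]
    congr 1
    exact (integral_integral_swap (hprod ξ)).symm
  have hUint : ∀ ξ, Integrable fun x => conj (g ξ x) * (U t s φ) x := fun ξ =>
    integrable_conj_gaussian_mul ξ hp1 _
  -- The conjugate of `g (2π w)` is the Fourier character at `w` times that of `g 0`, so equality of
  -- the pairings for all `ξ` says that this integrable difference has zero Fourier transform. The
  -- nowhere vanishing Gaussian is divided out afterwards.
  have hzero : (fun x => conj (g 0 x) * (U t s φ) x - conj (g 0 x) * T x) =ᵐ[volume] 0 := by
    refine ae_eq_zero_of_fourier_eq_zero ((hUint 0).sub (hTint 0)) fun w => ?_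
    rw [Real.fourier_eq']
    have h1 : ∀ x, Complex.exp (((-2 * Real.pi * ⟪x, w⟫_ℝ : ℝ) : ℂ) * Complex.I) * conj (g 0 x) =
        conj (g ((2 * Real.pi) • w) x) := fun x => by
      simp only [hg, ← Complex.exp_conj, ← Complex.exp_add]
      congr 1
      simp only [gaussExponent, map_sub, map_add, map_mul, map_div₀, Complex.conj_I,
        Complex.conj_ofReal, inner_zero_left, map_zero, real_inner_smul_left, real_inner_comm x w,
        map_one, map_ofNat]
      push_cast
      ring
    have h2 : ∀ x, Complex.exp (((-2 * Real.pi * ⟪x, w⟫_ℝ : ℝ) : ℂ) * Complex.I) •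
        (conj (g 0 x) * (U t s φ) x - conj (g 0 x) * T x) =
        conj (g ((2 * Real.pi) • w) x) * (U t s φ) x - conj (g ((2 * Real.pi) • w) x) * T x :=
      fun x => by
        rw [← h1 x, smul_eq_mul]
        ring
    simp only [h2]
    rw [integral_sub (hUint _) (hTint _), hduality, sub_self]
  filter_upwards [hzero] with x hx
  have hg0 : conj (g 0 x) ≠ 0 := by
    rw [map_ne_zero]
    exact Complex.exp_ne_zero _
  have hx' : (U t s φ) x = T x := by
    have : conj (g 0 x) * ((U t s φ) x - T x) = 0 := by rw [mul_sub]; exact hx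
    exact sub_eq_zero.1 ((mul_eq_zero.1 this).resolve_left hg0)
  rw [hx', hT, norm_mul, RCLike.norm_conj, hc]
  gcongr
  refine (norm_integral_le_integral_norm _).trans (le_of_eq ?_)
  refine integral_congr_ae (Eventually.of_forall fun y => ?_)
  simp only [norm_mul, RCLike.norm_conj, hk, norm_kernel, one_mul]

end Dispersive

/-! ### The three lines argument on simple functions. -/

section Interpolation

variable {α : Type*} [MeasurableSpace α] {μ : Measure α}

/-- The coefficient map sending values on the range of a simple function to `L²`. -/
def simpleFuncRecolor (f : SimpleFunc α ℂ) (c : f.range → ℂ) : SimpleFunc α ℂ :=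
  -- Keeping the value `0` on the zero set of `f` makes the support of finite measure for every
  -- choice of `c`.
  f.map fun a => if h : a ∈ f.range ∧ a ≠ 0 then c ⟨a, h.1⟩ else 0

theorem simpleFuncRecolor_apply_of_ne (f : SimpleFunc α ℂ) (c : f.range → ℂ) {x : α}
    (hx : f x ≠ 0) : simpleFuncRecolor f c x = c ⟨f x, f.mem_range_self x⟩ := by
  rw [simpleFuncRecolor, SimpleFunc.map_apply, dif_pos ⟨f.mem_range_self x, hx⟩]

theorem simpleFuncRecolor_apply_of_eq (f : SimpleFunc α ℂ) (c : f.range → ℂ) {x : α}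
    (hx : f x = 0) : simpleFuncRecolor f c x = 0 := by
  rw [simpleFuncRecolor, SimpleFunc.map_apply, dif_neg (by simp [hx])]

theorem memLp_simpleFuncRecolor {f : SimpleFunc α ℂ} (hf : f.FinMeasSupp μ) (c : f.range → ℂ) :
    MemLp (simpleFuncRecolor f c) 2 μ := by
  rw [SimpleFunc.memLp_iff_finMeasSupp (by norm_num) (by norm_num)]
  exact hf.map (by simp)

/-- `simpleFuncRecolor` as a linear map into `L²`. -/
def recolorLinear {f : SimpleFunc α ℂ} (hf : f.FinMeasSupp μ) : (f.range → ℂ) →ₗ[ℂ] Lp ℂ 2 μ where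
  toFun c := (memLp_simpleFuncRecolor hf c).toLp
  map_add' c d := by
    rw [← MemLp.toLp_add]
    refine MemLp.toLp_congr _ _ (Eventually.of_forall fun x => ?_)
    by_cases hx : f x = 0
    · simp [simpleFuncRecolor_apply_of_eq, hx]
    · simp [simpleFuncRecolor_apply_of_ne, hx]
  map_smul' r c := by
    rw [RingHom.id_apply, ← MemLp.toLp_const_smul]
    refine MemLp.toLp_congr _ _ (Eventually.of_forall fun x => ?_)
    by_cases hx : f x = 0
    · simp [simpleFuncRecolor_apply_of_eq, hx]
    · simp [simpleFuncRecolor_apply_of_ne, hx]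

/-- The holomorphic family `|f| ^ (p (1 + z) / 2) sgn f` through a simple function `f`. -/
theorem exists_holomorphic_family {f : SimpleFunc α ℂ} (hf : f.FinMeasSupp μ) {p : ℝ}
    (hp : 0 < p) :
    ∃ G : ℂ → Lp ℂ 2 μ, Differentiable ℂ G ∧
      (∀ z : ℂ, 0 ≤ z.re → ∀ᵐ x ∂μ, ‖G z x‖ = ‖f x‖ ^ (p * (1 + z.re) / 2)) ∧
      (∀ z : ℂ, p * (1 + z) / 2 = 1 → G z =ᵐ[μ] f) := by
  set w : ℂ → f.range → ℂ := fun z a =>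
    (a : ℂ) / ‖(a : ℂ)‖ * Complex.exp (p * (1 + z) / 2 * Real.log ‖(a : ℂ)‖) with hw
  have hwd : Differentiable ℂ w := by
    rw [differentiable_pi]
    intro a
    fun_prop
  refine ⟨fun z => recolorLinear hf (w z),
    (recolorLinear hf).toContinuousLinearMap.differentiable.comp hwd,
    fun z hz => ?_, fun z hz => ?_⟩
  · filter_upwards [(memLp_simpleFuncRecolor hf (w z)).coeFn_toLp] with x hx
    change ‖(memLp_simpleFuncRecolor hf (w z)).toLp _ x‖ = _
    rw [hx]
    by_cases h0 : f x = 0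
    · rw [simpleFuncRecolor_apply_of_eq f _ h0, h0, norm_zero, Real.zero_rpow (by positivity)]
    · have hn : 0 < ‖f x‖ := norm_pos_iff.2 h0
      rw [simpleFuncRecolor_apply_of_ne f _ h0, hw]
      simp only [norm_mul, norm_div, Complex.norm_real, norm_norm, div_self hn.ne', one_mul,
        Complex.norm_exp]
      rw [Real.rpow_def_of_pos hn]
      congr 1
      have : (p * (1 + z) / 2 * Real.log ‖f x‖ : ℂ) =
          ((p / 2 * Real.log ‖f x‖ : ℝ) : ℂ) * (1 + z) := by
        push_cast
        ring
      rw [this, Complex.re_ofReal_mul]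
      simp
      ring
  · filter_upwards [(memLp_simpleFuncRecolor hf (w z)).coeFn_toLp] with x hx
    change (memLp_simpleFuncRecolor hf (w z)).toLp _ x = _
    rw [hx]
    by_cases h0 : f x = 0
    · rw [simpleFuncRecolor_apply_of_eq f _ h0, h0]
    · have hn : 0 < ‖f x‖ := norm_pos_iff.2 h0
      rw [simpleFuncRecolor_apply_of_ne f _ h0, hw]
      simp only [hz, one_mul]
      rw [← Complex.ofReal_exp, Real.exp_log hn, div_mul_cancel₀]
      exact_mod_cast hn.ne'

/-- The norm depends only on `Re z`, so compactness of `[0, 1]` bounds it on the whole strip. -/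
theorem exists_bound_of_norm_eq_re {G : ℂ → Lp ℂ 2 μ} (hG : Continuous G)
    (h : ∀ z : ℂ, 0 ≤ z.re → ‖G z‖ = ‖G (z.re : ℂ)‖) :
    ∃ M, ∀ z : ℂ, 0 ≤ z.re → z.re ≤ 1 → ‖G z‖ ≤ M := by
  have hc : ContinuousOn (fun r : ℝ => ‖G (r : ℂ)‖) (Icc 0 1) := by
    have : Continuous fun r : ℝ => ‖G (r : ℂ)‖ := by fun_prop
    exact this.continuousOn
  obtain ⟨M, hM⟩ := isCompact_Icc.bddAbove_image hc
  refine ⟨M, fun z h0 h1 => ?_⟩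
  rw [h z h0]
  exact hM ⟨z.re, ⟨h0, h1⟩, rfl⟩

/-- Hadamard's three lines theorem for `F z = B (G z) (H z)`. At `Re z = 0` the moduli are
`|f|^(p/2)`, `|g|^(p/2)` and the `L²` bound applies; at `Re z = 1` they are `|f|^p`, `|g|^p` and the
`L¹` bound applies. At `θ = 2/p - 1` the family passes through `f` and `g`, and `(1 - θ)/2 + θ =
1/p`. -/
theorem norm_bilinear_simpleFunc_le {B : Lp ℂ 2 μ →L[ℂ] Lp ℂ 2 μ →L[ℂ] ℂ} {A p : ℝ} (hA : 0 ≤ A)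
    (hp1 : 1 < p) (hp2 : p < 2) (hB2 : ∀ u v, ‖B u v‖ ≤ ‖u‖ * ‖v‖)
    (hB1 : ∀ u v : Lp ℂ 2 μ, Integrable u μ → Integrable v μ →
      ‖B u v‖ ≤ A * ((∫ x, ‖u x‖ ∂μ) * ∫ x, ‖v x‖ ∂μ))
    {f g : SimpleFunc α ℂ} (hf : f.FinMeasSupp μ) (hg : g.FinMeasSupp μ) {u v : Lp ℂ 2 μ}
    (hu : u =ᵐ[μ] f) (hv : v =ᵐ[μ] g) :
    ‖B u v‖ ≤ A ^ (2 / p - 1) *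
      ((∫ x, ‖f x‖ ^ p ∂μ) * ∫ x, ‖g x‖ ^ p ∂μ) ^ (1 / p) := by
  have hp0 : 0 < p := by linarith
  obtain ⟨G, hGd, hGn, hGe⟩ := exists_holomorphic_family hf hp0
  obtain ⟨H, hHd, hHn, hHe⟩ := exists_holomorphic_family hg hp0
  have hnorm : ∀ (G : ℂ → Lp ℂ 2 μ) (f : SimpleFunc α ℂ),
      (∀ z : ℂ, 0 ≤ z.re → ∀ᵐ x ∂μ, ‖G z x‖ = ‖f x‖ ^ (p * (1 + z.re) / 2)) →
      ∀ z : ℂ, 0 ≤ z.re → ‖G z‖ = ‖G (z.re : ℂ)‖ := by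
    intro G f hGn z hz
    rw [Lp.norm_def, Lp.norm_def]
    congr 1
    refine eLpNorm_congr_norm_ae ?_
    filter_upwards [hGn z hz, hGn (z.re : ℂ) (by simpa using hz)] with x h1 h2
    rw [h1, h2, Complex.ofReal_re]
  have hL2 : ∀ (G : ℂ → Lp ℂ 2 μ) (f : SimpleFunc α ℂ),
      (∀ z : ℂ, 0 ≤ z.re → ∀ᵐ x ∂μ, ‖G z x‖ = ‖f x‖ ^ (p * (1 + z.re) / 2)) →
      ∀ z : ℂ, z.re = 0 → ‖G z‖ = (∫ x, ‖f x‖ ^ p ∂μ) ^ (1 / 2 : ℝ) := by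
    intro G f hGn z hz
    rw [Lp.norm_def, (Lp.memLp (G z)).eLpNorm_eq_integral_rpow_norm (by norm_num) (by norm_num),
      ENNReal.toReal_ofReal (by positivity)]
    simp only [ENNReal.toReal_ofNat, one_div]
    congr 1
    refine integral_congr_ae ?_
    filter_upwards [hGn z hz.ge] with x hx
    rw [hx, hz, ← Real.rpow_mul (norm_nonneg _)]
    congr 1
    ring
  have hL1 : ∀ (G : ℂ → Lp ℂ 2 μ) (f : SimpleFunc α ℂ),
      (∀ z : ℂ, 0 ≤ z.re → ∀ᵐ x ∂μ, ‖G z x‖ = ‖f x‖ ^ (p * (1 + z.re) / 2)) →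
      f.FinMeasSupp μ → ∀ z : ℂ, z.re = 1 → Integrable (G z) μ ∧
        ∫ x, ‖G z x‖ ∂μ = ∫ x, ‖f x‖ ^ p ∂μ := by
    intro G f hGn hf z hz
    have he : ∀ᵐ x ∂μ, ‖G z x‖ = ‖f x‖ ^ p := by
      filter_upwards [hGn z (by linarith)] with x hx
      rw [hx, hz]
      congr 1
      ring
    have hint : Integrable (fun x => ‖f x‖ ^ p) μ := by
      have : Integrable (f.map fun a => ‖a‖ ^ p) μ :=
        SimpleFunc.integrable_iff_finMeasSupp.2 (hf.map (by simp [Real.zero_rpow hp0.ne']))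
      exact this
    exact ⟨(integrable_norm_iff (Lp.aestronglyMeasurable _)).1 (hint.congr (by
      filter_upwards [he] with x hx using hx.symm)), integral_congr_ae he⟩
  set Nf := ∫ x, ‖f x‖ ^ p ∂μ with hNf
  set Ng := ∫ x, ‖g x‖ ^ p ∂μ with hNg
  have hNf0 : 0 ≤ Nf := integral_nonneg fun x => by positivity
  have hNg0 : 0 ≤ Ng := integral_nonneg fun x => by positivity
  set F : ℂ → ℂ := fun z => B (G z) (H z) with hF
  have hFd : Differentiable ℂ F := (B.differentiable.comp hGd).clm_apply hHd
  have hθ0 : 0 < 2 / p - 1 := by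
    rw [sub_pos, lt_div_iff₀ hp0]
    linarith
  have hθ1 : 2 / p - 1 < 1 := by
    rw [sub_lt_iff_lt_add, div_lt_iff₀ hp0]
    linarith
  obtain ⟨M, hM⟩ := exists_bound_of_norm_eq_re hGd.continuous (hnorm G f hGn)
  obtain ⟨M', hM'⟩ := exists_bound_of_norm_eq_re hHd.continuous (hnorm H g hHn)
  have key := Complex.HadamardThreeLines.norm_le_interp_of_mem_verticalClosedStrip₀₁' F
    (z := ((2 / p - 1 : ℝ) : ℂ)) (a := (Nf * Ng) ^ (1 / 2 : ℝ)) (b := A * (Nf * Ng))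
    (by
      simp only [Complex.HadamardThreeLines.verticalClosedStrip, mem_preimage, Complex.ofReal_re]
      exact ⟨hθ0.le, hθ1.le⟩)
    hFd.diffContOnCl (by
      refine ⟨M * M', ?_⟩
      rintro _ ⟨z, hz, rfl⟩
      simp only [Complex.HadamardThreeLines.verticalClosedStrip, mem_preimage, mem_Icc] at hz
      refine (hB2 _ _).trans ?_
      have h1 := hM z hz.1 hz.2
      exact mul_le_mul h1 (hM' z hz.1 hz.2) (norm_nonneg _) ((norm_nonneg _).trans h1))
    (fun z hz => by
      refine (hB2 _ _).trans (le_of_eq ?_)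
      rw [hL2 G f hGn z hz, hL2 H g hHn z hz, Real.mul_rpow hNf0 hNg0])
    (fun z hz => by
      obtain ⟨h1, h2⟩ := hL1 G f hGn hf z hz
      obtain ⟨h3, h4⟩ := hL1 H g hHn hg z hz
      refine (hB1 _ _ h1 h3).trans (le_of_eq ?_)
      rw [h2, h4])
  have hz1 : (p * (1 + ((2 / p - 1 : ℝ) : ℂ)) / 2 : ℂ) = 1 := by
    have : (p : ℂ) ≠ 0 := by exact_mod_cast hp0.ne'
    push_cast
    field_simp
    ring
  have hGu : G ((2 / p - 1 : ℝ) : ℂ) = u := Lp.ext ((hGe _ hz1).trans hu.symm)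
  have hHv : H ((2 / p - 1 : ℝ) : ℂ) = v := Lp.ext ((hHe _ hz1).trans hv.symm)
  simp only [hF, hGu, hHv, Complex.ofReal_re] at key
  refine key.trans (le_of_eq ?_)
  rw [Real.mul_rpow hA (by positivity), ← Real.rpow_mul (by positivity), mul_left_comm,
    ← Real.rpow_add_of_nonneg (by positivity) (by nlinarith) hθ0.le]
  congr 2
  field_simp
  ring

end Interpolation

/-! ### From simple functions to the `L^p → L^q` bound. -/

section RieszThorin

variable {α : Type*} [MeasurableSpace α] {μ : Measure α}

/-- The same simple approximants converge in `L²`, where `B` is continuous, and in `L^p`, where the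
bound is measured. -/
theorem norm_bilinear_le {B : Lp ℂ 2 μ →L[ℂ] Lp ℂ 2 μ →L[ℂ] ℂ} {A p : ℝ} (hA : 0 ≤ A)
    (hp1 : 1 < p) (hp2 : p < 2) (hB2 : ∀ u v, ‖B u v‖ ≤ ‖u‖ * ‖v‖)
    (hB1 : ∀ u v : Lp ℂ 2 μ, Integrable u μ → Integrable v μ →
      ‖B u v‖ ≤ A * ((∫ x, ‖u x‖ ∂μ) * ∫ x, ‖v x‖ ∂μ))
    {u v : Lp ℂ 2 μ} (hu : MemLp u (ENNReal.ofReal p) μ) (hv : MemLp v (ENNReal.ofReal p) μ) :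
    ‖B u v‖ ≤ A ^ (2 / p - 1) *
      ((eLpNorm u (ENNReal.ofReal p) μ).toReal * (eLpNorm v (ENNReal.ofReal p) μ).toReal) := by
  have hp0 : 0 < p := by linarith
  have : Fact (1 ≤ ENNReal.ofReal p) := ⟨by
    rw [← ENNReal.ofReal_one]
    exact ENNReal.ofReal_le_ofReal hp1.le⟩
  have happrox : ∀ u : Lp ℂ 2 μ, MemLp u (ENNReal.ofReal p) μ →
      ∃ (f : ℕ → SimpleFunc α ℂ) (w : ℕ → Lp ℂ 2 μ), (∀ n, (f n).FinMeasSupp μ) ∧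
        (∀ n, w n =ᵐ[μ] f n) ∧ Tendsto w atTop (𝓝 u) ∧
        Tendsto (fun n => (∫ x, ‖f n x‖ ^ p ∂μ) ^ (1 / p)) atTop
          (𝓝 (eLpNorm u (ENNReal.ofReal p) μ).toReal) := by
    intro u hu
    have hm : Measurable u := (Lp.stronglyMeasurable u).measurable
    have h2 : MemLp u 2 μ := Lp.memLp u
    have t2 := SimpleFunc.tendsto_approxOn_range_Lp (p := 2) (by norm_num) hm h2
    have tp := (SimpleFunc.tendsto_approxOn_range_Lp (p := ENNReal.ofReal p) (by simp) hm hu).norm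
    rw [Lp.toLp_coeFn] at t2
    rw [Lp.norm_toLp] at tp
    refine ⟨fun n => SimpleFunc.approxOn u hm (range u ∪ {0}) 0 (by simp) n,
      fun n => (SimpleFunc.memLp_approxOn_range hm h2 n).toLp _, fun n => ?_, fun n => ?_, t2, ?_⟩
    · exact (SimpleFunc.memLp_iff_finMeasSupp (by norm_num) (by norm_num)).1
        (SimpleFunc.memLp_approxOn_range hm h2 n)
    · exact (SimpleFunc.memLp_approxOn_range hm h2 n).coeFn_toLp
    · refine tp.congr fun n => ?_
      rw [Lp.norm_toLp, (SimpleFunc.memLp_approxOn_range hm hu n).eLpNorm_eq_integral_rpow_norm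
        (by simpa using hp0) (by simp), ENNReal.toReal_ofReal hp0.le,
        ENNReal.toReal_ofReal (by positivity), one_div]
  obtain ⟨f, w, hf, hw, tw, tf⟩ := happrox u hu
  obtain ⟨g, w', hg, hw', tw', tg⟩ := happrox v hv
  have hlim : Tendsto (fun n => ‖B (w n) (w' n)‖) atTop (𝓝 ‖B u v‖) :=
    ((B.continuous₂.tendsto (u, v)).comp (tw.prodMk_nhds tw')).norm
  refine le_of_tendsto_of_tendsto' hlim ((tf.mul tg).const_mul (A ^ (2 / p - 1))) fun n => ?_
  refine (norm_bilinear_simpleFunc_le hA hp1 hp2 hB2 hB1 (hf n) (hg n) (hw n) (hw' n)).trans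
    (le_of_eq ?_)
  rw [Real.mul_rpow (integral_nonneg fun x => by positivity)
    (integral_nonneg fun x => by positivity)]

/-- The integral of `u v` as a bounded bilinear form on `L²`. -/
def lpMulPairing (μ : Measure α) : Lp ℂ 2 μ →L[ℂ] Lp ℂ 2 μ →L[ℂ] ℂ :=
  (ContinuousLinearMap.mul ℂ ℂ).lpPairing μ 2 2

theorem lpMulPairing_apply (u v : Lp ℂ 2 μ) : lpMulPairing μ u v = ∫ x, u x * v x ∂μ :=
  ContinuousLinearMap.lpPairing_eq_integral _ u v

theorem norm_lpMulPairing_le (u v : Lp ℂ 2 μ) : ‖lpMulPairing μ u v‖ ≤ ‖u‖ * ‖v‖ := by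
  have h2 : lpMulPairing μ u v = inner ℂ (star u) v := by
    rw [lpMulPairing_apply, L2.inner_def]
    refine integral_congr_ae ?_
    filter_upwards [Lp.coeFn_star u] with x hx
    rw [hx, RCLike.inner_apply, Pi.star_apply, RCLike.star_def, RCLike.conj_conj, mul_comm]
  rw [h2]
  have h3 : ‖star u‖ = ‖u‖ := by
    rw [Lp.norm_def, Lp.norm_def]
    congr 1
    refine eLpNorm_congr_norm_ae ?_
    filter_upwards [Lp.coeFn_star u] with x hx
    rw [hx, Pi.star_apply, norm_star]
  exact (norm_inner_le_norm _ _).trans (le_of_eq (by rw [h3]))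

/-- A function in `L²` whose integral against every test function `ψ ∈ L² ∩ L^p` is bounded by
`b ‖ψ‖_p` lies in the dual space `L^q` with norm at most `b`. -/
theorem eLpNorm_le_of_forall_norm_integral_mul_le {p q b : ℝ} (hp1 : 1 < p)
    (hpq : p.HolderConjugate q) (hb : 0 ≤ b) (h : Lp ℂ 2 μ)
    (hh : ∀ v : Lp ℂ 2 μ, MemLp v (ENNReal.ofReal p) μ →
      ‖∫ x, v x * h x ∂μ‖ ≤ b * (eLpNorm v (ENNReal.ofReal p) μ).toReal) :
    eLpNorm h (ENNReal.ofReal q) μ ≤ ENNReal.ofReal b := by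
  have hp0 : 0 < p := by linarith
  have hq1 : 1 < q := hpq.symm.lt
  have hq0 : 0 < q := by linarith
  have hm : Measurable h := (Lp.stronglyMeasurable h).measurable
  -- On `E N` the function `h` is bounded, and `E N` has finite measure by Chebyshev, so truncations
  -- to it lie in every `L^r`. They converge pointwise to `h`, so it suffices to bound each one.
  set E : ℕ → Set α := fun N => {x | ((N : ℝ) + 1)⁻¹ ≤ ‖h x‖ ∧ ‖h x‖ ≤ N + 1} with hE
  have hEm : ∀ N, MeasurableSet (E N) := fun N =>
    (measurableSet_le measurable_const hm.norm).inter (measurableSet_le hm.norm measurable_const)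
  have hEfin : ∀ N, μ (E N) ≠ ∞ := fun N => by
    have h1 := (Lp.memLp h).meas_ge_lt_top' (by norm_num) (by norm_num)
      (ε := ENNReal.ofReal ((N : ℝ) + 1)⁻¹) (by simpa using by positivity)
    refine ((measure_mono fun x hx => ?_).trans_lt h1).ne
    change _ ≤ ‖h x‖ₑ
    rw [← ofReal_norm]
    exact ENNReal.ofReal_le_ofReal hx.1
  have hbound : ∀ (N : ℕ) (k : α → ℂ) (c : ℝ) (r : ℝ≥0∞), Measurable k →
      (∀ x ∈ E N, ‖k x‖ ≤ c) → MemLp ((E N).indicator k) r μ := by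
    intro N k c r hk hc
    rw [memLp_indicator_iff_restrict (hEm N)]
    have : IsFiniteMeasure (μ.restrict (E N)) := ⟨by simpa using (hEfin N).lt_top⟩
    exact MemLp.of_bound hk.aestronglyMeasurable c
      ((ae_restrict_iff' (hEm N)).2 (Eventually.of_forall hc))
  refine Lp.eLpNorm_le_of_ae_tendsto (u := atTop) (f := fun N => (E N).indicator h)
    (Eventually.of_forall fun N => ?_) (fun N => (hm.indicator (hEm N)).aestronglyMeasurable)
    (Eventually.of_forall fun x => ?_)
  -- The extremal test function for Hölder's inequality: on `E N`, `k h = |h|^q` and `|k|^p =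
  -- |h|^q`. The hypothesis becomes `I ≤ b I^(1/p)`, that is, `I^(1/q) ≤ b` when `I > 0`.
  · set k : α → ℂ := fun x => star (h x) * ((‖h x‖ ^ (q - 2) : ℝ) : ℂ) with hk
    have hkm : Measurable k := by
      have h1 : Measurable fun x => ((‖h x‖ ^ (q - 2) : ℝ) : ℂ) :=
        Complex.measurable_ofReal.comp (hm.norm.pow_const _)
      exact (continuous_star.measurable.comp hm).mul h1
    have hknorm : ∀ x ∈ E N, ‖k x‖ = ‖h x‖ ^ (q - 1) := fun x hx => by
      have h0 : 0 < ‖h x‖ := lt_of_lt_of_le (by positivity) hx.1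
      rw [hk]
      simp only [norm_mul, norm_star, Complex.norm_real, Real.norm_eq_abs,
        abs_of_nonneg (Real.rpow_nonneg (norm_nonneg (h x)) _)]
      rw [← Real.rpow_one_add' h0.le (by linarith)]
      congr 1
      ring
    have hkb : ∀ x ∈ E N, ‖k x‖ ≤ ((N : ℝ) + 1) ^ (q - 1) := fun x hx => by
      rw [hknorm x hx]
      exact Real.rpow_le_rpow (norm_nonneg _) hx.2 (by linarith)
    have hk2 := hbound N k _ 2 hkm hkb
    have hkp := hbound N k _ (ENNReal.ofReal p) hkm hkb
    have hhq := hbound N h _ (ENNReal.ofReal q) hm fun x hx => hx.2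
    have hv := hk2.coeFn_toLp
    have h1 := hh hk2.toLp ((memLp_congr_ae hv).2 hkp)
    rw [eLpNorm_congr_ae hv] at h1
    set I : ℝ := ∫ x, ‖(E N).indicator h x‖ ^ q ∂μ with hI
    have hI0 : 0 ≤ I := integral_nonneg fun x => by positivity
    have e1 : ∫ x, hk2.toLp _ x * h x ∂μ = ((I : ℝ) : ℂ) := by
      rw [hI, ← integral_complex_ofReal]
      refine integral_congr_ae ?_
      filter_upwards [hv] with x hx
      rw [hx]
      by_cases hxE : x ∈ E N
      · rw [indicator_of_mem hxE, indicator_of_mem hxE, hk]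
        have h0 : 0 < ‖h x‖ := lt_of_lt_of_le (by positivity) hxE.1
        have h3 : star (h x) * h x = ((‖h x‖ ^ 2 : ℝ) : ℂ) := by
          rw [Complex.star_def, Complex.conj_mul']
          push_cast
          rfl
        rw [mul_right_comm, h3, ← Complex.ofReal_mul]
        congr 1
        rw [← Real.rpow_natCast, ← Real.rpow_add h0]
        congr 1
        push_cast
        ring
      · rw [indicator_of_notMem hxE, indicator_of_notMem hxE, norm_zero,
          Real.zero_rpow hq0.ne']
        simp
    have e2 : (eLpNorm ((E N).indicator k) (ENNReal.ofReal p) μ).toReal = I ^ (1 / p) := by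
      rw [hkp.eLpNorm_eq_integral_rpow_norm (by simpa using hp0) (by simp),
        ENNReal.toReal_ofReal hp0.le, ENNReal.toReal_ofReal (by positivity), hI, one_div]
      congr 1
      refine integral_congr_ae (Eventually.of_forall fun x => ?_)
      by_cases hxE : x ∈ E N
      · simp only [indicator_of_mem hxE]
        rw [hknorm x hxE, ← Real.rpow_mul (norm_nonneg _)]
        congr 1
        exact hpq.symm.sub_one_mul_conj
      · simp only [indicator_of_notMem hxE, norm_zero]
        rw [Real.zero_rpow hq0.ne', Real.zero_rpow hp0.ne']
    rw [e1, e2, Complex.norm_real, Real.norm_of_nonneg hI0] at h1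
    rw [hhq.eLpNorm_eq_integral_rpow_norm (by simpa using hq0) (by simp),
      ENNReal.toReal_ofReal hq0.le]
    refine ENNReal.ofReal_le_ofReal ?_
    change I ^ q⁻¹ ≤ b
    rcases hI0.eq_or_lt with h0 | h0
    · rw [← h0, Real.zero_rpow (by positivity)]
      exact hb
    · have h4 : I ^ q⁻¹ * I ^ (1 / p) = I := by
        rw [← Real.rpow_add h0, one_div, add_comm, hpq.inv_add_inv_eq_one, Real.rpow_one]
      have h5 : 0 < I ^ (1 / p) := Real.rpow_pos_of_pos h0 _
      by_contra hcon
      push Not at hcon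
      nlinarith
  · by_cases h0 : h x = 0
    · refine tendsto_const_nhds.congr' (Eventually.of_forall fun N => ?_)
      change h x = (E N).indicator h x
      by_cases hx : x ∈ E N
      · rw [indicator_of_mem hx]
      · rw [indicator_of_notMem hx, h0]
    · refine tendsto_const_nhds.congr' ?_
      have hn : 0 < ‖h x‖ := norm_pos_iff.2 h0
      obtain ⟨N₁, hN₁⟩ := exists_nat_ge ‖h x‖
      obtain ⟨N₂, hN₂⟩ := exists_nat_ge ‖h x‖⁻¹
      filter_upwards [eventually_ge_atTop (max N₁ N₂)] with N hN
      have h1 : (N₁ : ℝ) ≤ N := by exact_mod_cast (le_max_left _ _).trans hN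
      have h2 : (N₂ : ℝ) ≤ N := by exact_mod_cast (le_max_right _ _).trans hN
      rw [indicator_of_mem]
      refine ⟨?_, by linarith⟩
      exact inv_le_of_inv_le₀ hn (by linarith)

/-- Riesz–Thorin interpolation between an `L²` contraction and an `L¹ → L^∞` bound. -/
theorem eLpNorm_apply_le_of_L2_of_L1 {T : Lp ℂ 2 μ →L[ℂ] Lp ℂ 2 μ} {A p q : ℝ} (hA : 0 ≤ A)
    (hpq : p.HolderConjugate q) (hp2 : p < 2) (hT2 : ∀ u, ‖T u‖ ≤ ‖u‖)
    (hT1 : ∀ u : Lp ℂ 2 μ, Integrable u μ → ∀ᵐ x ∂μ, ‖T u x‖ ≤ A * ∫ y, ‖u y‖ ∂μ)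
    {u : Lp ℂ 2 μ} (hu : MemLp u (ENNReal.ofReal p) μ) :
    eLpNorm (T u) (ENNReal.ofReal q) μ ≤
      ENNReal.ofReal (A ^ (1 - 2 / q)) * eLpNorm u (ENNReal.ofReal p) μ := by
  have hp0 : 0 < p := hpq.pos
  have hp1 : 1 < p := hpq.lt
  set B : Lp ℂ 2 μ →L[ℂ] Lp ℂ 2 μ →L[ℂ] ℂ := (lpMulPairing μ).comp T with hB
  have hB2 : ∀ u v, ‖B u v‖ ≤ ‖u‖ * ‖v‖ := fun u v =>
    (norm_lpMulPairing_le (T u) v).trans (mul_le_mul_of_nonneg_right (hT2 u) (norm_nonneg v))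
  have hB1 : ∀ u v : Lp ℂ 2 μ, Integrable u μ → Integrable v μ →
      ‖B u v‖ ≤ A * ((∫ x, ‖u x‖ ∂μ) * ∫ x, ‖v x‖ ∂μ) := by
    intro u v hu hv
    change ‖lpMulPairing μ (T u) v‖ ≤ _
    rw [lpMulPairing_apply, ← mul_assoc, ← integral_const_mul]
    refine norm_integral_le_of_norm_le (hv.norm.const_mul _) ?_
    filter_upwards [hT1 u hu] with x hx
    rw [norm_mul]
    gcongr
  have hexp : 2 / p - 1 = 1 - 2 / q := by
    have := hpq.inv_add_inv_eq_one
    rw [div_eq_mul_inv, div_eq_mul_inv]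
    linarith
  have hmain := eLpNorm_le_of_forall_norm_integral_mul_le (μ := μ) (p := p) (q := q)
    (b := A ^ (1 - 2 / q) * (eLpNorm u (ENNReal.ofReal p) μ).toReal) hp1 hpq (by positivity) (T u)
    (fun v hv => by
      have := norm_bilinear_le hA hp1 hp2 hB2 hB1 hu hv
      rw [hexp, ← mul_assoc] at this
      change ‖lpMulPairing μ (T u) v‖ ≤ _ at this
      rw [lpMulPairing_apply] at this
      simpa only [mul_comm] using this)
  refine hmain.trans (le_of_eq ?_)
  rw [ENNReal.ofReal_mul (by positivity), ENNReal.ofReal_toReal hu.eLpNorm_ne_top]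

end RieszThorin

/-! ### Lower bounds for the cross product of two solutions on a half line. -/

section Asymptotics

theorem eventually_abs_bounds_of_tendsto {f : ℝ → ℝ} {a c : ℝ} (hc : c ≠ 0)
    (h : Tendsto (fun t : ℝ => f t / |t| ^ a) atTop (𝓝 c)) :
    ∀ᶠ t in atTop, |c| / 2 * |t| ^ a ≤ |f t| ∧ |f t| ≤ 2 * |c| * |t| ^ a := by
  have hc0 : 0 < |c| := abs_pos.2 hc
  have h1 := h.abs
  filter_upwards [h1.eventually (lt_mem_nhds (show |c| / 2 < |c| by linarith)),
    h1.eventually (gt_mem_nhds (show |c| < 2 * |c| by linarith)), eventually_gt_atTop 0]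
    with t h2 h3 h4
  have h5 : 0 < |t| ^ a := Real.rpow_pos_of_pos (abs_pos.2 h4.ne') _
  rw [abs_div, abs_of_pos h5] at h2 h3
  rw [lt_div_iff₀ h5] at h2
  rw [div_lt_iff₀ h5] at h3
  exact ⟨h2.le, h3.le⟩

variable {y₁ y₂ v₁ v₂ : ℝ → ℝ} {W lam c₁ c₂ r₀ : ℝ}

/-- Mean value form of `(y₂ / y₁)' = -W / y₁²`. -/
theorem exists_ratio_sub_eq (h₁ : ∀ t, HasDerivAt y₁ (v₁ t) t) (h₂ : ∀ t, HasDerivAt y₂ (v₂ t) t)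
    (hW : ∀ t, v₁ t * y₂ t - y₁ t * v₂ t = W) {s t : ℝ} (hst : s ≤ t)
    (hy : ∀ τ, s ≤ τ → y₁ τ ≠ 0) :
    ∃ ξ, s ≤ ξ ∧ ξ ≤ t ∧ y₂ s / y₁ s - y₂ t / y₁ t = W * ((t - s) / y₁ ξ ^ 2) := by
  rcases hst.eq_or_lt with rfl | hlt
  · exact ⟨s, le_rfl, le_rfl, by simp⟩
  have hd : ∀ τ, s ≤ τ → HasDerivAt (fun τ => y₂ τ / y₁ τ) (-W / y₁ τ ^ 2) τ := fun τ hτ => by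
    refine ((h₂ τ).div (h₁ τ) (hy τ hτ)).congr_deriv ?_
    rw [← hW τ]
    ring
  obtain ⟨ξ, hξ, he⟩ := exists_hasDerivAt_eq_slope (fun τ => y₂ τ / y₁ τ)
    (fun τ => -W / y₁ τ ^ 2) hlt (fun τ hτ => (hd τ hτ.1).continuousAt.continuousWithinAt)
    (fun τ hτ => hd τ hτ.1.le)
  refine ⟨ξ, hξ.1.le, hξ.2.le, ?_⟩
  have h0 : t - s ≠ 0 := by linarith
  rw [eq_div_iff h0] at he
  have : W * ((t - s) / y₁ ξ ^ 2) = -(-W / y₁ ξ ^ 2 * (t - s)) := by ring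
  rw [this, he]
  ring

/-- If `c₂ = 0` then `y₂ / y₁ = o(t^(2 lam - 1))`, at `t` and equally at `2t`. But the difference of
the two values is `W t / y₁(ξ)²` with `ξ ≤ 2t`, which has at least this order. -/
theorem limit_ne_zero_of_wronskian (h₁ : ∀ t, HasDerivAt y₁ (v₁ t) t)
    (h₂ : ∀ t, HasDerivAt y₂ (v₂ t) t) (hW : ∀ t, v₁ t * y₂ t - y₁ t * v₂ t = W) (hW0 : W ≠ 0)
    (hlam : lam < 1 / 2) (hc₁ : c₁ ≠ 0)
    (hl₁ : Tendsto (fun t : ℝ => y₁ t / |t| ^ (1 - lam)) atTop (𝓝 c₁))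
    (hl₂ : Tendsto (fun t : ℝ => y₂ t / |t| ^ lam) atTop (𝓝 c₂)) : c₂ ≠ 0 := by
  rintro rfl
  obtain ⟨R, hR⟩ := eventually_atTop.1 (eventually_abs_bounds_of_tendsto hc₁ hl₁)
  have hc0 : 0 < |c₁| := abs_pos.2 hc₁
  have hb : Tendsto (fun t : ℝ => y₂ t / y₁ t * t ^ (1 - 2 * lam)) atTop (𝓝 0) := by
    have := hl₂.div hl₁ hc₁
    rw [zero_div] at this
    refine this.congr' ?_
    filter_upwards [eventually_gt_atTop 0] with t ht
    rw [Pi.div_apply, abs_of_pos ht, show 1 - 2 * lam = (1 - lam) - lam by ring,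
      Real.rpow_sub ht (1 - lam) lam]
    have := (Real.rpow_pos_of_pos ht lam).ne'
    have := (Real.rpow_pos_of_pos ht (1 - lam)).ne'
    rw [div_div_div_eq, div_mul_div_comm, mul_comm (t ^ lam)]
  have hb2 : Tendsto (fun t : ℝ => y₂ (2 * t) / y₁ (2 * t) * t ^ (1 - 2 * lam)) atTop (𝓝 0) := by
    have h2 : Tendsto (fun t : ℝ => 2 * t) atTop atTop :=
      tendsto_id.const_mul_atTop (by norm_num)
    have := (hb.comp h2).mul_const (((2 : ℝ) ^ (1 - 2 * lam))⁻¹)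
    rw [zero_mul] at this
    refine this.congr' ?_
    filter_upwards [eventually_gt_atTop 0] with t ht
    simp only [Function.comp]
    rw [Real.mul_rpow (by norm_num) ht.le]
    have := (Real.rpow_pos_of_pos (show (0 : ℝ) < 2 by norm_num) (1 - 2 * lam)).ne'
    field_simp
  have hd := (hb.sub hb2).abs
  rw [sub_zero, abs_zero] at hd
  -- The lower bound for `|W| t / y₁(ξ)²` times `t^(1 - 2 lam)` that follows from `|y₁ ξ| ≤ 2 |c₁|
  -- (2t)^(1 - lam)`.
  set k : ℝ := |W| / (4 * c₁ ^ 2 * 2 ^ (2 - 2 * lam)) with hk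
  have hk0 : 0 < k := by
    have := abs_pos.2 hW0
    have := sq_pos_of_ne_zero hc₁
    positivity
  obtain ⟨t, ht1, ht2, ht3⟩ := ((hd.eventually (gt_mem_nhds hk0)).and
    ((eventually_ge_atTop R).and (eventually_gt_atTop 0))).exists
  have hy : ∀ τ, t ≤ τ → y₁ τ ≠ 0 := fun τ hτ => by
    have h5 : 0 < |τ| ^ (1 - lam) := Real.rpow_pos_of_pos (abs_pos.2 (by linarith)) _
    exact abs_pos.1 (lt_of_lt_of_le (by positivity) (hR τ (ht2.trans hτ)).1)
  obtain ⟨ξ, hξ1, hξ2, he⟩ := exists_ratio_sub_eq h₁ h₂ hW (show t ≤ 2 * t by linarith) hy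
  rw [← sub_mul, he] at ht1
  have hξ0 : 0 < ξ := by linarith
  have hyξ : y₁ ξ ^ 2 ≤ 4 * c₁ ^ 2 * ((2 : ℝ) ^ (2 - 2 * lam) * t ^ (2 - 2 * lam)) := by
    rw [← Real.mul_rpow (by norm_num) ht3.le, ← sq_abs]
    have h6 := (hR ξ (ht2.trans hξ1)).2
    rw [abs_of_pos hξ0] at h6
    calc |y₁ ξ| ^ 2 ≤ (2 * |c₁| * ξ ^ (1 - lam)) ^ 2 := by gcongr
      _ = 4 * c₁ ^ 2 * ξ ^ (2 - 2 * lam) := by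
          rw [mul_pow, mul_pow, sq_abs, ← Real.rpow_natCast (ξ ^ (1 - lam)),
            ← Real.rpow_mul hξ0.le]
          push_cast
          ring_nf
      _ ≤ _ := by
          gcongr
          linarith
  have hyξ0 : 0 < y₁ ξ ^ 2 := sq_pos_of_ne_zero (hy ξ hξ1)
  refine absurd ht1 (not_lt.2 ?_)
  have htp := Real.rpow_pos_of_pos ht3 (1 - 2 * lam)
  rw [abs_mul, abs_mul, abs_of_pos htp, abs_of_pos (div_pos (by linarith) hyξ0), hk]
  have e1 : t ^ (2 - 2 * lam) = t * t ^ (1 - 2 * lam) := by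
    rw [← Real.rpow_one_add' ht3.le (by linarith)]
    ring_nf
  rw [e1] at hyξ
  have h2p : (0 : ℝ) < 2 ^ (2 - 2 * lam) := by positivity
  have hc2 := sq_pos_of_ne_zero hc₁
  rw [mul_assoc |W|, div_eq_mul_inv]
  refine mul_le_mul_of_nonneg_left ?_ (abs_nonneg W)
  rw [inv_eq_one_div, div_mul_eq_mul_div, div_le_div_iff₀ (by positivity) hyξ0]
  have : 2 * t - t = t := by ring
  rw [this]
  nlinarith

/-- Dropping `y₂²` leaves a multiple of `τ^(2 lam - 2)`, integrable at infinity exactly because `lam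
< 1/2`; the explicit bound tends to `0` as `r` grows. -/
theorem integrableOn_and_abs_integral_le (h₁ : Continuous y₁) (h₂ : Continuous y₂)
    (hlam : lam < 1 / 2) (hc₁ : c₁ ≠ 0) {r : ℝ} (hr : 0 < r)
    (hb : ∀ t, r ≤ t → |c₁| / 2 * |t| ^ (1 - lam) ≤ |y₁ t|) :
    IntegrableOn (fun τ => W / (y₁ τ ^ 2 + y₂ τ ^ 2)) (Ioi r) volume ∧
      |∫ τ in Ioi r, W / (y₁ τ ^ 2 + y₂ τ ^ 2)| ≤
        4 * |W| / c₁ ^ 2 * (r ^ (2 * lam - 1) / (1 - 2 * lam)) := by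
  have hint := (integrableOn_Ioi_rpow_of_lt (show 2 * lam - 2 < -1 by linarith) hr).const_mul
    (4 * |W| / c₁ ^ 2)
  have hc2 := sq_pos_of_ne_zero hc₁
  have hle : ∀ᵐ τ ∂(volume.restrict (Ioi r)), ‖W / (y₁ τ ^ 2 + y₂ τ ^ 2)‖ ≤
      4 * |W| / c₁ ^ 2 * τ ^ (2 * lam - 2) := by
    refine (ae_restrict_iff' measurableSet_Ioi).2 (Eventually.of_forall fun τ hτ => ?_)
    have hτ0 : 0 < τ := hr.trans hτ
    have h3 := hb τ (le_of_lt hτ)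
    rw [abs_of_pos hτ0] at h3
    have h4 : c₁ ^ 2 / 4 * τ ^ (2 - 2 * lam) ≤ y₁ τ ^ 2 := by
      rw [← sq_abs (y₁ τ)]
      calc c₁ ^ 2 / 4 * τ ^ (2 - 2 * lam) = (|c₁| / 2 * τ ^ (1 - lam)) ^ 2 := by
            rw [mul_pow, div_pow, sq_abs, ← Real.rpow_natCast (τ ^ (1 - lam)),
              ← Real.rpow_mul hτ0.le]
            push_cast
            ring_nf
        _ ≤ _ := by gcongr
    have h5 : 0 < τ ^ (2 - 2 * lam) := Real.rpow_pos_of_pos hτ0 _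
    rw [norm_div, Real.norm_eq_abs, Real.norm_of_nonneg (by positivity)]
    calc |W| / (y₁ τ ^ 2 + y₂ τ ^ 2) ≤ |W| / (c₁ ^ 2 / 4 * τ ^ (2 - 2 * lam)) := by
          gcongr
          nlinarith [sq_nonneg (y₂ τ)]
      _ = _ := by
          rw [show 2 * lam - 2 = -(2 - 2 * lam) by ring, Real.rpow_neg hτ0.le]
          field_simp
  have hmeas : AEStronglyMeasurable (fun τ => W / (y₁ τ ^ 2 + y₂ τ ^ 2))
      (volume.restrict (Ioi r)) :=
    (measurable_const.div ((h₁.measurable.pow_const 2).add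
      (h₂.measurable.pow_const 2))).aestronglyMeasurable
  refine ⟨Integrable.mono' hint hmeas hle, ?_⟩
  rw [← Real.norm_eq_abs]
  refine (norm_integral_le_of_norm_le hint hle).trans (le_of_eq ?_)
  rw [integral_const_mul, integral_Ioi_rpow_of_lt (by linarith) hr,
    show 2 * lam - 2 + 1 = -(1 - 2 * lam) by ring, neg_div_neg_eq]
  ring_nf

/-- All conditions on a cutoff radius that concern the half line `t > 0`. -/
theorem exists_forall_cutoff (h₁ : ∀ t, HasDerivAt y₁ (v₁ t) t)
    (h₂ : ∀ t, HasDerivAt y₂ (v₂ t) t) (hW : ∀ t, v₁ t * y₂ t - y₁ t * v₂ t = W) (hW0 : W ≠ 0)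
    (hlam : lam < 1 / 2) (hc₁ : c₁ ≠ 0)
    (hl₁ : Tendsto (fun t : ℝ => y₁ t / |t| ^ (1 - lam)) atTop (𝓝 c₁))
    (hl₂ : Tendsto (fun t : ℝ => y₂ t / |t| ^ lam) atTop (𝓝 c₂)) :
    ∃ R : ℝ, 0 < R ∧ ∀ r, R ≤ r →
      (∀ t, r ≤ t → |c₁| / 2 * |t| ^ (1 - lam) ≤ |y₁ t| ∧ |y₁ t| ≤ 2 * |c₁| * |t| ^ (1 - lam)) ∧
      (∀ t, r ≤ t → |c₂| / 2 * |t| ^ lam ≤ |y₂ t| ∧ |y₂ t| ≤ 2 * |c₂| * |t| ^ lam) ∧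
      IntegrableOn (fun τ => W / (y₁ τ ^ 2 + y₂ τ ^ 2)) (Ioi r) volume ∧
      |∫ τ in Ioi r, W / (y₁ τ ^ 2 + y₂ τ ^ 2)| < Real.pi / 2 := by
  have hc₂ := limit_ne_zero_of_wronskian h₁ h₂ hW hW0 hlam hc₁ hl₁ hl₂
  obtain ⟨R₁, hR₁⟩ := eventually_atTop.1 (eventually_abs_bounds_of_tendsto hc₁ hl₁)
  obtain ⟨R₂, hR₂⟩ := eventually_atTop.1 (eventually_abs_bounds_of_tendsto hc₂ hl₂)
  have hlim : Tendsto (fun r : ℝ => 4 * |W| / c₁ ^ 2 * (r ^ (2 * lam - 1) / (1 - 2 * lam))) atTop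
      (𝓝 0) := by
    have h3 := tendsto_rpow_neg_atTop (show 0 < 1 - 2 * lam by linarith)
    have h4 := (h3.div_const (1 - 2 * lam)).const_mul (4 * |W| / c₁ ^ 2)
    rw [zero_div, mul_zero] at h4
    simpa only [neg_sub] using h4
  obtain ⟨R₃, hR₃⟩ := eventually_atTop.1 (hlim.eventually (gt_mem_nhds
    (show 0 < Real.pi / 2 by positivity)))
  refine ⟨max (max R₁ R₂) (max R₃ 1), lt_of_lt_of_le one_pos
    ((le_max_right _ _).trans (le_max_right _ _)), fun r hr => ?_⟩
  have hr1 : R₁ ≤ r := ((le_max_left _ _).trans (le_max_left _ _)).trans hr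
  have hr2 : R₂ ≤ r := ((le_max_right _ _).trans (le_max_left _ _)).trans hr
  have hr3 : R₃ ≤ r := ((le_max_left _ _).trans (le_max_right _ _)).trans hr
  have hr4 : 1 ≤ r := ((le_max_right _ _).trans (le_max_right _ _)).trans hr
  obtain ⟨h5, h6⟩ := integrableOn_and_abs_integral_le (W := W)
    (continuous_iff_continuousAt.2 fun t => (h₁ t).continuousAt)
    (continuous_iff_continuousAt.2 fun t => (h₂ t).continuousAt) hlam hc₁
    (show 0 < r by linarith) (fun t ht => (hR₁ t (hr1.trans ht)).1)
  exact ⟨fun t ht => hR₁ t (hr1.trans ht), fun t ht => hR₂ t (hr2.trans ht), h5,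
    h6.trans_lt (hR₃ r hr3)⟩

theorem abs_cross_eq (hy : ∀ t, r₀ ≤ t → y₁ t ≠ 0) {s t : ℝ} (hs : r₀ ≤ s) (ht : r₀ ≤ t) :
    |y₁ s * y₂ t - y₂ s * y₁ t| = |y₁ s| * |y₁ t| * |y₂ s / y₁ s - y₂ t / y₁ t| := by
  have h1 := hy s hs
  have h2 := hy t ht
  rw [← abs_mul, ← abs_mul, abs_sub_comm]
  congr 1
  field_simp

theorem abs_pos_of_bound (hr : 0 < r₀) (hc₁ : c₁ ≠ 0)
    (hb : ∀ t, r₀ ≤ t → |c₁| / 2 * |t| ^ (1 - lam) ≤ |y₁ t|) (t : ℝ) (ht : r₀ ≤ t) : y₁ t ≠ 0 := by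
  have h5 : 0 < |t| ^ (1 - lam) := Real.rpow_pos_of_pos (abs_pos.2 (by linarith)) _
  have := abs_pos.2 hc₁
  exact abs_pos.1 (lt_of_lt_of_le (by positivity) (hb t ht))

/-- Two lower bounds with factor `1/2` and one squared upper bound with factor `2` give `1/16`, and
`c₁` cancels. -/
theorem le_mul_of_bounds (hr : 0 < r₀) (hlam1 : lam < 1) (hc₁ : c₁ ≠ 0)
    (hb : ∀ t, r₀ ≤ t → |c₁| / 2 * |t| ^ (1 - lam) ≤ |y₁ t| ∧ |y₁ t| ≤ 2 * |c₁| * |t| ^ (1 - lam))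
    {s t ξ τ : ℝ} (hs : r₀ ≤ s) (ht : r₀ ≤ t) (hξ : r₀ ≤ ξ) (hξτ : ξ ≤ τ) :
    1 / 16 * (s ^ (1 - lam) * t ^ (1 - lam) / (τ ^ (1 - lam)) ^ 2) ≤
      |y₁ s| * |y₁ t| * (1 / y₁ ξ ^ 2) := by
  have hs0 : 0 < s := hr.trans_le hs
  have ht0 : 0 < t := hr.trans_le ht
  have hξ0 : 0 < ξ := hr.trans_le hξ
  have hτ0 : 0 < τ := hξ0.trans_le hξτ
  have h1 := (hb s hs).1
  have h2 := (hb t ht).1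
  have h3 := (hb ξ hξ).2
  rw [abs_of_pos hs0] at h1
  rw [abs_of_pos ht0] at h2
  rw [abs_of_pos hξ0] at h3
  have hc := abs_pos.2 hc₁
  have hy : 0 < |y₁ ξ| := abs_pos.2 (abs_pos_of_bound hr hc₁ (fun t ht => (hb t ht).1) ξ hξ)
  have hsp := Real.rpow_pos_of_pos hs0 (1 - lam)
  have htp := Real.rpow_pos_of_pos ht0 (1 - lam)
  have hτp := Real.rpow_pos_of_pos hτ0 (1 - lam)
  have hmono : ξ ^ (1 - lam) ≤ τ ^ (1 - lam) :=
    Real.rpow_le_rpow hξ0.le hξτ (by linarith)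
  calc 1 / 16 * (s ^ (1 - lam) * t ^ (1 - lam) / (τ ^ (1 - lam)) ^ 2)
      = (|c₁| / 2 * s ^ (1 - lam)) * (|c₁| / 2 * t ^ (1 - lam)) *
          (1 / (2 * |c₁| * τ ^ (1 - lam)) ^ 2) := by
        field_simp
        norm_num
    _ ≤ _ := by
        rw [← sq_abs (y₁ ξ)]
        have h4 : |y₁ ξ| ≤ 2 * |c₁| * τ ^ (1 - lam) := h3.trans (by gcongr)
        gcongr

/-- With `ξ ≤ t` in the mean value form, the powers reduce to `(s/t)^(1 - lam) ≥ s/t ≥ 1/2`, which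
turns `1/16` into `1/32`. -/
theorem le_abs_cross_of_comparable (h₁ : ∀ t, HasDerivAt y₁ (v₁ t) t)
    (h₂ : ∀ t, HasDerivAt y₂ (v₂ t) t) (hW : ∀ t, v₁ t * y₂ t - y₁ t * v₂ t = W)
    (hr : 0 < r₀) (hlam0 : 0 ≤ lam) (hlam1 : lam < 1) (hc₁ : c₁ ≠ 0)
    (hb : ∀ t, r₀ ≤ t → |c₁| / 2 * |t| ^ (1 - lam) ≤ |y₁ t| ∧ |y₁ t| ≤ 2 * |c₁| * |t| ^ (1 - lam))
    {s t : ℝ} (hs : r₀ ≤ s) (hst : s ≤ t) (hts : t ≤ 2 * s) :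
    1 / 32 * (t - s) * |W| ≤ |y₁ s * y₂ t - y₂ s * y₁ t| := by
  have hy := abs_pos_of_bound hr hc₁ (fun t ht => (hb t ht).1)
  have ht : r₀ ≤ t := hs.trans hst
  have hs0 : 0 < s := hr.trans_le hs
  have ht0 : 0 < t := hr.trans_le ht
  obtain ⟨ξ, hξ1, hξ2, he⟩ := exists_ratio_sub_eq h₁ h₂ hW hst
    (fun τ hτ => hy τ (hs.trans hτ))
  have hn : 0 ≤ (t - s) / y₁ ξ ^ 2 := div_nonneg (by linarith) (sq_nonneg _)
  rw [abs_cross_eq hy hs ht, he, abs_mul, abs_of_nonneg hn]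
  have key := le_mul_of_bounds hr hlam1 hc₁ hb hs ht (hs.trans hξ1) hξ2
  have hhalf : (1 : ℝ) / 2 ≤ s ^ (1 - lam) * t ^ (1 - lam) / (t ^ (1 - lam)) ^ 2 := by
    have htp := Real.rpow_pos_of_pos ht0 (1 - lam)
    have e1 : s ^ (1 - lam) * t ^ (1 - lam) / (t ^ (1 - lam)) ^ 2 = (s / t) ^ (1 - lam) := by
      rw [Real.div_rpow hs0.le ht0.le]
      field_simp
    rw [e1]
    have h3 : (1 : ℝ) / 2 ≤ s / t := by
      rw [div_le_div_iff₀ (by norm_num) ht0]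
      linarith
    have h4 : s / t ≤ 1 := (div_le_one ht0).2 hst
    calc (1 : ℝ) / 2 ≤ s / t := h3
      _ = (s / t) ^ (1 : ℝ) := (Real.rpow_one _).symm
      _ ≤ (s / t) ^ (1 - lam) :=
          Real.rpow_le_rpow_of_exponent_ge (div_pos hs0 ht0) h4 (by linarith)
  have e2 : |y₁ s| * |y₁ t| * (|W| * ((t - s) / y₁ ξ ^ 2)) =
      |y₁ s| * |y₁ t| * (1 / y₁ ξ ^ 2) * ((t - s) * |W|) := by ring
  rw [e2, mul_assoc]
  refine mul_le_mul_of_nonneg_right ?_ (mul_nonneg (by linarith) (abs_nonneg W))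
  linarith

/-- The increments of `y₂ / y₁` over `[s, 2s]` and `[2s, t]` have the same sign, so the first alone
is a lower bound. There `ξ ≤ 2s`, and what remains is at least a multiple of `s^lam t^(1 - lam) ≥
r₀^lam (t - s)^(1 - lam)`. -/
theorem le_abs_cross_of_nonComparable (h₁ : ∀ t, HasDerivAt y₁ (v₁ t) t)
    (h₂ : ∀ t, HasDerivAt y₂ (v₂ t) t) (hW : ∀ t, v₁ t * y₂ t - y₁ t * v₂ t = W)
    (hr : 0 < r₀) (hlam0 : 0 ≤ lam) (hlam1 : lam < 1) (hc₁ : c₁ ≠ 0)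
    (hb : ∀ t, r₀ ≤ t → |c₁| / 2 * |t| ^ (1 - lam) ≤ |y₁ t| ∧ |y₁ t| ≤ 2 * |c₁| * |t| ^ (1 - lam))
    {s t : ℝ} (hs : r₀ ≤ s) (hst : 2 * s ≤ t) :
    r₀ ^ lam / 64 * (t - s) ^ (1 - lam) * |W| ≤ |y₁ s * y₂ t - y₂ s * y₁ t| := by
  have hy := abs_pos_of_bound hr hc₁ (fun t ht => (hb t ht).1)
  have hs0 : 0 < s := hr.trans_le hs
  have ht : r₀ ≤ t := by linarith
  have ht0 : 0 < t := hr.trans_le ht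
  have h2s : r₀ ≤ 2 * s := by linarith
  obtain ⟨ξ, hξ1, hξ2, he⟩ := exists_ratio_sub_eq h₁ h₂ hW (show s ≤ 2 * s by linarith)
    (fun τ hτ => hy τ (hs.trans hτ))
  obtain ⟨η, -, -, he'⟩ := exists_ratio_sub_eq h₁ h₂ hW hst (fun τ hτ => hy τ (h2s.trans hτ))
  have hsum : y₂ s / y₁ s - y₂ t / y₁ t = W * (s / y₁ ξ ^ 2 + (t - 2 * s) / y₁ η ^ 2) := by
    have : y₂ s / y₁ s - y₂ t / y₁ t = (y₂ s / y₁ s - y₂ (2 * s) / y₁ (2 * s)) +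
      (y₂ (2 * s) / y₁ (2 * s) - y₂ t / y₁ t) := by ring
    rw [this, he, he']
    ring
  have hη : 0 ≤ (t - 2 * s) / y₁ η ^ 2 := div_nonneg (by linarith) (sq_nonneg _)
  have hξn : 0 ≤ s / y₁ ξ ^ 2 := div_nonneg hs0.le (sq_nonneg _)
  rw [abs_cross_eq hy hs ht, hsum, abs_mul, abs_of_nonneg (add_nonneg hξn hη)]
  have key := le_mul_of_bounds hr hlam1 hc₁ hb hs ht (hs.trans hξ1) hξ2
  have hsp := Real.rpow_pos_of_pos hs0 (1 - lam)
  have htp := Real.rpow_pos_of_pos ht0 (1 - lam)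
  have h3 : r₀ ^ lam / 4 * (t - s) ^ (1 - lam) ≤
      s ^ (1 - lam) * t ^ (1 - lam) / ((2 * s) ^ (1 - lam)) ^ 2 * s := by
    have e1 : s = s ^ (1 - lam) * s ^ lam := by
      rw [← Real.rpow_add hs0, sub_add_cancel, Real.rpow_one]
    have h2p : (2 : ℝ) ^ (1 - lam) ≤ 2 := by
      calc (2 : ℝ) ^ (1 - lam) ≤ 2 ^ (1 : ℝ) :=
            Real.rpow_le_rpow_of_exponent_le (by norm_num) (by linarith)
        _ = 2 := Real.rpow_one 2
    have h2p0 : (0 : ℝ) < 2 ^ (1 - lam) := by positivity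
    have e2 : s ^ (1 - lam) * t ^ (1 - lam) / ((2 * s) ^ (1 - lam)) ^ 2 * s =
        s ^ lam * t ^ (1 - lam) / (2 ^ (1 - lam)) ^ 2 := by
      rw [Real.mul_rpow (by norm_num) hs0.le]
      nth_rewrite 3 [e1]
      field_simp
    rw [e2]
    have h4 : r₀ ^ lam ≤ s ^ lam := Real.rpow_le_rpow hr.le hs hlam0
    have h5 : (t - s) ^ (1 - lam) ≤ t ^ (1 - lam) :=
      Real.rpow_le_rpow (by linarith) (by linarith) (by linarith)
    have h6 : ((2 : ℝ) ^ (1 - lam)) ^ 2 ≤ 4 := by nlinarith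
    have h7 : 0 ≤ (t - s) ^ (1 - lam) := Real.rpow_nonneg (by linarith) _
    calc r₀ ^ lam / 4 * (t - s) ^ (1 - lam) = r₀ ^ lam * (t - s) ^ (1 - lam) / 4 := by ring
      _ ≤ s ^ lam * t ^ (1 - lam) / (2 ^ (1 - lam)) ^ 2 := by gcongr
  calc r₀ ^ lam / 64 * (t - s) ^ (1 - lam) * |W|
      = 1 / 16 * (r₀ ^ lam / 4 * (t - s) ^ (1 - lam)) * |W| := by ring
    _ ≤ 1 / 16 * (s ^ (1 - lam) * t ^ (1 - lam) / ((2 * s) ^ (1 - lam)) ^ 2 * s) * |W| := by gcongr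
    _ = 1 / 16 * (s ^ (1 - lam) * t ^ (1 - lam) / ((2 * s) ^ (1 - lam)) ^ 2) * (s * |W|) := by ring
    _ ≤ |y₁ s| * |y₁ t| * (1 / y₁ ξ ^ 2) * (s * |W|) := by gcongr
    _ = |y₁ s| * |y₁ t| * (|W| * (s / y₁ ξ ^ 2)) := by ring
    _ ≤ _ := by
        gcongr
        linarith

end Asymptotics

/-! ### Symmetry in the two times and under time reversal. -/

section Reflection

variable {y₁ y₂ v₁ v₂ : ℝ → ℝ} {W lam c₁ r₀ : ℝ}

theorem hasDerivAt_comp_const_mul {y v : ℝ → ℝ} (h : ∀ t, HasDerivAt y (v t) t) (ε t : ℝ) :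
    HasDerivAt (fun t => y (ε * t)) (ε * v (ε * t)) t := by
  have := (h (ε * t)).comp t ((hasDerivAt_id t).const_mul ε)
  exact this.congr_deriv (by ring)

theorem le_abs_cross_of_comparable_abs (h₁ : ∀ t, HasDerivAt y₁ (v₁ t) t)
    (h₂ : ∀ t, HasDerivAt y₂ (v₂ t) t) (hW : ∀ t, v₁ t * y₂ t - y₁ t * v₂ t = W)
    (hr : 0 < r₀) (hlam0 : 0 ≤ lam) (hlam1 : lam < 1) (hc₁ : c₁ ≠ 0)
    (hb : ∀ t, r₀ ≤ t → |c₁| / 2 * |t| ^ (1 - lam) ≤ |y₁ t| ∧ |y₁ t| ≤ 2 * |c₁| * |t| ^ (1 - lam))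
    {s t : ℝ} (hs : r₀ ≤ s) (ht : r₀ ≤ t) (hst : s ≤ 2 * t) (hts : t ≤ 2 * s) :
    1 / 32 * |t - s| * |W| ≤ |y₁ s * y₂ t - y₂ s * y₁ t| := by
  rcases le_total s t with h | h
  · rw [abs_of_nonneg (sub_nonneg.2 h)]
    exact le_abs_cross_of_comparable h₁ h₂ hW hr hlam0 hlam1 hc₁ hb hs h hts
  · rw [abs_of_nonpos (sub_nonpos.2 h), neg_sub,
      show y₁ s * y₂ t - y₂ s * y₁ t = -(y₁ t * y₂ s - y₂ t * y₁ s) by ring, abs_neg]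
    exact le_abs_cross_of_comparable h₁ h₂ hW hr hlam0 hlam1 hc₁ hb ht h hst

theorem le_abs_cross_of_nonComparable_abs (h₁ : ∀ t, HasDerivAt y₁ (v₁ t) t)
    (h₂ : ∀ t, HasDerivAt y₂ (v₂ t) t) (hW : ∀ t, v₁ t * y₂ t - y₁ t * v₂ t = W)
    (hr : 0 < r₀) (hlam0 : 0 ≤ lam) (hlam1 : lam < 1) (hc₁ : c₁ ≠ 0)
    (hb : ∀ t, r₀ ≤ t → |c₁| / 2 * |t| ^ (1 - lam) ≤ |y₁ t| ∧ |y₁ t| ≤ 2 * |c₁| * |t| ^ (1 - lam))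
    {s t : ℝ} (hs : r₀ ≤ s) (ht : r₀ ≤ t) (hst : 2 * s ≤ t ∨ 2 * t ≤ s) :
    r₀ ^ lam / 64 * |t - s| ^ (1 - lam) * |W| ≤ |y₁ s * y₂ t - y₂ s * y₁ t| := by
  rcases hst with h | h
  · rw [abs_of_nonneg (show 0 ≤ t - s by linarith)]
    exact le_abs_cross_of_nonComparable h₁ h₂ hW hr hlam0 hlam1 hc₁ hb hs h
  · rw [abs_of_nonpos (show t - s ≤ 0 by linarith), neg_sub,
      show y₁ s * y₂ t - y₂ s * y₁ t = -(y₁ t * y₂ s - y₂ t * y₁ s) by ring, abs_neg]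
    exact le_abs_cross_of_nonComparable h₁ h₂ hW hr hlam0 hlam1 hc₁ hb ht h

end Reflection

/-! ### Cutoff radii and lower bounds on the regions of both signs. -/

section Cutoff

variable {m : ℝ} {σ y₁ y₂ : ℝ → ℝ} {lam c₁p c₁m c₂p c₂m r₀ : ℝ}

theorem CoefficientAssumption.wronskian_comp_const_mul
    (hA : CoefficientAssumption m σ y₁ y₂ lam c₁p c₁m c₂p c₂m) (ε t : ℝ) :
    ε * deriv y₁ (ε * t) * y₂ (ε * t) - y₁ (ε * t) * (ε * deriv y₂ (ε * t)) =
      ε * wronskianConst y₁ y₂ := by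
  rw [← hA.wronskian_eq (ε * t)]
  ring

/-- The half line `t < 0` is the positive one for the reflected solutions, whose Wronskian is `-W`;
the sign is lost in absolute values. -/
theorem CoefficientAssumption.exists_isCutoffRadius
    (hA : CoefficientAssumption m σ y₁ y₂ lam c₁p c₁m c₂p c₂m) :
    ∃ r₀, IsCutoffRadius y₁ y₂ lam c₁p c₁m c₂p c₂m r₀ := by
  have hW0 := hA.wronskianConst_ne_zero
  obtain ⟨R, hR0, hR⟩ := exists_forall_cutoff hA.sol₁.hasDerivAt hA.sol₂.hasDerivAt
    hA.wronskian_eq hW0 hA.lam_lt hA.c₁p_ne hA.lim₁p hA.lim₂p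
  have hneg : Tendsto (fun t : ℝ => -1 * t) atTop atBot := by
    simpa using tendsto_neg_atTop_atBot (G := ℝ)
  have hl : ∀ (y : ℝ → ℝ) (a c : ℝ), Tendsto (fun t : ℝ => y t / |t| ^ a) atBot (𝓝 c) →
      Tendsto (fun t : ℝ => y (-1 * t) / |t| ^ a) atTop (𝓝 c) := fun y a c h => by
    refine (h.comp hneg).congr fun t => ?_
    simp
  obtain ⟨R', -, hR'⟩ := exists_forall_cutoff
    (hasDerivAt_comp_const_mul hA.sol₁.hasDerivAt (-1))
    (hasDerivAt_comp_const_mul hA.sol₂.hasDerivAt (-1))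
    (hA.wronskian_comp_const_mul (-1)) (by simpa using hW0) hA.lam_lt hA.c₁m_ne
    (hl _ _ _ hA.lim₁m) (hl _ _ _ hA.lim₂m)
  obtain ⟨hp1, hp2, hp3, hp4⟩ := hR (max R R') (le_max_left _ _)
  obtain ⟨hm1, hm2, hm3, hm4⟩ := hR' (max R R') (le_max_right _ _)
  set r := max R R' with hr
  set F : ℝ → ℝ := fun τ => wronskianConst y₁ y₂ / (y₁ τ ^ 2 + y₂ τ ^ 2) with hF
  have hFn : (fun τ => -1 * wronskianConst y₁ y₂ / (y₁ (-1 * τ) ^ 2 + y₂ (-1 * τ) ^ 2)) =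
      fun τ => -F (-τ) := by
    funext τ
    simp only [hF, neg_one_mul, neg_div]
  rw [hFn] at hm3 hm4
  refine ⟨r, hR0.trans_le (le_max_left _ _), hp1, fun t ht => ?_, hp2, fun t ht => ?_, hp3, ?_,
    hp4, ?_⟩
  · simpa using hm1 (-t) (by linarith)
  · simpa using hm2 (-t) (by linarith)
  · have h1 : IntegrableOn (fun τ => F (-τ)) (Ioi r) volume := by
      simpa using hm3.neg
    have h2 := (Measure.measurePreserving_neg (volume : Measure ℝ)).integrableOn_comp_preimage
      (Homeomorph.neg ℝ).measurableEmbedding (f := F) (s := Iio (-r))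
    refine h2.1 ?_
    simpa [Function.comp_def] using h1
  · rwa [integral_neg, abs_neg, integral_comp_neg_Ioi, integral_Iic_eq_integral_Iio] at hm4

theorem IsCutoffRadius.exists_bounds (hA : CoefficientAssumption m σ y₁ y₂ lam c₁p c₁m c₂p c₂m)
    (hr : IsCutoffRadius y₁ y₂ lam c₁p c₁m c₂p c₂m r₀) {ε : ℝ} (hε : ε = 1 ∨ ε = -1) :
    ∃ c₁ : ℝ, c₁ ≠ 0 ∧ ∀ t, r₀ ≤ t → |c₁| / 2 * |t| ^ (1 - lam) ≤ |y₁ (ε * t)| ∧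
      |y₁ (ε * t)| ≤ 2 * |c₁| * |t| ^ (1 - lam) := by
  rcases hε with rfl | rfl
  · exact ⟨c₁p, hA.c₁p_ne, fun t ht => by simpa using hr.bound₁p t ht⟩
  · exact ⟨c₁m, hA.c₁m_ne, fun t ht => by simpa using hr.bound₁m (-t) (by linarith)⟩

theorem IsCutoffRadius.le_abs_cross_of_mem_comparableRegion
    (hA : CoefficientAssumption m σ y₁ y₂ lam c₁p c₁m c₂p c₂m)
    (hr : IsCutoffRadius y₁ y₂ lam c₁p c₁m c₂p c₂m r₀) {ε : ℝ} (hε : ε = 1 ∨ ε = -1) {t s : ℝ}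
    (h : (t, s) ∈ comparableRegion r₀ ε) :
    1 / 32 * |t - s| * |wronskianConst y₁ y₂| ≤ |y₁ s * y₂ t - y₂ s * y₁ t| := by
  obtain ⟨c₁, hc₁, hb⟩ := hr.exists_bounds hA hε
  obtain ⟨-, h1, h2, ht, hs⟩ := h
  have hε2 : ∀ x : ℝ, ε * (ε * x) = x := by rcases hε with rfl | rfl <;> simp
  have hεa : |ε| = 1 := by rcases hε with rfl | rfl <;> simp
  have habs : ∀ x : ℝ, r₀ ≤ ε * x → |x| = ε * x := fun x hx => by
    rw [← abs_of_pos (hr.pos.trans_le hx), abs_mul, hεa, one_mul]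
  simp only [habs t ht, habs s hs] at h1 h2
  have := le_abs_cross_of_comparable_abs
    (hasDerivAt_comp_const_mul hA.sol₁.hasDerivAt ε)
    (hasDerivAt_comp_const_mul hA.sol₂.hasDerivAt ε)
    (hA.wronskian_comp_const_mul ε) hr.pos hA.lam_nonneg (by linarith [hA.lam_lt]) hc₁ hb hs ht
    h2 (by linarith)
  simpa only [hε2, ← mul_sub, abs_mul, hεa, one_mul] using this

theorem IsCutoffRadius.le_abs_cross_of_mem_nonComparableRegion
    (hA : CoefficientAssumption m σ y₁ y₂ lam c₁p c₁m c₂p c₂m)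
    (hr : IsCutoffRadius y₁ y₂ lam c₁p c₁m c₂p c₂m r₀) {ε : ℝ} (hε : ε = 1 ∨ ε = -1) {t s : ℝ}
    (h : (t, s) ∈ nonComparableRegion r₀ ε) :
    r₀ ^ lam / 64 * |t - s| ^ (1 - lam) * |wronskianConst y₁ y₂| ≤
      |y₁ s * y₂ t - y₂ s * y₁ t| := by
  obtain ⟨c₁, hc₁, hb⟩ := hr.exists_bounds hA hε
  obtain ⟨-, h1, ht, hs⟩ := h
  have hε2 : ∀ x : ℝ, ε * (ε * x) = x := by rcases hε with rfl | rfl <;> simp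
  have hεa : |ε| = 1 := by rcases hε with rfl | rfl <;> simp
  have habs : ∀ x : ℝ, r₀ ≤ ε * x → |x| = ε * x := fun x hx => by
    rw [← abs_of_pos (hr.pos.trans_le hx), abs_mul, hεa, one_mul]
  simp only [habs t ht, habs s hs] at h1
  have := le_abs_cross_of_nonComparable_abs
    (hasDerivAt_comp_const_mul hA.sol₁.hasDerivAt ε)
    (hasDerivAt_comp_const_mul hA.sol₂.hasDerivAt ε)
    (hA.wronskian_comp_const_mul ε) hr.pos hA.lam_nonneg (by linarith [hA.lam_lt]) hc₁ hb hs ht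
    (h1.imp (fun h => by linarith) fun h => h)
  simpa only [hε2, ← mul_sub, abs_mul, hεa, one_mul] using this

/-- Cramer's rule for the Cauchy data at `t`, with determinant `W`. It identifies the `e` in the
kernel with the cross product of `y₁` and `y₂`. -/
theorem CoefficientAssumption.exists_isNormalizedPair
    (hA : CoefficientAssumption m σ y₁ y₂ lam c₁p c₁m c₂p c₂m) (t : ℝ) :
    ∃ z vz e ve, IsNormalizedPair (fun t => ∫ τ in (0 : ℝ)..t, σ τ) m t z vz e ve ∧
      ∀ s, |e s| = |y₁ s * y₂ t - y₂ s * y₁ t| / |wronskianConst y₁ y₂| := by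
  obtain ⟨K, -, hK⟩ := hA.sigma_mem.exists_ae_bound
  have hS := abs_primitive_sub_le hA.sigma_mem hK
  have h₁ := hA.sol₁.isDrivenSolution hA.sigma_mem
  have h₂ := hA.sol₂.isDrivenSolution hA.sigma_mem
  have hW0 := hA.wronskianConst_ne_zero
  have hW := hA.wronskian_eq t
  set W := wronskianConst y₁ y₂
  refine ⟨_, _, _, _, ⟨h₁.combination hS h₂ (-deriv y₂ t / W) (deriv y₁ t / W),
    h₁.combination hS h₂ (y₂ t / W) (-y₁ t / W), ?_, ?_, ?_, ?_⟩, fun s => ?_⟩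
  · field_simp
    linarith
  · ring
  · ring
  · field_simp
    linarith
  · rw [← abs_div]
    congr 1
    ring

end Cutoff

/-! ### The propagator estimate with constants uniform in `q`. -/

section Propagator

variable {n : ℕ} {m : ℝ} {σ : ℝ → ℝ} {U : ℝ → ℝ → (L2Space n →L[ℂ] L2Space n)}

/-- `U s s` is idempotent and unitary, hence the identity. -/
theorem IsPropagator.apply_self (hU : IsPropagator n m σ U) (s : ℝ) : U s s = 1 := by
  have h1 : star (U s s) * U s s = 1 := (Unitary.mem_iff.1 (hU.mem_unitary s s)).1
  have h2 : U s s * U s s = U s s := hU.comp s s s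
  calc U s s = star (U s s) * U s s * U s s := by rw [h1, one_mul]
    _ = 1 := by rw [mul_assoc, h2, h1]

theorem IsPropagator.adjoint_eq (hU : IsPropagator n m σ U) (t s : ℝ) :
    ContinuousLinearMap.adjoint (U t s) = U s t := by
  have h1 : star (U t s) * U t s = 1 := (Unitary.mem_iff.1 (hU.mem_unitary t s)).1
  have h2 : U t s * U s t = 1 := (hU.comp t s t).trans (hU.apply_self t)
  rw [← ContinuousLinearMap.star_eq_adjoint]
  calc star (U t s) = star (U t s) * (U t s * U s t) := by rw [h2, mul_one]
    _ = U s t := by rw [← mul_assoc, h1, one_mul]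

theorem IsPropagator.apply_adjoint_apply (hU : IsPropagator n m σ U) (t s : ℝ) (φ : L2Space n) :
    U t 0 (ContinuousLinearMap.adjoint (U s 0) φ) = U t s φ := by
  rw [hU.adjoint_eq, ← hU.comp t 0 s]
  rfl

theorem IsPropagator.norm_apply (hU : IsPropagator n m σ U) (t s : ℝ) (φ : L2Space n) :
    ‖U t s φ‖ = ‖φ‖ :=
  ContinuousLinearMap.norm_map_of_mem_unitary (hU.mem_unitary t s) φ

theorem IsPropagator.eLpNorm_apply_two (hU : IsPropagator n m σ U) (t s : ℝ) (φ : L2Space n) :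
    eLpNorm (U t s φ) 2 volume = eLpNorm φ 2 volume := by
  have := hU.norm_apply t s φ
  rw [Lp.norm_def, Lp.norm_def] at this
  exact (ENNReal.toReal_eq_toReal_iff' (Lp.eLpNorm_ne_top _) (Lp.eLpNorm_ne_top _)).1 this

/-- The `L^q' → L^q` estimate for the propagator in terms of the solution `e` with `e(t) = 0` and
`e'(t) = 1`. -/
theorem IsPropagator.eLpNorm_apply_le (hm : 0 < m) (hσ : MemLp σ ∞ volume)
    (hU : IsPropagator n m σ U) {t : ℝ} {z vz e ve : ℝ → ℝ}
    (h : IsNormalizedPair (fun t => ∫ τ in (0 : ℝ)..t, σ τ) m t z vz e ve) {s : ℝ}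
    (hs : e s ≠ 0) {q q' : ℝ≥0∞} (hq : 2 ≤ q) (hqq : q.HolderConjugate q') (φ : L2Space n) :
    eLpNorm (U t s φ) q volume ≤
      ENNReal.ofReal (m / (2 * Real.pi * |e s|)) ^ ((n : ℝ) * (1 / 2 - (1 / q).toReal)) *
        eLpNorm φ q' volume := by
  have hD : 0 < m / (2 * Real.pi * |e s|) := by
    have := abs_pos.2 hs
    positivity
  set D := m / (2 * Real.pi * |e s|) with hDdef
  have hD0 : ENNReal.ofReal D ≠ 0 := (ENNReal.ofReal_pos.2 hD).ne'
  have hU1 : ∀ s φ, U s s φ = φ := fun s φ => by rw [hU.apply_self s]; rfl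
  have h1 : ∀ u : L2Space n, Integrable u → ∀ᵐ x, ‖U t s u x‖ ≤ D ^ (n / 2 : ℝ) * ∫ y, ‖u y‖ :=
    fun u hu => hU.ae_norm_apply_le hm hσ hU1 h hs hu
  have hconj : q' = 1 + (q - 1)⁻¹ := ENNReal.HolderConjugate.conj_eq (h := hqq)
  rcases eq_or_ne (eLpNorm φ q' volume) ∞ with htop | htop
  · rw [htop, ENNReal.mul_top]
    · exact le_top
    · exact (ENNReal.rpow_pos (pos_iff_ne_zero.2 hD0) ENNReal.ofReal_ne_top).ne'
  -- The endpoints `q = ∞` (the dispersive bound) and `q = 2` (unitarity) are separate because the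
  -- interpolation lemma needs a dual exponent strictly between `1` and `2`.
  rcases eq_or_ne q ∞ with rfl | hqt
  · have hq1 : q' = 1 := by simpa using hconj
    subst hq1
    have hint : Integrable φ := memLp_one_iff_integrable.1
      ⟨(Lp.memLp φ).aestronglyMeasurable, htop.lt_top⟩
    rw [eLpNorm_exponent_top]
    refine (eLpNormEssSup_le_of_ae_bound (h1 φ hint)).trans (le_of_eq ?_)
    rw [ENNReal.ofReal_mul (by positivity), ENNReal.ofReal_rpow_of_pos hD,
      eLpNorm_one_eq_lintegral_enorm, ← ofReal_integral_norm_eq_lintegral_enorm hint]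
    simp [div_eq_mul_inv]
  rcases eq_or_lt_of_le hq with rfl | hq2
  · have hq1 : q' = 2 := by
      rw [hconj, ← one_add_one_eq_two, ENNReal.add_sub_cancel_right ENNReal.one_ne_top, inv_one]
    subst hq1
    rw [hU.eLpNorm_apply_two]
    simp
  · have hq't : q' ≠ ∞ := by
      rw [hconj]
      refine ENNReal.add_ne_top.2 ⟨ENNReal.one_ne_top, ENNReal.inv_ne_top.2 ?_⟩
      exact (tsub_pos_of_lt (lt_of_lt_of_le (by norm_num) hq)).ne'
    have hr : q.toReal.HolderConjugate q'.toReal :=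
      haveI := hqq
      ENNReal.HolderConjugate.toReal_of_ne_top hqt hq't
    have hq2' : 2 < q.toReal := by
      have := (ENNReal.toReal_lt_toReal (by norm_num) hqt).2 hq2
      simpa using this
    have hp2 : q'.toReal < 2 := by
      have h3 := hr.inv_add_inv_eq_one
      have h4 : (q.toReal)⁻¹ < 2⁻¹ := (inv_lt_inv₀ (by linarith) (by norm_num)).2 hq2'
      have h5 : (2 : ℝ)⁻¹ < (q'.toReal)⁻¹ := by linarith
      exact (inv_lt_inv₀ (by norm_num) hr.symm.pos).1 h5
    have key := eLpNorm_apply_le_of_L2_of_L1 (T := U t s) (A := D ^ (n / 2 : ℝ)) (by positivity)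
      hr.symm hp2 (fun u => (hU.norm_apply t s u).le) h1 (u := φ)
      ⟨(Lp.memLp φ).aestronglyMeasurable, by rwa [ENNReal.ofReal_toReal hq't, lt_top_iff_ne_top]⟩
    rw [ENNReal.ofReal_toReal hq't, ENNReal.ofReal_toReal hqt] at key
    refine key.trans (le_of_eq ?_)
    rw [ENNReal.ofReal_rpow_of_pos hD, ← Real.rpow_mul hD.le, one_div q, ENNReal.toReal_inv]
    congr 3
    ring

/-- The exponent `θ` lies in `[0, n/2]` for all `q ≥ 2`; replacing the base by its maximum with `1`
permits raising it to the power `n/2`, a constant independent of `q`. -/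
theorem IsPropagator.eLpNorm_apply_le_of_le_abs (hm : 0 < m) (hσ : MemLp σ ∞ volume)
    (hU : IsPropagator n m σ U) {t : ℝ} {z vz e ve : ℝ → ℝ}
    (h : IsNormalizedPair (fun t => ∫ τ in (0 : ℝ)..t, σ τ) m t z vz e ve) {s κ d γ : ℝ}
    (hκ : 0 < κ) (hd : 0 < d) (hs : κ * d ^ γ ≤ |e s|) {q q' : ℝ≥0∞} (hq : 2 ≤ q)
    (hqq : q.HolderConjugate q') (φ : L2Space n) :
    eLpNorm (U t s φ) q volume ≤
      (max 1 (m / (2 * Real.pi * κ)).toNNReal ^ (n / 2 : ℝ) : ℝ≥0) *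
        ENNReal.ofReal d ^ (-((n : ℝ) * γ * (1 / 2 - (1 / q).toReal))) *
        eLpNorm φ q' volume := by
  have hdγ : 0 < d ^ γ := Real.rpow_pos_of_pos hd γ
  have he : 0 < |e s| := (mul_pos hκ hdγ).trans_le hs
  refine (hU.eLpNorm_apply_le hm hσ h (abs_pos.1 he) hq hqq φ).trans ?_
  gcongr
  have hq1 : (1 / q).toReal ≤ 1 / 2 := by
    have : (1 / q) ≤ 1 / 2 := ENNReal.div_le_div_left hq 1
    have := ENNReal.toReal_mono (by norm_num) this
    simpa using this
  have hθ : 0 ≤ (n : ℝ) * (1 / 2 - (1 / q).toReal) :=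
    mul_nonneg (Nat.cast_nonneg n) (by linarith)
  have hθ2 : (n : ℝ) * (1 / 2 - (1 / q).toReal) ≤ n / 2 := by
    have : (0 : ℝ) ≤ (n : ℝ) * (1 / q).toReal := by positivity
    linarith
  set θ := (n : ℝ) * (1 / 2 - (1 / q).toReal) with hθdef
  have e1 : -((n : ℝ) * γ * (1 / 2 - (1 / q).toReal)) = γ * -θ := by
    rw [hθdef]
    ring
  calc ENNReal.ofReal (m / (2 * Real.pi * |e s|)) ^ θ
      ≤ ENNReal.ofReal (m / (2 * Real.pi * κ) * (d ^ γ)⁻¹) ^ θ := by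
        refine ENNReal.rpow_le_rpow (ENNReal.ofReal_le_ofReal ?_) hθ
        rw [← div_eq_mul_inv, div_div, mul_assoc (2 * Real.pi)]
        gcongr
    _ = ENNReal.ofReal (m / (2 * Real.pi * κ)) ^ θ *
          ENNReal.ofReal d ^ (-((n : ℝ) * γ * (1 / 2 - (1 / q).toReal))) := by
        rw [ENNReal.ofReal_mul (by positivity), ENNReal.mul_rpow_of_nonneg _ _ hθ, e1,
          ENNReal.rpow_mul (ENNReal.ofReal d), ENNReal.ofReal_rpow_of_pos hd,
          ENNReal.ofReal_inv_of_pos hdγ, ENNReal.rpow_neg, ENNReal.inv_rpow]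
    _ ≤ _ := by
        gcongr
        rw [ENNReal.coe_rpow_of_nonneg _ (by positivity)]
        calc ENNReal.ofReal (m / (2 * Real.pi * κ)) ^ θ
            ≤ (max 1 (m / (2 * Real.pi * κ)).toNNReal : ℝ≥0) ^ θ := by
              refine ENNReal.rpow_le_rpow ?_ hθ
              exact ENNReal.coe_le_coe.2 (le_max_right _ _)
          _ ≤ _ := ENNReal.rpow_le_rpow_of_exponent_le
              (ENNReal.one_le_coe_iff.2 (le_max_left _ _)) hθ2

/-- On the diagonal with `q > 2` the right side is infinite unless `φ = 0`; here `n ≥ 1` makes the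
exponent strictly negative. For `q = 2` the power is `0^0 = 1`, and `1 ≤ C` is what is needed. -/
theorem IsPropagator.eLpNorm_apply_self_le (hn : 1 ≤ n) (hU : IsPropagator n m σ U) (t : ℝ)
    {C : ℝ≥0} (hC : 1 ≤ C) {q q' : ℝ≥0∞} (hq : 2 ≤ q) (hqq : q.HolderConjugate q')
    (φ : L2Space n) :
    eLpNorm (U t t φ) q volume ≤
      C * ENNReal.ofReal |t - t| ^ (-((n : ℝ) * (1 / 2 - (1 / q).toReal))) *
        eLpNorm φ q' volume := by
  have hconj : q' = 1 + (q - 1)⁻¹ := ENNReal.HolderConjugate.conj_eq (h := hqq)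
  have hC' : (1 : ℝ≥0∞) ≤ C := ENNReal.one_le_coe_iff.2 hC
  rcases eq_or_lt_of_le hq with rfl | hq2
  · have hq1 : q' = 2 := by
      rw [hconj, ← one_add_one_eq_two, ENNReal.add_sub_cancel_right ENNReal.one_ne_top, inv_one]
    subst hq1
    rw [hU.eLpNorm_apply_two]
    simpa using mul_le_mul_left hC' (eLpNorm φ 2 volume)
  · have hθ : 0 < (n : ℝ) * (1 / 2 - (1 / q).toReal) := by
      have h1 : (1 / q) < 1 / 2 := by
        rw [one_div, one_div]
        exact ENNReal.inv_lt_inv.2 hq2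
      have := (ENNReal.toReal_lt_toReal h1.ne_top (by norm_num)).2 h1
      have h2 : (1 / q).toReal < 1 / 2 := by simpa using this
      have h3 : (0 : ℝ) < n := by exact_mod_cast hn
      exact mul_pos h3 (by linarith)
    rw [sub_self, abs_zero, ENNReal.ofReal_zero, ENNReal.zero_rpow_of_neg (neg_lt_zero.2 hθ),
      ENNReal.mul_top (by positivity)]
    rcases eq_or_ne (eLpNorm φ q' volume) 0 with h0 | h0
    · have hq'0 : q' ≠ 0 := by simp [hconj]
      have hφ : φ = 0 := (Lp.eq_zero_iff_ae_eq_zero).2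
        ((eLpNorm_eq_zero_iff (Lp.aestronglyMeasurable φ) hq'0).1 h0)
      rw [hφ, map_zero, eLpNorm_congr_ae (Lp.coeFn_zero ℂ 2 volume), eLpNorm_zero]
      exact zero_le
    · rw [ENNReal.top_mul h0]
      exact le_top

end Propagator

end

/-! ### Assembly of the estimates. -/

theorem lemma2p3 (n : ℕ) (hn : 1 ≤ n) (m : ℝ) (hm : 0 < m) (σ y₁ y₂ : ℝ → ℝ)
    (lam c₁p c₁m c₂p c₂m : ℝ)
    (hA : CoefficientAssumption m σ y₁ y₂ lam c₁p c₁m c₂p c₂m)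
    (U : ℝ → ℝ → (L2Space n →L[ℂ] L2Space n)) (hU : IsPropagator n m σ U) :
    (∃ r₀ : ℝ, IsCutoffRadius y₁ y₂ lam c₁p c₁m c₂p c₂m r₀) ∧
    ∀ r₀ : ℝ, IsCutoffRadius y₁ y₂ lam c₁p c₁m c₂p c₂m r₀ →
      ∃ C : ℝ≥0, 0 < C ∧
        ∀ (q q' : ℝ≥0∞), 2 ≤ q → ENNReal.HolderConjugate q q' →
        ∀ (ε : ℝ), (ε = 1 ∨ ε = -1) → ∀ (t s : ℝ) (φ : L2Space n),
          ((t, s) ∈ comparableRegion r₀ ε →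
            eLpNorm (U t 0 (ContinuousLinearMap.adjoint (U s 0) φ)) q volume ≤
              C * ENNReal.ofReal |t - s| ^ (-((n : ℝ) * (1 / 2 - (1 / q).toReal))) *
                eLpNorm φ q' volume) ∧
          ((t, s) ∈ nonComparableRegion r₀ ε →
            eLpNorm (U t 0 (ContinuousLinearMap.adjoint (U s 0) φ)) q volume ≤
              C * ENNReal.ofReal |t - s| ^ (-((n : ℝ) * (1 - lam) * (1 / 2 - (1 / q).toReal))) *
                eLpNorm φ q' volume) := by
  refine ⟨hA.exists_isCutoffRadius, fun r₀ hr => ?_⟩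
  -- The smaller of the two lower bound constants for `|e s|`, so that one `C` serves both regions.
  set κ : ℝ := min (1 / 32) (r₀ ^ lam / 64) with hκdef
  have hrp : 0 < r₀ ^ lam := Real.rpow_pos_of_pos hr.pos lam
  have hκ : 0 < κ := lt_min (by norm_num) (by positivity)
  have hC : (1 : ℝ≥0) ≤ max 1 (m / (2 * Real.pi * κ)).toNNReal ^ (n / 2 : ℝ) :=
    NNReal.one_le_rpow (le_max_left _ _) (by positivity)
  refine ⟨_, one_pos.trans_le hC, fun q q' hq hqq ε hε t s φ => ?_⟩
  have hW := abs_pos.2 hA.wronskianConst_ne_zero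
  obtain ⟨z, vz, e, ve, hp, he⟩ := hA.exists_isNormalizedPair t
  rw [hU.apply_adjoint_apply]
  constructor
  · intro h
    rcases eq_or_ne t s with rfl | hts
    · exact hU.eLpNorm_apply_self_le hn t hC hq hqq φ
    · have hd : 0 < |t - s| := abs_pos.2 (sub_ne_zero.2 hts)
      have hle : κ * |t - s| ^ (1 : ℝ) ≤ |e s| := by
        rw [he, le_div_iff₀ hW, Real.rpow_one]
        refine le_trans ?_ (hr.le_abs_cross_of_mem_comparableRegion hA hε h)
        gcongr
        exact min_le_left _ _
      simpa only [mul_one] using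
        hU.eLpNorm_apply_le_of_le_abs hm hA.sigma_mem hp hκ hd hle hq hqq φ
  · intro h
    -- Equal times would give `|t| ≤ |t| / 2` or `2 |t| ≤ |t|`, impossible as `|t| > 0`.
    have hts : t ≠ s := by
      rintro rfl
      obtain ⟨-, h1, h2, -⟩ := h
      have h3 : 0 < |t| := abs_pos.2 fun h0 => by
        have := hr.pos
        simp only [h0, mul_zero] at h2
        linarith
      rcases h1 with h1 | h1 <;> simp only at h1 <;> linarith
    have hd : 0 < |t - s| := abs_pos.2 (sub_ne_zero.2 hts)
    have hle : κ * |t - s| ^ (1 - lam) ≤ |e s| := by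
      rw [he, le_div_iff₀ hW]
      refine le_trans ?_ (hr.le_abs_cross_of_mem_nonComparableRegion hA hε h)
      gcongr
      exact min_le_right _ _
    exact hU.eLpNorm_apply_le_of_le_abs hm hA.sigma_mem hp hκ hd hle hq hqq φ
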